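/- Let $\Bbbk$ be a commutative ring in which $2$ is invertible. A Lie superalgebra over $\Bbbk$ is a $\mathbb Z/2\mathbb Z$-graded module with an even bilinear super-skew-symmetric bracket satisfying the super Jacobi identity. Let $R$ be a unital associative $\Bbbk$-superalgebra with a superinvolution ${}^-$, i.e. an even $\Bbbk$-linear map with $\overline{ab}=(-1)^{|a||b|}\bar b\,\bar a$ for homogeneous $a,b$ and $\bar{\bar a}=a$. Put $\rho(a)=(-1)^{|a|}a$ for homogeneous $a$, and let $m\ge 3$. **The Lie superalgebra $\mathfrak p_m(R,{}^-)$.** The $2m\times 2m$ matrices over $R$ form a superalgebra with $|e_{ij}(a)|=|i|+|j|+|a|$, where $|i|=0$ for $i\le m$ and $|i|=1$ for $i>m$. The map $$\begin{pmatrix}A&B\\C&D\end{pmatrix}^{\mathrm{prp}}=\begin{pmatrix}\overline{D}^t&-\overline{\rho(B)}^t\\ \overline{\rho(C)}^t&\overline{A}^t\end{pmatrix}$$ is a superinvolution on it. Let $\widetilde{\mathfrak p}_m(R,{}^-)=\{X: X^{\mathrm{prp}}=-X\}$ with the supercommutator, and $\mathfrak p_m(R,{}^-)=[\widetilde{\mathfrak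 p}_m(R,{}^-),\widetilde{\mathfrak p}_m(R,{}^-)]$. For $1\le i\ne j\le m$ and $a\in R$ put $t_{ij}(a)=e_{ij}(a)-e_{m+j,m+i}(\bar a)$, $f_{ij}(a)=e_{i,m+j}(a)+e_{j,m+i}(\rho(\bar a))$, $g_{ij}(a)=e_{m+i,j}(a)-e_{m+j,i}(\rho(\bar a))$. **The Lie superalgebra $\mathfrak{stp}_m(R,{}^-)$.** It is the Lie superalgebra with generators $\mathbf t_{ij}(a),\mathbf f_{ij}(a),\mathbf g_{ij}(a)$ of parities $|a|,|a|+1,|a|+1$, for $1\le i\neq j\le m$ and homogeneous $a\in R$, and the following relations, for homogeneous $a,b\in R$ and indices $i,j,k,l\in\{1,\dots,m\}$: - $\mathbf t_{ij},\mathbf f_{ij},\mathbf g_{ij}$ are $\Bbbk$-linear; - $\mathbf f_{ij}(\bar a)=\mathbf f_{ji}(\rho(a))$ and $\mathbf g_{ij}(\bar a)=-\mathbf g_{ji}(\rho(a))$ for $i\ne j$; - $[\mathbf t_{ij}(a),\mathbf t_{jk}(b)]=\mathbf t_{ik}(ab)$, $[\mathbf t_{ij}(a),\mathbf f_{jk}(b)]=\mathbf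 f_{ik}(ab)$, $[\mathbf g_{ij}(a),\mathbf t_{jk}(b)]=\mathbf g_{ik}(ab)$ and $[\mathbf f_{ij}(a),\mathbf g_{jk}(b)]=\mathbf t_{ik}(ab)$ for distinct $i,j,k$; - $[\mathbf t_{ij}(a),\mathbf t_{kl}(b)]=0$ if $i\neq j$, $j\ne k$, $k\neq l$, $l\ne i$; - $[\mathbf t_{ij}(a),\mathbf f_{kl}(b)]=0$ if $i\neq j$, $j\ne k$, $k\neq l$, $l\ne j$; - $[\mathbf g_{ij}(a),\mathbf t_{kl}(b)]=0$ if $i\neq j$, $k\neq l$, $k\ne i$, $k\ne j$; - $[\mathbf f_{ij}(a),\mathbf f_{kl}(b)]=[\mathbf g_{ij}(a),\mathbf g_{kl}(b)]=0$ if $i\ne j$ and $k\ne l$; - $[\mathbf f_{ij}(a),\mathbf g_{kl}(b)]=0$ for distinct $i,j,k,l$. **Dihedral homology.** For a superinvolution $\sigma$ on $R$ let $I\subseteq R\otimes_{\Bbbk}R$ be the submodule spanned by $a\otimes b+(-1)^{|a||b|}b\otimes a$, $a\otimes b+\sigma(a)\otimes\sigma(b)$ and $(-1)^{|a||c|}ab\otimes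 c+(-1)^{|b||a|}bc\otimes a+(-1)^{|c||b|}ca\otimes b$ for homogeneous $a,b,c\in R$. Let $\langle a,b\rangle$ be the class of $a\otimes b$ in $(R\otimes_{\Bbbk} R)/I$, and $${}_1^{+}\mathrm{HD}(R,\sigma)=\Big\{\sum_i\langle a_i,b_i\rangle\ \Big|\ \sigma\Big(\sum_i[a_i,b_i]\Big)=-\sum_i[a_i,b_i]\Big\}\subseteq (R\otimes_{\Bbbk} R)/I,$$ where $[\cdot,\cdot]$ is the supercommutator. **Statement.** The map ${}^-\circ\rho$ is a superinvolution on $R$. There is a unique homomorphism of Lie superalgebras $\psi:\mathfrak{stp}_m(R,{}^-)\to\mathfrak p_m(R,{}^-)$ with $\psi(\mathbf t_{ij}(a))=t_{ij}(a)$, $\psi(\mathbf f_{ij}(a))=f_{ij}(a)$ and $\psi(\mathbf g_{ij}(a))=g_{ij}(a)$ for all $i\ne j$ and homogeneous $a\in R$. It is surjective, its kernel is contained in the center of $\mathfrak{stp}_m(R,{}^-)$, and $$\ker\psi\;\cong\;{}_1^{+}\mathrm{HD}(R,{}^-\circ\rho)$$ as $\Bbbk$-modules. -/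

import Mathlib

open scoped TensorProduct

noncomputable section

namespace Periplectic

/-! ### Signs and homogeneous components -/

/-- The sign `(-1) ^ i` of a parity `i`. -/
def psign (i : ZMod 2) : ℤ := (-1) ^ i.val

/-- The Koszul sign `(-1) ^ (i * j)` of two parities. -/
def koszul (i j : ZMod 2) : ℤ := (-1) ^ (i * j).val

theorem psign_sq (i : ZMod 2) : psign i * psign i = 1 := by
  revert i; decide

theorem psign_add (i j : ZMod 2) : psign (i + j) = psign i * psign j := by
  revert i j; decide

theorem koszul_comm (i j : ZMod 2) : koszul i j = koszul j i := by
  revert i j; decide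

theorem koszul_sq (i j : ZMod 2) : koszul i j * koszul i j = 1 := by
  revert i j; decide

theorem koszul_add_left (i j l : ZMod 2) : koszul (i + j) l = koszul i l * koszul j l := by
  revert i j l; decide

theorem koszul_add_right (i j l : ZMod 2) : koszul i (j + l) = koszul i j * koszul i l := by
  revert i j l; decide

section Components

variable {k A : Type*} [CommRing k] [AddCommGroup A] [Module k A]
  (𝒜 : ZMod 2 → Submodule k A) [DirectSum.Decomposition 𝒜]

/-- The homogeneous component of parity `i`. -/
def comp (i : ZMod 2) : A →ₗ[k] A :=
  (𝒜 i).subtype ∘ₗ DirectSum.component k (ZMod 2) (fun j => 𝒜 j) i ∘ₗ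
    (DirectSum.decomposeLinearEquiv 𝒜).toLinearMap

/-- The sign map: `ρ a = (-1) ^ |a| a` for homogeneous `a`. -/
def rho : A →ₗ[k] A := ∑ i : ZMod 2, psign i • comp 𝒜 i

theorem comp_apply (i : ZMod 2) (a : A) :
    comp 𝒜 i a = (DirectSum.decompose 𝒜 a i : A) := rfl

theorem comp_mem (i : ZMod 2) (a : A) : comp 𝒜 i a ∈ 𝒜 i := by
  rw [comp_apply]; exact Subtype.property _

theorem comp_same {i : ZMod 2} {a : A} (ha : a ∈ 𝒜 i) : comp 𝒜 i a = a :=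
  DirectSum.decompose_of_mem_same 𝒜 ha

theorem comp_ne {i j : ZMod 2} {a : A} (ha : a ∈ 𝒜 i) (h : i ≠ j) : comp 𝒜 j a = 0 :=
  DirectSum.decompose_of_mem_ne 𝒜 ha h

theorem sum_zmod2 {M : Type*} [AddCommMonoid M] (f : ZMod 2 → M) :
    ∑ i, f i = f 0 + f 1 := Fin.sum_univ_two f

theorem sum_comp (a : A) : comp 𝒜 0 a + comp 𝒜 1 a = a := by
  classical
  have h := DirectSum.sum_support_decompose 𝒜 a
  rw [Finset.sum_subset (Finset.subset_univ _)] at h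
  · rw [sum_zmod2] at h
    exact h
  · intro i _ hi
    simpa using hi

theorem rho_of_mem {i : ZMod 2} {a : A} (ha : a ∈ 𝒜 i) : rho 𝒜 a = psign i • a := by
  rw [rho, LinearMap.sum_apply, Finset.sum_eq_single i]
  · rw [LinearMap.smul_apply, comp_same 𝒜 ha]
  · intro j _ hj
    rw [LinearMap.smul_apply, comp_ne 𝒜 ha hj.symm, smul_zero]
  · simp

end Components

/-! ### Lie superalgebras -/

/-- A Lie superalgebra structure on a module `L` over a commutative ring in which `2` is
invertible: a decomposition `L = L₀ ⊕ L₁` and a bilinear even bracket that is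
super-skew-symmetric and satisfies the super Jacobi identity. -/
structure LieSuperalgebra (k L : Type*) [CommRing k] [AddCommGroup L] [Module k L] where
  grade : ZMod 2 → Submodule k L
  isCompl : IsCompl (grade 0) (grade 1)
  bracket : L →ₗ[k] L →ₗ[k] L
  bracket_mem : ∀ {i j : ZMod 2} {x y : L}, x ∈ grade i → y ∈ grade j →
    bracket x y ∈ grade (i + j)
  skew : ∀ {i j : ZMod 2} {x y : L}, x ∈ grade i → y ∈ grade j →
    bracket x y = -(koszul i j • bracket y x)
  jacobi : ∀ {i j l : ZMod 2} {x y z : L}, x ∈ grade i → y ∈ grade j → z ∈ grade l →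
    bracket x (bracket y z) = bracket (bracket x y) z + koszul i j • bracket y (bracket x z)

/-- Homomorphisms of Lie superalgebras: even linear maps that preserve the bracket. -/
@[ext]
structure LieSuperHom {k L L' : Type*} [CommRing k] [AddCommGroup L] [Module k L]
    [AddCommGroup L'] [Module k L'] (S : LieSuperalgebra k L) (S' : LieSuperalgebra k L') where
  toLinearMap : L →ₗ[k] L'
  map_grade : ∀ {i : ZMod 2} {x : L}, x ∈ S.grade i → toLinearMap x ∈ S'.grade i
  map_bracket : ∀ x y : L,
    toLinearMap (S.bracket x y) = S'.bracket (toLinearMap x) (toLinearMap y)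

/-- A graded submodule closed under the bracket. -/
structure LieSubsuperalgebra {k L : Type*} [CommRing k] [AddCommGroup L] [Module k L]
    (S : LieSuperalgebra k L) where
  carrier : Submodule k L
  graded : carrier ≤ (carrier ⊓ S.grade 0) ⊔ (carrier ⊓ S.grade 1)
  bracket_mem : ∀ {x y : L}, x ∈ carrier → y ∈ carrier → S.bracket x y ∈ carrier

section Sub

variable {k L : Type*} [CommRing k] [AddCommGroup L] [Module k L] {S : LieSuperalgebra k L}

/-- The Lie superalgebra structure of a Lie sub-superalgebra. -/
def LieSubsuperalgebra.lie (N : LieSubsuperalgebra S) : LieSuperalgebra k N.carrier where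
  grade i := (S.grade i).comap N.carrier.subtype
  isCompl := by
    constructor
    · rw [Submodule.disjoint_def]
      intro x h0 h1
      exact Subtype.ext ((Submodule.disjoint_def.1 S.isCompl.disjoint) x.1 h0 h1)
    · rw [codisjoint_iff_le_sup]
      rintro ⟨x, hx⟩ -
      obtain ⟨a, ha, b, hb, hab⟩ := Submodule.mem_sup.1 (N.graded hx)
      exact Submodule.mem_sup.2
        ⟨⟨a, ha.1⟩, ha.2, ⟨b, hb.1⟩, hb.2, Subtype.ext hab⟩
  bracket := LinearMap.mk₂ k (fun x y => ⟨S.bracket x.1 y.1, N.bracket_mem x.2 y.2⟩)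
    (fun _ _ _ => Subtype.ext (by simp)) (fun _ _ _ => Subtype.ext (by simp))
    (fun _ _ _ => Subtype.ext (by simp)) (fun _ _ _ => Subtype.ext (by simp))
  bracket_mem hx hy := S.bracket_mem hx hy
  skew hx hy := Subtype.ext (S.skew hx hy)
  jacobi hx hy hz := Subtype.ext (S.jacobi hx hy hz)

variable (S) in
/-- The derived Lie sub-superalgebra `[L, L]`, spanned by all brackets. -/
def derived : LieSubsuperalgebra S where
  carrier := Submodule.span k {z | ∃ x y : L, z = S.bracket x y}
  graded := by
    have hom : ∀ {i j : ZMod 2} {x y : L}, x ∈ S.grade i → y ∈ S.grade j →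
        S.bracket x y ∈
          (Submodule.span k {z | ∃ x y : L, z = S.bracket x y} ⊓ S.grade 0) ⊔
          (Submodule.span k {z | ∃ x y : L, z = S.bracket x y} ⊓ S.grade 1) := by
      intro i j x y hx hy
      have h1 := S.bracket_mem hx hy
      have h2 : S.bracket x y ∈ Submodule.span k {z | ∃ x y : L, z = S.bracket x y} :=
        Submodule.subset_span ⟨x, y, rfl⟩
      generalize i + j = d at h1
      fin_cases d
      · exact Submodule.mem_sup_left ⟨h2, h1⟩
      · exact Submodule.mem_sup_right ⟨h2, h1⟩
    rw [Submodule.span_le]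
    rintro z ⟨x, y, rfl⟩
    obtain ⟨x0, hx0, x1, hx1, rfl⟩ := Submodule.mem_sup.1
      (S.isCompl.sup_eq_top.ge (Submodule.mem_top (x := x)))
    obtain ⟨y0, hy0, y1, hy1, rfl⟩ := Submodule.mem_sup.1
      (S.isCompl.sup_eq_top.ge (Submodule.mem_top (x := y)))
    simp only [map_add, LinearMap.add_apply]
    exact add_mem (add_mem (hom hx0 hy0) (hom hx1 hy0)) (add_mem (hom hx0 hy1) (hom hx1 hy1))
  bracket_mem := fun {x y} _ _ => Submodule.subset_span ⟨x, y, rfl⟩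

end Sub

/-! ### Associative superalgebras and superinvolutions -/

section Assoc

variable {k A : Type*} [CommRing k] [Ring A] [Algebra k A]
  (𝒜 : ZMod 2 → Submodule k A) [GradedAlgebra 𝒜]

/-- The supercommutator: `[a, b] = a b - (-1) ^ (|a| |b|) b a` for homogeneous `a`, `b`. -/
def superBracket : A →ₗ[k] A →ₗ[k] A :=
  ∑ i : ZMod 2, ∑ j : ZMod 2,
    (LinearMap.mul k A - koszul i j • (LinearMap.mul k A).flip).compl₁₂ (comp 𝒜 i) (comp 𝒜 j)

theorem superBracket_of_mem {i j : ZMod 2} {a b : A} (ha : a ∈ 𝒜 i) (hb : b ∈ 𝒜 j) :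
    superBracket 𝒜 a b = a * b - koszul i j • (b * a) := by
  simp only [superBracket, LinearMap.sum_apply]
  rw [Finset.sum_eq_single i, Finset.sum_eq_single j]
  · simp [comp_same 𝒜 ha, comp_same 𝒜 hb]
  · intro l _ hl
    simp [comp_ne 𝒜 hb hl.symm]
  · simp
  · intro l _ hl
    simp [comp_ne 𝒜 ha hl.symm]
  · simp

/-- An associative superalgebra as a Lie superalgebra under the supercommutator. -/
def superLie : LieSuperalgebra k A where
  grade := 𝒜
  isCompl := by
    constructor
    · rw [Submodule.disjoint_def]
      intro x h0 h1
      rw [← comp_same 𝒜 h0]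
      exact comp_ne 𝒜 h1 (by decide)
    · rw [codisjoint_iff_le_sup]
      intro x _
      exact Submodule.mem_sup.2
        ⟨comp 𝒜 0 x, comp_mem 𝒜 0 x, comp 𝒜 1 x, comp_mem 𝒜 1 x, sum_comp 𝒜 x⟩
  bracket := superBracket 𝒜
  bracket_mem := by
    intro i j x y hx hy
    rw [superBracket_of_mem 𝒜 hx hy]
    refine sub_mem (SetLike.mul_mem_graded hx hy) (zsmul_mem ?_ _)
    rw [add_comm]
    exact SetLike.mul_mem_graded hy hx
  skew := by
    intro i j x y hx hy
    rw [superBracket_of_mem 𝒜 hx hy, superBracket_of_mem 𝒜 hy hx, koszul_comm j i, smul_sub,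
      smul_smul, koszul_sq, one_smul, neg_sub]
  jacobi := by
    intro i j l x y z hx hy hz
    have h1 : ∀ {i j : ZMod 2} {x y : A}, x ∈ 𝒜 i → y ∈ 𝒜 j →
        x * y - koszul i j • (y * x) ∈ 𝒜 (i + j) := by
      intro i j x y hx hy
      refine sub_mem (SetLike.mul_mem_graded hx hy) (zsmul_mem ?_ _)
      rw [add_comm]
      exact SetLike.mul_mem_graded hy hx
    rw [superBracket_of_mem 𝒜 hy hz, superBracket_of_mem 𝒜 hx hy, superBracket_of_mem 𝒜 hx hz,
      superBracket_of_mem 𝒜 hx (h1 hy hz), superBracket_of_mem 𝒜 (h1 hx hy) hz,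
      superBracket_of_mem 𝒜 hy (h1 hx hz), koszul_add_left, koszul_add_right, koszul_add_right,
      koszul_comm j i]
    simp only [mul_sub, sub_mul, smul_sub, smul_smul, mul_smul_comm, smul_mul_assoc, mul_assoc]
    have e := koszul_sq i j
    have e1 : koszul i j * (koszul i j * koszul j l * koszul i l) =
        koszul i l * koszul j l := by linear_combination (koszul i l * koszul j l) * e
    have e2 : koszul i j * (koszul i j * koszul j l) = koszul j l := by
      linear_combination (koszul j l) * e
    simp only [mul_left_comm, mul_comm] at *
    simp only [e1, e2]
    abel

/-- A superinvolution: an even linear map with `σ (a b) = (-1) ^ (|a| |b|) σ b σ a` for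
homogeneous `a`, `b` and `σ (σ a) = a`. -/
structure SuperInvolution {k A : Type*} [CommRing k] [Ring A] [Algebra k A]
    (𝒜 : ZMod 2 → Submodule k A) where
  toFun : A →ₗ[k] A
  map_mem : ∀ {i : ZMod 2} {a : A}, a ∈ 𝒜 i → toFun a ∈ 𝒜 i
  map_mul : ∀ {i j : ZMod 2} {a b : A}, a ∈ 𝒜 i → b ∈ 𝒜 j →
    toFun (a * b) = koszul i j • (toFun b * toFun a)
  invol : ∀ a : A, toFun (toFun a) = a

variable {𝒜}

theorem SuperInvolution.map_comp (σ : SuperInvolution 𝒜) (i : ZMod 2) (a : A) :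
    σ.toFun (comp 𝒜 i a) = comp 𝒜 i (σ.toFun a) := by
  have h0 := σ.map_mem (comp_mem 𝒜 0 a)
  have h1 := σ.map_mem (comp_mem 𝒜 1 a)
  conv_rhs => rw [← sum_comp 𝒜 a, map_add, map_add]
  fin_cases i
  · change _ = comp 𝒜 0 _ + comp 𝒜 0 _
    rw [comp_same 𝒜 h0, comp_ne 𝒜 h1 (by decide), add_zero]; rfl
  · change _ = comp 𝒜 1 _ + comp 𝒜 1 _
    rw [comp_same 𝒜 h1, comp_ne 𝒜 h0 (by decide), zero_add]; rfl

/-- The twisted superinvolution `σ ∘ ρ`. -/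
def SuperInvolution.twist (σ : SuperInvolution 𝒜) : SuperInvolution 𝒜 where
  toFun := σ.toFun ∘ₗ rho 𝒜
  map_mem := by
    intro i a ha
    rw [LinearMap.comp_apply, rho_of_mem 𝒜 ha, map_zsmul]
    exact zsmul_mem (σ.map_mem ha) _
  map_mul := by
    intro i j a b ha hb
    simp only [LinearMap.comp_apply]
    rw [rho_of_mem 𝒜 ha, rho_of_mem 𝒜 hb, rho_of_mem 𝒜 (SetLike.mul_mem_graded ha hb),
      map_zsmul, map_zsmul, map_zsmul, σ.map_mul ha hb, smul_mul_smul_comm, smul_smul, smul_smul,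
      psign_add]
    congr 1
    ring
  invol := by
    intro a
    have key : ∀ {i : ZMod 2} {a : A}, a ∈ 𝒜 i →
        (σ.toFun ∘ₗ rho 𝒜) ((σ.toFun ∘ₗ rho 𝒜) a) = a := by
      intro i a ha
      simp only [LinearMap.comp_apply]
      rw [rho_of_mem 𝒜 ha, map_zsmul, map_zsmul, rho_of_mem 𝒜 (σ.map_mem ha), map_zsmul,
        map_zsmul, σ.invol, smul_smul, psign_sq, one_smul]
    conv_lhs => rw [← sum_comp 𝒜 a]
    rw [map_add, map_add, key (comp_mem 𝒜 0 a), key (comp_mem 𝒜 1 a), sum_comp]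

/-- The Lie superalgebra of elements that are skew-symmetric for a superinvolution. -/
def skewElements (σ : SuperInvolution 𝒜) : LieSubsuperalgebra (superLie 𝒜) where
  carrier :=
    { carrier := {x | σ.toFun x = -x}
      zero_mem' := by simp
      add_mem' := by
        intro a b ha hb
        simp only [Set.mem_ofPred_eq] at *
        rw [map_add, ha, hb, neg_add]
      smul_mem' := by
        intro c a ha
        simp only [Set.mem_ofPred_eq] at *
        rw [map_smul, ha, smul_neg] }
  graded := by
    intro x hx
    have h : ∀ i, σ.toFun (comp 𝒜 i x) = -comp 𝒜 i x := by
      intro i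
      rw [σ.map_comp, show σ.toFun x = -x from hx, map_neg]
    exact Submodule.mem_sup.2 ⟨comp 𝒜 0 x, ⟨h 0, comp_mem 𝒜 0 x⟩,
      comp 𝒜 1 x, ⟨h 1, comp_mem 𝒜 1 x⟩, sum_comp 𝒜 x⟩
  bracket_mem := by
    intro x y hx hy
    have h : ∀ {z : A}, σ.toFun z = -z → ∀ i, σ.toFun (comp 𝒜 i z) = -comp 𝒜 i z := by
      intro z hz i
      rw [σ.map_comp, hz, map_neg]
    have key : ∀ {i j : ZMod 2} {a b : A}, a ∈ 𝒜 i → b ∈ 𝒜 j → σ.toFun a = -a →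
        σ.toFun b = -b → σ.toFun (superBracket 𝒜 a b) = -superBracket 𝒜 a b := by
      intro i j a b ha hb ea eb
      rw [superBracket_of_mem 𝒜 ha hb, map_sub, map_zsmul, σ.map_mul ha hb, σ.map_mul hb ha,
        ea, eb, smul_smul, koszul_comm j i, koszul_sq, one_smul, neg_mul_neg, neg_mul_neg, neg_sub]
    change σ.toFun (superBracket 𝒜 x y) = -superBracket 𝒜 x y
    rw [← sum_comp 𝒜 x, ← sum_comp 𝒜 y]
    simp only [map_add, LinearMap.add_apply]
    rw [key (comp_mem 𝒜 0 x) (comp_mem 𝒜 0 y) (h hx 0) (h hy 0),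
      key (comp_mem 𝒜 0 x) (comp_mem 𝒜 1 y) (h hx 0) (h hy 1),
      key (comp_mem 𝒜 1 x) (comp_mem 𝒜 0 y) (h hx 1) (h hy 0),
      key (comp_mem 𝒜 1 x) (comp_mem 𝒜 1 y) (h hx 1) (h hy 1)]
    abel

/-! ### The first dihedral homology -/

/-- The submodule `I` of `A ⊗ A`. -/
def dihedralRel (σ : SuperInvolution 𝒜) : Submodule k (A ⊗[k] A) :=
  Submodule.span k
    ({z | ∃ (i j : ZMod 2) (a b : A), a ∈ 𝒜 i ∧ b ∈ 𝒜 j ∧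
        z = a ⊗ₜ[k] b + koszul i j • (b ⊗ₜ[k] a)} ∪
     {z | ∃ (i j : ZMod 2) (a b : A), a ∈ 𝒜 i ∧ b ∈ 𝒜 j ∧
        z = a ⊗ₜ[k] b + σ.toFun a ⊗ₜ[k] σ.toFun b} ∪
     {z | ∃ (i j l : ZMod 2) (a b c : A), a ∈ 𝒜 i ∧ b ∈ 𝒜 j ∧ c ∈ 𝒜 l ∧
        z = koszul i l • ((a * b) ⊗ₜ[k] c) + koszul j i • ((b * c) ⊗ₜ[k] a) +
          koszul l j • ((c * a) ⊗ₜ[k] b)})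

/-- The first `ℤ/2ℤ`-graded dihedral homology: the submodule of `(A ⊗ A) / I` of all classes
`∑ ⟨aᵢ, bᵢ⟩` with `σ (∑ [aᵢ, bᵢ]) = - ∑ [aᵢ, bᵢ]`. -/
def dihedralHomology (σ : SuperInvolution 𝒜) : Submodule k ((A ⊗[k] A) ⧸ dihedralRel σ) :=
  (LinearMap.ker ((σ.toFun + LinearMap.id) ∘ₗ TensorProduct.lift (superBracket 𝒜))).map
    (dihedralRel σ).mkQ

end Assoc

/-! ### Matrix superalgebras and periplectic Lie superalgebras -/

section Matrices

variable {k R : Type*} [CommRing k] [Ring R] [Algebra k R]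
  (𝒜 : ZMod 2 → Submodule k R) (m : ℕ)

/-- `2m × 2m` matrices, with rows and columns indexed by two copies of `Fin m`. -/
abbrev Mat (m : ℕ) (R : Type*) := Matrix (Fin m ⊕ Fin m) (Fin m ⊕ Fin m) R

/-- The parity of an index. -/
def idx {m : ℕ} : Fin m ⊕ Fin m → ZMod 2 := Sum.elim (fun _ => 0) (fun _ => 1)

/-- The grading `|e_{pq}(a)| = |p| + |q| + |a|` on matrices. -/
def matGrade (d : ZMod 2) : Submodule k (Mat m R) where
  carrier := {X | ∀ p q, X p q ∈ 𝒜 (idx p + idx q + d)}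
  zero_mem' := fun _ _ => zero_mem _
  add_mem' := fun hX hY p q => add_mem (hX p q) (hY p q)
  smul_mem' := fun c _ hX p q => Submodule.smul_mem _ c (hX p q)

variable [GradedAlgebra 𝒜]

/-- The homogeneous component of parity `d` of a matrix. -/
def matComp (d : ZMod 2) (X : Mat m R) : Mat m R :=
  Matrix.of fun p q => comp 𝒜 (idx p + idx q + d) (X p q)

theorem matComp_mem (d : ZMod 2) (X : Mat m R) : matComp 𝒜 m d X ∈ matGrade 𝒜 m d :=
  fun _ _ => comp_mem 𝒜 _ _

instance matGradedMonoid : SetLike.GradedMonoid (matGrade 𝒜 m) where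
  one_mem := by
    intro p q
    by_cases h : p = q
    · subst h
      rw [Matrix.one_apply_eq, CharTwo.add_self_eq_zero, add_zero]
      exact SetLike.one_mem_graded 𝒜
    · rw [Matrix.one_apply_ne h]
      exact zero_mem _
  mul_mem := by
    intro d e X Y hX hY p q
    rw [Matrix.mul_apply]
    refine sum_mem fun r _ => ?_
    have h := SetLike.mul_mem_graded (hX p r) (hY r q)
    have e1 : idx p + idx r + d + (idx r + idx q + e) = idx p + idx q + (d + e) := by
      generalize idx p = a, idx q = b, idx r = c
      clear h hX hY
      revert a b c d e; decide
    rwa [e1] at h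

instance matGradedAlgebra : GradedAlgebra (matGrade 𝒜 m) where
  toGradedMonoid := matGradedMonoid 𝒜 m
  toDecomposition :=
    { decompose' := fun X => ∑ d : ZMod 2,
        DirectSum.of (fun d => matGrade 𝒜 m d) d ⟨matComp 𝒜 m d X, matComp_mem 𝒜 m d X⟩
      left_inv := by
        intro X
        rw [map_sum, sum_zmod2, DirectSum.coeAddMonoidHom_of, DirectSum.coeAddMonoidHom_of]
        ext p q
        change comp 𝒜 (idx p + idx q + 0) (X p q) + comp 𝒜 (idx p + idx q + 1) (X p q) = X p q
        generalize idx p + idx q = c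
        fin_cases c
        · exact sum_comp 𝒜 _
        · rw [add_comm]
          exact sum_comp 𝒜 _
      right_inv := by
        intro x
        induction x using DirectSum.induction_on with
        | zero =>
          rw [map_zero]
          refine Finset.sum_eq_zero fun d _ => ?_
          have : (⟨matComp 𝒜 m d 0, matComp_mem 𝒜 m d 0⟩ : matGrade 𝒜 m d) = 0 :=
            Subtype.ext (by ext p q; simp [matComp])
          rw [this, map_zero]
        | of d X =>
          rw [DirectSum.coeAddMonoidHom_of]
          change ∑ e : ZMod 2, DirectSum.of (fun d => matGrade 𝒜 m d) e
            ⟨matComp 𝒜 m e X, matComp_mem 𝒜 m e X⟩ = _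
          rw [Finset.sum_eq_single d]
          · congr 1
            refine Subtype.ext ?_
            ext p q
            exact comp_same 𝒜 (X.2 p q)
          · intro e _ he
            have : (⟨matComp 𝒜 m e X, matComp_mem 𝒜 m e X⟩ : matGrade 𝒜 m e) = 0 := by
              refine Subtype.ext ?_
              ext p q
              exact comp_ne 𝒜 (X.2 p q) (fun h => he (add_left_cancel h).symm)
            rw [this, map_zero]
          · simp
        | add x y hx hy =>
          rw [map_add]
          conv_rhs => rw [← hx, ← hy]
          rw [← Finset.sum_add_distrib]
          refine Finset.sum_congr rfl fun d _ => ?_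
          refine Eq.trans (congrArg (DirectSum.of (fun d => matGrade 𝒜 m d) d) (Subtype.ext ?_))
            (map_add (DirectSum.of (fun d => matGrade 𝒜 m d) d) _ _)
          ext p q
          simp [matComp] }

variable {𝒜} (bar : SuperInvolution 𝒜)

/-- The periplectic transpose
`(A, B; C, D) ↦ (σ(D)ᵗ, -σ(ρ(B))ᵗ; σ(ρ(C))ᵗ, σ(A)ᵗ)` with `σ`, `ρ` applied entrywise. -/
def prpFun (X : Mat m R) : Mat m R :=
  Matrix.fromBlocks
    (X.toBlocks₂₂.map bar.toFun).transpose
    (-(X.toBlocks₁₂.map fun a => bar.toFun (rho 𝒜 a)).transpose)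
    (X.toBlocks₂₁.map fun a => bar.toFun (rho 𝒜 a)).transpose
    (X.toBlocks₁₁.map bar.toFun).transpose

/-- The sign in front of the `(p, q)` entry, `|p| = a`, `|q| = b`, for matrices of parity `d`. -/
def prpSign (a b d : ZMod 2) : ℤ :=
  if a = b then 1 else if a = 0 then -psign (1 + d) else psign (1 + d)

theorem idx_swap {m : ℕ} (p : Fin m ⊕ Fin m) : idx p.swap = idx p + 1 := by
  rcases p with i | i
  · change (1 : ZMod 2) = 0 + 1
    decide
  · change (0 : ZMod 2) = 1 + 1
    decide

theorem prpFun_apply {d : ZMod 2} {X : Mat m R} (hX : X ∈ matGrade 𝒜 m d)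
    (p q : Fin m ⊕ Fin m) :
    prpFun m bar X p q = prpSign (idx p) (idx q) d • bar.toFun (X q.swap p.swap) := by
  rcases p with i | i <;> rcases q with j | j
  · change bar.toFun (X (Sum.inr j) (Sum.inr i)) =
      prpSign 0 0 d • bar.toFun (X (Sum.inr j) (Sum.inr i))
    rw [prpSign, if_pos rfl, one_smul]
  · change -bar.toFun (rho 𝒜 (X (Sum.inl j) (Sum.inr i))) =
      prpSign 0 1 d • bar.toFun (X (Sum.inl j) (Sum.inr i))
    have h : X (Sum.inl j) (Sum.inr i) ∈ 𝒜 (0 + 1 + d) := hX (Sum.inl j) (Sum.inr i)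
    rw [rho_of_mem 𝒜 h, map_zsmul, zero_add, prpSign, if_neg (by decide), if_pos rfl, neg_smul]
  · change bar.toFun (rho 𝒜 (X (Sum.inr j) (Sum.inl i))) =
      prpSign 1 0 d • bar.toFun (X (Sum.inr j) (Sum.inl i))
    have h : X (Sum.inr j) (Sum.inl i) ∈ 𝒜 (1 + 0 + d) := hX (Sum.inr j) (Sum.inl i)
    rw [rho_of_mem 𝒜 h, map_zsmul, add_zero, prpSign, if_neg (by decide), if_neg (by decide)]
  · change bar.toFun (X (Sum.inl j) (Sum.inl i)) =
      prpSign 1 1 d • bar.toFun (X (Sum.inl j) (Sum.inl i))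
    rw [prpSign, if_pos rfl, one_smul]

theorem prpFun_mem {d : ZMod 2} {X : Mat m R} (hX : X ∈ matGrade 𝒜 m d) :
    prpFun m bar X ∈ matGrade 𝒜 m d := by
  intro p q
  rw [prpFun_apply m bar hX]
  refine zsmul_mem ?_ _
  have h := bar.map_mem (hX q.swap p.swap)
  have e : idx q.swap + idx p.swap + d = idx p + idx q + d := by
    rw [idx_swap, idx_swap]
    generalize idx p = a, idx q = b
    clear h hX
    revert a b d; decide
  rwa [e] at h

/-- The periplectic superinvolution of the superalgebra of `2m × 2m` matrices. -/
def prp : SuperInvolution (matGrade 𝒜 m) where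
  toFun :=
    { toFun := prpFun m bar
      map_add' := by
        intro X Y
        ext p q
        rcases p with i | i <;> rcases q with j | j <;>
          simp [prpFun, Matrix.toBlocks₁₁, Matrix.toBlocks₁₂, Matrix.toBlocks₂₁,
            Matrix.toBlocks₂₂, add_comm]
      map_smul' := by
        intro c X
        ext p q
        rcases p with i | i <;> rcases q with j | j <;>
          simp [prpFun, Matrix.toBlocks₁₁, Matrix.toBlocks₁₂, Matrix.toBlocks₂₁,
            Matrix.toBlocks₂₂] }
  map_mem := fun hX => prpFun_mem m bar hX
  map_mul := by
    intro d e X Y hX hY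
    change prpFun m bar (X * Y) = koszul d e • (prpFun m bar Y * prpFun m bar X)
    ext p q
    rw [prpFun_apply m bar (SetLike.mul_mem_graded hX hY), Matrix.smul_apply, Matrix.mul_apply,
      Matrix.mul_apply, map_sum, Finset.smul_sum, Finset.smul_sum]
    refine Fintype.sum_equiv (Equiv.sumComm (Fin m) (Fin m)) _ _ fun r => ?_
    change _ = koszul d e • (prpFun m bar Y p r.swap * prpFun m bar X r.swap q)
    rw [prpFun_apply m bar hX, prpFun_apply m bar hY, bar.map_mul (hX _ _) (hY _ _),
      Sum.swap_swap, smul_mul_smul_comm, smul_smul, smul_smul]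
    congr 1
    rw [idx_swap, idx_swap, idx_swap]
    generalize idx p = a, idx q = b, idx r = c
    clear hX hY
    revert a b c d e; decide
  invol := by
    have key : ∀ {d : ZMod 2} {X : Mat m R}, X ∈ matGrade 𝒜 m d →
        prpFun m bar (prpFun m bar X) = X := by
      intro d X hX
      ext p q
      rw [prpFun_apply m bar (prpFun_mem m bar hX), prpFun_apply m bar hX, map_zsmul, bar.invol,
        Sum.swap_swap, Sum.swap_swap, smul_smul, idx_swap, idx_swap]
      have e : prpSign (idx p) (idx q) d * prpSign (idx q + 1) (idx p + 1) d = 1 := by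
        generalize idx p = a, idx q = b
        clear hX
        revert a b d; decide
      rw [e, one_smul]
    intro X
    conv_lhs => rw [← sum_comp (matGrade 𝒜 m) X]
    rw [map_add, map_add]
    conv_rhs => rw [← sum_comp (matGrade 𝒜 m) X]
    exact congrArg₂ _ (key (comp_mem _ 0 X)) (key (comp_mem _ 1 X))

/-- The Lie superalgebra of all matrices `X` with `prp X = -X`. -/
def pTilde : LieSubsuperalgebra (superLie (matGrade 𝒜 m)) := skewElements (prp m bar)

/-- The underlying module of the generalized periplectic Lie superalgebra
`𝔭ₘ = [𝔭̃ₘ, 𝔭̃ₘ]`. -/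
abbrev P : Type _ := (derived (pTilde m bar).lie).carrier

/-- The generalized periplectic Lie superalgebra `𝔭ₘ = [𝔭̃ₘ, 𝔭̃ₘ]`. -/
def pLie : LieSuperalgebra k (P m bar) := (derived (pTilde m bar).lie).lie

/-- The matrix underlying an element of `𝔭ₘ`. -/
def toMat (x : P m bar) : Mat m R := x.1.1

/-- `t_{ij}(a) = e_{ij}(a) - e_{m+j,m+i}(σ a)`. -/
def tMat (i j : Fin m) (a : R) : Mat m R :=
  Matrix.single (Sum.inl i) (Sum.inl j) a - Matrix.single (Sum.inr j) (Sum.inr i) (bar.toFun a)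

/-- `f_{ij}(a) = e_{i,m+j}(a) + e_{j,m+i}(ρ (σ a))`. -/
def fMat (i j : Fin m) (a : R) : Mat m R :=
  Matrix.single (Sum.inl i) (Sum.inr j) a +
    Matrix.single (Sum.inl j) (Sum.inr i) (rho 𝒜 (bar.toFun a))

/-- `g_{ij}(a) = e_{m+i,j}(a) - e_{m+j,i}(ρ (σ a))`. -/
def gMat (i j : Fin m) (a : R) : Mat m R :=
  Matrix.single (Sum.inr i) (Sum.inl j) a -
    Matrix.single (Sum.inr j) (Sum.inl i) (rho 𝒜 (bar.toFun a))

end Matrices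

/-! ### Lie superalgebras presented by generators and relations -/

section Presented

variable {k X : Type*} [CommRing k] (par : X → ZMod 2)

/-- The free non-unital non-associative algebra on the generators. -/
abbrev Free (k X : Type*) [CommRing k] : Type _ := FreeNonUnitalNonAssocAlgebra k X

/-- The parity automorphism of the free algebra: `x ↦ (-1) ^ |x| x` on generators. -/
def freeSign : Free k X →ₙₐ[k] Free k X :=
  FreeNonUnitalNonAssocAlgebra.lift k fun x =>
    psign (par x) • FreeNonUnitalNonAssocAlgebra.of k x

/-- The grading of the free algebra by the parities of the generators. As `2` is invertible, the
elements of parity `i` are those on which the parity automorphism acts by `(-1) ^ i`. -/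
def freeGrade (i : ZMod 2) : Submodule k (Free k X) where
  carrier := {x | freeSign par x = psign i • x}
  zero_mem' := by simp
  add_mem' := by
    intro x y hx hy
    simp only [Set.mem_ofPred_eq] at *
    rw [map_add, hx, hy, smul_add]
  smul_mem' := by
    intro c x hx
    simp only [Set.mem_ofPred_eq] at *
    rw [map_smul, hx, smul_comm]

/-- The given relations together with super-skew-symmetry and the super Jacobi identity. -/
def lieRel (rels : Set (Free k X)) : Set (Free k X) :=
  rels ∪
  {w | ∃ (i j : ZMod 2) (x y : Free k X), x ∈ freeGrade par i ∧ y ∈ freeGrade par j ∧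
    w = x * y + koszul i j • (y * x)} ∪
  {w | ∃ (i j l : ZMod 2) (x y z : Free k X), x ∈ freeGrade par i ∧ y ∈ freeGrade par j ∧
    z ∈ freeGrade par l ∧ w = x * (y * z) - ((x * y) * z + koszul i j • (y * (x * z)))}

/-- The two-sided ideal generated by `lieRel`. -/
def lieIdeal (rels : Set (Free k X)) : Submodule k (Free k X) :=
  sInf {J | lieRel par rels ⊆ J ∧ ∀ x y : Free k X, y ∈ J → x * y ∈ J ∧ y * x ∈ J}

/-- The module underlying the Lie superalgebra with generators `X`, of parities `par`, and
relations `r = 0` for `r ∈ rels`. -/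
abbrev Presented (rels : Set (Free k X)) : Type _ := Free k X ⧸ lieIdeal par rels

variable {par} {rels : Set (Free k X)}

theorem mem_lieIdeal {x : Free k X} : x ∈ lieIdeal par rels ↔ ∀ J : Submodule k (Free k X),
    lieRel par rels ⊆ J → (∀ x y : Free k X, y ∈ J → x * y ∈ J ∧ y * x ∈ J) → x ∈ J := by
  rw [lieIdeal, Submodule.mem_sInf]
  exact ⟨fun h J h1 h2 => h J ⟨h1, h2⟩, fun h J hJ => h J hJ.1 hJ.2⟩

theorem lieRel_subset {x : Free k X} (hx : x ∈ lieRel par rels) : x ∈ lieIdeal par rels :=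
  mem_lieIdeal.2 fun _ h1 _ => h1 hx

theorem lieIdeal_mul_left (x : Free k X) {y : Free k X} (hy : y ∈ lieIdeal par rels) :
    x * y ∈ lieIdeal par rels :=
  mem_lieIdeal.2 fun J h1 h2 => (h2 x y (mem_lieIdeal.1 hy J h1 h2)).1

theorem lieIdeal_mul_right (x : Free k X) {y : Free k X} (hy : y ∈ lieIdeal par rels) :
    y * x ∈ lieIdeal par rels :=
  mem_lieIdeal.2 fun J h1 h2 => (h2 x y (mem_lieIdeal.1 hy J h1 h2)).2

theorem freeGrade_mul {i j : ZMod 2} {x y : Free k X} (hx : x ∈ freeGrade par i)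
    (hy : y ∈ freeGrade par j) : x * y ∈ freeGrade par (i + j) := by
  change freeSign par (x * y) = psign (i + j) • (x * y)
  rw [map_mul, show freeSign par x = _ from hx, show freeSign par y = _ from hy,
    smul_mul_smul_comm, psign_add]

theorem freeGrade_of (x : X) : FreeNonUnitalNonAssocAlgebra.of k x ∈ freeGrade par (par x) := by
  change freeSign par _ = _
  rw [freeSign, FreeNonUnitalNonAssocAlgebra.lift_of_apply]

/-- All relations are homogeneous. -/
def Homog (par : X → ZMod 2) (rels : Set (Free k X)) : Prop :=
  ∀ r ∈ rels, ∃ i, r ∈ freeGrade par i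

theorem lieRel_homog (h : Homog par rels) {r : Free k X} (hr : r ∈ lieRel par rels) :
    ∃ i, r ∈ freeGrade par i := by
  rcases hr with (hr | ⟨i, j, x, y, hx, hy, rfl⟩) | ⟨i, j, l, x, y, z, hx, hy, hz, rfl⟩
  · exact h r hr
  · refine ⟨i + j, add_mem (freeGrade_mul hx hy) (zsmul_mem ?_ _)⟩
    rw [add_comm]
    exact freeGrade_mul hy hx
  · refine ⟨i + (j + l), sub_mem (freeGrade_mul hx (freeGrade_mul hy hz))
      (add_mem ?_ (zsmul_mem ?_ _))⟩
    · rw [← add_assoc]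
      exact freeGrade_mul (freeGrade_mul hx hy) hz
    · rw [add_left_comm]
      exact freeGrade_mul hy (freeGrade_mul hx hz)

theorem lieIdeal_sign (h : Homog par rels) :
    lieIdeal par rels ≤ (lieIdeal par rels).comap
      ((freeSign (k := k) par : Free k X →ₙₐ[k] Free k X) : Free k X →ₗ[k] Free k X) := by
  intro x hx
  refine mem_lieIdeal.1 hx _ ?_ ?_
  · intro r hr
    obtain ⟨i, hi⟩ := lieRel_homog h hr
    change freeSign par r ∈ lieIdeal par rels
    rw [show freeSign par r = _ from hi]
    exact zsmul_mem (lieRel_subset hr) _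
  · intro x y hy
    change freeSign par (x * y) ∈ lieIdeal par rels ∧ freeSign par (y * x) ∈ lieIdeal par rels
    rw [map_mul, map_mul]
    exact ⟨lieIdeal_mul_left _ hy, lieIdeal_mul_right _ hy⟩

theorem freeSign_freeSign (x : Free k X) : freeSign par (freeSign par x) = x := by
  have : (freeSign (k := k) par).comp (freeSign (k := k) par) = NonUnitalAlgHom.id k (Free k X) := by
    refine FreeNonUnitalNonAssocAlgebra.hom_ext k fun x => ?_
    change freeSign par (freeSign par (FreeNonUnitalNonAssocAlgebra.of k x)) =
      FreeNonUnitalNonAssocAlgebra.of k x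
    rw [show freeSign par (FreeNonUnitalNonAssocAlgebra.of k x) = _ from freeGrade_of x,
      map_zsmul, show freeSign par (FreeNonUnitalNonAssocAlgebra.of k x) = _ from freeGrade_of x,
      smul_smul, psign_sq, one_smul]
  exact DFunLike.congr_fun this x

theorem exists_freeGrade [Invertible (2 : k)] (x : Free k X) :
    ∃ a ∈ freeGrade (k := k) par 0, ∃ b ∈ freeGrade (k := k) par 1, a + b = x := by
  refine ⟨(⅟2 : k) • (x + freeSign par x), ?_, (⅟2 : k) • (x - freeSign par x), ?_, ?_⟩
  · change freeSign par _ = (1 : ℤ) • _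
    rw [map_smul, map_add, freeSign_freeSign, one_smul, add_comm]
  · change freeSign par _ = (-1 : ℤ) • _
    rw [map_smul, map_sub, freeSign_freeSign, neg_smul, one_smul, ← smul_neg, neg_sub]
  · rw [← smul_add, add_add_sub_cancel, ← two_smul k x, smul_smul, invOf_mul_self, one_smul]

/-- The Lie superalgebra with the given generators and homogeneous relations; its elements of
parity `i` are the classes of the elements of parity `i` of the free algebra. -/
def presentedLie [Invertible (2 : k)] (h : Homog par rels) :
    LieSuperalgebra k (Presented par rels) where
  grade i := (freeGrade par i).map (lieIdeal par rels).mkQ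
  isCompl := by
    constructor
    · rw [Submodule.disjoint_def]
      rintro _ ⟨x, hx, rfl⟩ ⟨y, hy, hxy⟩
      have e := lieIdeal_sign h ((Submodule.Quotient.eq _).1 hxy)
      change freeSign par (y - x) ∈ lieIdeal par rels at e
      rw [map_sub, show freeSign par x = (1 : ℤ) • x from hx,
        show freeSign par y = (-1 : ℤ) • y from hy, one_smul, neg_smul, one_smul] at e
      have e3 := add_mem ((Submodule.Quotient.eq _).1 hxy) e
      have e4 : x = (⅟2 : k) • -(y - x + (-y - x)) := by
        rw [show -(y - x + (-y - x)) = x + x by abel, ← two_smul k x, smul_smul,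
          invOf_mul_self, one_smul]
      rw [Submodule.mkQ_apply, Submodule.Quotient.mk_eq_zero, e4]
      exact Submodule.smul_mem _ _ (neg_mem e3)
    · rw [codisjoint_iff_le_sup]
      intro x _
      obtain ⟨x, rfl⟩ := Submodule.mkQ_surjective _ x
      obtain ⟨a, ha, b, hb, rfl⟩ := exists_freeGrade (par := par) x
      rw [map_add]
      exact Submodule.mem_sup.2 ⟨_, ⟨a, ha, rfl⟩, _, ⟨b, hb, rfl⟩, rfl⟩
  bracket := (lieIdeal par rels).liftQ
    { toFun := fun x => (lieIdeal par rels).mapQ (lieIdeal par rels) (LinearMap.mul k _ x)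
        fun _ hy => lieIdeal_mul_left x hy
      map_add' := fun _ _ => Submodule.linearMap_qext _ (LinearMap.ext fun z =>
        congrArg (lieIdeal par rels).mkQ (add_mul _ _ z))
      map_smul' := fun _ _ => Submodule.linearMap_qext _ (LinearMap.ext fun z =>
        congrArg (lieIdeal par rels).mkQ (smul_mul_assoc _ _ z)) }
    (by
      intro x hx
      refine Submodule.linearMap_qext _ (LinearMap.ext fun y => ?_)
      exact (Submodule.Quotient.mk_eq_zero _).2 (lieIdeal_mul_right y hx))
  bracket_mem := by
    rintro i j _ _ ⟨x, hx, rfl⟩ ⟨y, hy, rfl⟩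
    exact ⟨x * y, freeGrade_mul hx hy, rfl⟩
  skew := by
    rintro i j _ _ ⟨x, hx, rfl⟩ ⟨y, hy, rfl⟩
    rw [eq_neg_iff_add_eq_zero]
    exact (Submodule.Quotient.mk_eq_zero _).2
      (lieRel_subset (Or.inl (Or.inr ⟨i, j, x, y, hx, hy, rfl⟩)))
  jacobi := by
    rintro i j l _ _ _ ⟨x, hx, rfl⟩ ⟨y, hy, rfl⟩ ⟨z, hz, rfl⟩
    rw [← sub_eq_zero]
    exact (Submodule.Quotient.mk_eq_zero _).2
      (lieRel_subset (Or.inr ⟨i, j, l, x, y, z, hx, hy, hz, rfl⟩))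

end Presented

/-! ### Steinberg periplectic Lie superalgebras -/

section Steinberg

variable {k R : Type*} [CommRing k] [Ring R] [Algebra k R]

/-- The generators `t_{ij}(a)`, `f_{ij}(a)`, `g_{ij}(a)`, for `i ≠ j` and homogeneous `a`. -/
inductive StpGen (𝒜 : ZMod 2 → Submodule k R) (m : ℕ)
  | t (i j : Fin m) (h : i ≠ j) (α : ZMod 2) (a : 𝒜 α)
  | f (i j : Fin m) (h : i ≠ j) (α : ZMod 2) (a : 𝒜 α)
  | g (i j : Fin m) (h : i ≠ j) (α : ZMod 2) (a : 𝒜 α)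

/-- The parities `|a|`, `|a| + 1`, `|a| + 1` of the generators. -/
def StpGen.parity {𝒜 : ZMod 2 → Submodule k R} {m : ℕ} : StpGen 𝒜 m → ZMod 2
  | .t _ _ _ α _ => α
  | .f _ _ _ α _ => α + 1
  | .g _ _ _ α _ => α + 1

variable {𝒜 : ZMod 2 → Submodule k R} {m : ℕ}

/-- The generator `t_{ij}(a)` in the free algebra. -/
def tF {i j : Fin m} (h : i ≠ j) {α : ZMod 2} (a : 𝒜 α) : Free k (StpGen 𝒜 m) :=
  FreeNonUnitalNonAssocAlgebra.of k (StpGen.t i j h α a)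

/-- The generator `f_{ij}(a)` in the free algebra. -/
def fF {i j : Fin m} (h : i ≠ j) {α : ZMod 2} (a : 𝒜 α) : Free k (StpGen 𝒜 m) :=
  FreeNonUnitalNonAssocAlgebra.of k (StpGen.f i j h α a)

/-- The generator `g_{ij}(a)` in the free algebra. -/
def gF {i j : Fin m} (h : i ≠ j) {α : ZMod 2} (a : 𝒜 α) : Free k (StpGen 𝒜 m) :=
  FreeNonUnitalNonAssocAlgebra.of k (StpGen.g i j h α a)

variable [GradedAlgebra 𝒜]

/-- The product of homogeneous elements. -/
def hmul {α β : ZMod 2} (a : 𝒜 α) (b : 𝒜 β) : 𝒜 (α + β) :=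
  ⟨a.1 * b.1, SetLike.mul_mem_graded a.2 b.2⟩

/-- The superinvolution on homogeneous elements. -/
def hbar (bar : SuperInvolution 𝒜) {α : ZMod 2} (a : 𝒜 α) : 𝒜 α :=
  ⟨bar.toFun a.1, bar.map_mem a.2⟩

/-- The sign map on homogeneous elements. -/
def hrho {α : ZMod 2} (a : 𝒜 α) : 𝒜 α :=
  ⟨rho 𝒜 a.1, by rw [rho_of_mem 𝒜 a.2]; exact zsmul_mem a.2 _⟩

/-- The defining relations of the Steinberg periplectic Lie superalgebra: `StpRel bar r` for
every relation `r = 0`, the product of the free algebra standing for the bracket. -/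
inductive StpRel (bar : SuperInvolution 𝒜) : Free k (StpGen 𝒜 m) → Prop
  | t_add {i j : Fin m} (h : i ≠ j) {α : ZMod 2} (a b : 𝒜 α) :
      StpRel bar (tF h (a + b) - (tF h a + tF h b))
  | t_smul {i j : Fin m} (h : i ≠ j) {α : ZMod 2} (c : k) (a : 𝒜 α) :
      StpRel bar (tF h (c • a) - c • tF h a)
  | f_add {i j : Fin m} (h : i ≠ j) {α : ZMod 2} (a b : 𝒜 α) :
      StpRel bar (fF h (a + b) - (fF h a + fF h b))
  | f_smul {i j : Fin m} (h : i ≠ j) {α : ZMod 2} (c : k) (a : 𝒜 α) :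
      StpRel bar (fF h (c • a) - c • fF h a)
  | g_add {i j : Fin m} (h : i ≠ j) {α : ZMod 2} (a b : 𝒜 α) :
      StpRel bar (gF h (a + b) - (gF h a + gF h b))
  | g_smul {i j : Fin m} (h : i ≠ j) {α : ZMod 2} (c : k) (a : 𝒜 α) :
      StpRel bar (gF h (c • a) - c • gF h a)
  | f_bar {i j : Fin m} (h : i ≠ j) {α : ZMod 2} (a : 𝒜 α) :
      StpRel bar (fF h (hbar bar a) - fF h.symm (hrho a))
  | g_bar {i j : Fin m} (h : i ≠ j) {α : ZMod 2} (a : 𝒜 α) :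
      StpRel bar (gF h (hbar bar a) + gF h.symm (hrho a))
  | tt {i j l : Fin m} (hij : i ≠ j) (hjl : j ≠ l) (hil : i ≠ l) {α β : ZMod 2}
      (a : 𝒜 α) (b : 𝒜 β) :
      StpRel bar (tF hij a * tF hjl b - tF hil (hmul a b))
  | tt_zero {i j l n : Fin m} (hij : i ≠ j) (_ : j ≠ l) (hln : l ≠ n) (_ : n ≠ i)
      {α β : ZMod 2} (a : 𝒜 α) (b : 𝒜 β) :
      StpRel bar (tF hij a * tF hln b)
  | tf {i j l : Fin m} (hij : i ≠ j) (hjl : j ≠ l) (hil : i ≠ l) {α β : ZMod 2}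
      (a : 𝒜 α) (b : 𝒜 β) :
      StpRel bar (tF hij a * fF hjl b - fF hil (hmul a b))
  | tf_zero {i j l n : Fin m} (hij : i ≠ j) (_ : j ≠ l) (hln : l ≠ n) (_ : n ≠ j)
      {α β : ZMod 2} (a : 𝒜 α) (b : 𝒜 β) :
      StpRel bar (tF hij a * fF hln b)
  | gt {i j l : Fin m} (hij : i ≠ j) (hjl : j ≠ l) (hil : i ≠ l) {α β : ZMod 2}
      (a : 𝒜 α) (b : 𝒜 β) :
      StpRel bar (gF hij a * tF hjl b - gF hil (hmul a b))
  | gt_zero {i j l n : Fin m} (hij : i ≠ j) (hln : l ≠ n) (_ : l ≠ j) (_ : i ≠ l)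
      {α β : ZMod 2} (a : 𝒜 α) (b : 𝒜 β) :
      StpRel bar (gF hij a * tF hln b)
  | ff {i j l n : Fin m} (hij : i ≠ j) (hln : l ≠ n) {α β : ZMod 2} (a : 𝒜 α) (b : 𝒜 β) :
      StpRel bar (fF hij a * fF hln b)
  | gg {i j l n : Fin m} (hij : i ≠ j) (hln : l ≠ n) {α β : ZMod 2} (a : 𝒜 α) (b : 𝒜 β) :
      StpRel bar (gF hij a * gF hln b)
  | fg {i j l : Fin m} (hij : i ≠ j) (hjl : j ≠ l) (hil : i ≠ l) {α β : ZMod 2}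
      (a : 𝒜 α) (b : 𝒜 β) :
      StpRel bar (fF hij a * gF hjl b - tF hil (hmul a b))
  | fg_zero {i j l n : Fin m} (hij : i ≠ j) (_ : i ≠ l) (_ : i ≠ n) (_ : j ≠ l) (_ : j ≠ n)
      (hln : l ≠ n) {α β : ZMod 2} (a : 𝒜 α) (b : 𝒜 β) :
      StpRel bar (fF hij a * gF hln b)

variable (m) (bar : SuperInvolution 𝒜)

/-- The set of defining relations. -/
def stpRels : Set (Free k (StpGen 𝒜 m)) := {r | StpRel bar r}

theorem stpRels_homog : Homog StpGen.parity (stpRels m bar) := by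
  have ht : ∀ {i j : Fin m} (h : i ≠ j) {α : ZMod 2} (a : 𝒜 α),
      tF h a ∈ freeGrade (k := k) StpGen.parity α :=
    fun h _ a => freeGrade_of (par := StpGen.parity) (StpGen.t _ _ h _ a)
  have hf : ∀ {i j : Fin m} (h : i ≠ j) {α : ZMod 2} (a : 𝒜 α),
      fF h a ∈ freeGrade (k := k) StpGen.parity (α + 1) :=
    fun h _ a => freeGrade_of (par := StpGen.parity) (StpGen.f _ _ h _ a)
  have hg : ∀ {i j : Fin m} (h : i ≠ j) {α : ZMod 2} (a : 𝒜 α),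
      gF h a ∈ freeGrade (k := k) StpGen.parity (α + 1) :=
    fun h _ a => freeGrade_of (par := StpGen.parity) (StpGen.g _ _ h _ a)
  intro r hr
  cases hr with
  | t_add => exact ⟨_, sub_mem (ht _ _) (add_mem (ht _ _) (ht _ _))⟩
  | t_smul => exact ⟨_, sub_mem (ht _ _) (Submodule.smul_mem _ _ (ht _ _))⟩
  | f_add => exact ⟨_, sub_mem (hf _ _) (add_mem (hf _ _) (hf _ _))⟩
  | f_smul => exact ⟨_, sub_mem (hf _ _) (Submodule.smul_mem _ _ (hf _ _))⟩
  | g_add => exact ⟨_, sub_mem (hg _ _) (add_mem (hg _ _) (hg _ _))⟩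
  | g_smul => exact ⟨_, sub_mem (hg _ _) (Submodule.smul_mem _ _ (hg _ _))⟩
  | f_bar => exact ⟨_, sub_mem (hf _ _) (hf _ _)⟩
  | g_bar => exact ⟨_, add_mem (hg _ _) (hg _ _)⟩
  | tt => exact ⟨_, sub_mem (freeGrade_mul (ht _ _) (ht _ _)) (ht _ _)⟩
  | tt_zero => exact ⟨_, freeGrade_mul (ht _ _) (ht _ _)⟩
  | tf =>
    refine ⟨_, sub_mem (freeGrade_mul (ht _ _) (hf _ _)) ?_⟩
    rw [← add_assoc]
    exact hf _ _
  | tf_zero => exact ⟨_, freeGrade_mul (ht _ _) (hf _ _)⟩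
  | gt =>
    refine ⟨_, sub_mem (freeGrade_mul (hg _ _) (ht _ _)) ?_⟩
    rw [add_right_comm]
    exact hg _ _
  | gt_zero => exact ⟨_, freeGrade_mul (hg _ _) (ht _ _)⟩
  | ff => exact ⟨_, freeGrade_mul (hf _ _) (hf _ _)⟩
  | gg => exact ⟨_, freeGrade_mul (hg _ _) (hg _ _)⟩
  | @fg i j l _ _ _ α β a b =>
    refine ⟨_, sub_mem (freeGrade_mul (hf _ _) (hg _ _)) ?_⟩
    rw [show α + 1 + (β + 1) = α + β by
      clear a b
      revert α β; decide]
    exact ht _ _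
  | fg_zero => exact ⟨_, freeGrade_mul (hf _ _) (hg _ _)⟩

/-- The module underlying the Steinberg periplectic Lie superalgebra `𝔰𝔱𝔭ₘ`. -/
abbrev Stp : Type _ := Presented StpGen.parity (stpRels m bar)

/-- The Steinberg periplectic Lie superalgebra `𝔰𝔱𝔭ₘ`. -/
def stpLie [Invertible (2 : k)] : LieSuperalgebra k (Stp m bar) :=
  presentedLie (stpRels_homog m bar)

/-- The image in `𝔰𝔱𝔭ₘ` of an element of the free algebra. -/
def toStp (x : Free k (StpGen 𝒜 m)) : Stp m bar := (lieIdeal StpGen.parity (stpRels m bar)).mkQ x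

/-- `ψ : 𝔰𝔱𝔭ₘ → 𝔭ₘ` is the canonical homomorphism: it sends the generators `t_{ij}(a)`,
`f_{ij}(a)`, `g_{ij}(a)` to the matrices of the same names. -/
def IsCanonical [Invertible (2 : k)] (ψ : LieSuperHom (stpLie m bar) (pLie m bar)) : Prop :=
  ∀ (i j : Fin m) (h : i ≠ j) (α : ZMod 2) (a : 𝒜 α),
    toMat m bar (ψ.toLinearMap (toStp m bar (tF h a))) = tMat m bar i j a ∧
    toMat m bar (ψ.toLinearMap (toStp m bar (fF h a))) = fMat m bar i j a ∧
    toMat m bar (ψ.toLinearMap (toStp m bar (gF h a))) = gMat m bar i j a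

end Steinberg

end Periplectic

open Periplectic

/-! All generators are treated uniformly by signed indices `p : Fin m ⊕ Fin m`, with `p.swap` in the
role of `p*`. The matrices `t`, `f`, `g` are the cases of one family `rootMat`, `u_{pq}(a) =
e_{pq}(a) - prp (e_{pq}(a))`, and `u_{pq}(a) = u_{q*p*}(τ a)` for a signed version `tau` of the
involution. The defining relations amount to three rules for indices with `q ≠ p, p*`: this
reflection, `[u_{pq}(a), u_{qr}(b)] = u_{pr}(ab)`, and the vanishing of brackets whose indices do
not meet. They form the structure `PeriplecticSystem`.

The kernel is found by embedding `𝔰𝔱𝔭ₘ` into an explicit central extension. Put `σ = bar ∘ ρ` and `Q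
= (R ⊗ R) / I`. The form `ω(X, Y) = 1/2 ∑ ± ⟨X_{pq}, Y_{qp}⟩` is an even 2-cocycle on matrices with
values in `Q` (`cocycle_jacobi`), and the elements `(u_{pq}(a), 0)` of the extension obey the three
rules (`rootExt_system`). Hence there is a homomorphism `φ = stpToExt` from `𝔰𝔱𝔭ₘ` to the extension,
whose matrix component is `ψ`.

The main point is that `φ` is injective (`retraction_comp`). In any such system the short root
elements, the long root elements `u_{pp*}(a)` and the Cartan-type elements `c_{pq}(a, b) = ±
[u_{pq}(a), u_{qp}(b)]` span a subspace stable under root elements (`bracket_mem_fullSpan`), which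
for `𝔰𝔱𝔭ₘ` is everything. By the Jacobi identity `c_{pq}(a, b)` is a term `λ(a, b)` attached to a
base index, plus "`ab` at `p`", minus "`± ba` at `q`" (`eq_symLam_add`). Averaged over the base
index and its swap, `λ` satisfies exactly the relations in `I` (`dihedralRel_le_ker_symLam`). So the
matrix entries together with the class in `Q` determine an element, and a linear left inverse of `φ`
can be written down.

The rest follows. If `ψ x = 0`, then `φ [x, y] = 0` because brackets in the extension see only
matrix components; thus `x` is central. The central component embeds `ker ψ` into `Q`. A twisted
trace of the matrix component equals `[a, b] + σ [a, b]` summed over the central component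
(`matTrace_eq`), so the image lies in the dihedral homology; conversely the averaged `λ` lifts every
class there (`exists_kernel_equiv`). For surjectivity, the image contains all off-diagonal root
matrices, and these already generate the brackets of all root matrices (`bracket_rootMat_mem`). -/

namespace Periplectic

/-! ### Homogeneous elements -/

theorem psign_mul_psign (i j : ZMod 2) : psign i * psign j = psign (i + j) := (psign_add i j).symm

theorem koszul_eq (i j : ZMod 2) : koszul i j = psign (i * j) := rfl

theorem psign_zero : psign 0 = 1 := rfl

theorem koszul_zero_left (i : ZMod 2) : koszul 0 i = 1 := by revert i; decide

theorem koszul_zero_right (i : ZMod 2) : koszul i 0 = 1 := by revert i; decide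

section Homogeneous

variable {k A M : Type*} [CommRing k] [AddCommGroup A] [Module k A] [AddCommGroup M] [Module k M]
  (𝒜 : ZMod 2 → Submodule k A) [DirectSum.Decomposition 𝒜]

/-- Every sign rule is stated for homogeneous elements only; additivity carries linear identities
from there to all of `A`. -/
theorem homogeneous_induction {P : A → Prop} (hom : ∀ i, ∀ a ∈ 𝒜 i, P a)
    (add : ∀ a b, P a → P b → P (a + b)) (a : A) : P a := by
  rw [← sum_comp 𝒜 a]
  exact add _ _ (hom 0 _ (comp_mem 𝒜 0 a)) (hom 1 _ (comp_mem 𝒜 1 a))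

theorem linearMap_ext_homogeneous {f g : A →ₗ[k] M} (h : ∀ i, ∀ a ∈ 𝒜 i, f a = g a) : f = g :=
  LinearMap.ext fun a => homogeneous_induction 𝒜 (P := fun a => f a = g a) h
    (fun a b ha hb => by rw [map_add, map_add, ha, hb]) a

theorem linearMap_ext_homogeneous₂ {f g : A →ₗ[k] A →ₗ[k] M}
    (h : ∀ i j, ∀ a ∈ 𝒜 i, ∀ b ∈ 𝒜 j, f a b = g a b) : f = g :=
  linearMap_ext_homogeneous 𝒜 fun i a ha => linearMap_ext_homogeneous 𝒜 fun j b hb =>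
    h i j a ha b hb

theorem rho_rho (a : A) : rho 𝒜 (rho 𝒜 a) = a :=
  homogeneous_induction 𝒜 (P := fun a => rho 𝒜 (rho 𝒜 a) = a)
    (fun i a ha => by rw [rho_of_mem 𝒜 ha, map_zsmul, rho_of_mem 𝒜 ha, smul_smul, psign_sq,
      one_smul])
    (fun a b ha hb => by rw [map_add, map_add, ha, hb]) a

end Homogeneous

/-- Apply the involution to the product `1 * σ 1`. -/
theorem SuperInvolution.map_one {k A : Type*} [CommRing k] [Ring A] [Algebra k A]
    {𝒜 : ZMod 2 → Submodule k A} [GradedAlgebra 𝒜] (σ : SuperInvolution 𝒜) : σ.toFun 1 = 1 := by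
  have h1 : (1 : A) ∈ 𝒜 0 := SetLike.one_mem_graded 𝒜
  have h := σ.map_mul h1 (σ.map_mem h1)
  rw [one_mul, σ.invol, koszul_zero_left, one_smul, one_mul] at h
  exact h.symm

theorem SuperInvolution.map_rho {k A : Type*} [CommRing k] [Ring A] [Algebra k A]
    {𝒜 : ZMod 2 → Submodule k A} [GradedAlgebra 𝒜] (σ : SuperInvolution 𝒜) (a : A) :
    σ.toFun (rho 𝒜 a) = rho 𝒜 (σ.toFun a) :=
  homogeneous_induction 𝒜 (P := fun a => σ.toFun (rho 𝒜 a) = rho 𝒜 (σ.toFun a))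
    (fun i a ha => by rw [rho_of_mem 𝒜 ha, rho_of_mem 𝒜 (σ.map_mem ha), map_zsmul])
    (fun a b ha hb => by rw [map_add, map_add, map_add, map_add, ha, hb]) a

/-! ### Generalities on Lie superalgebras -/

namespace LieSuperalgebra

variable {k L : Type*} [CommRing k] [AddCommGroup L] [Module k L] (S : LieSuperalgebra k L)

theorem exists_add (x : L) : ∃ a ∈ S.grade 0, ∃ b ∈ S.grade 1, a + b = x :=
  Submodule.mem_sup.1 (S.isCompl.sup_eq_top.ge (Submodule.mem_top (x := x)))

theorem induction {P : L → Prop} (hom : ∀ i, ∀ x ∈ S.grade i, P x)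
    (add : ∀ x y, P x → P y → P (x + y)) (x : L) : P x := by
  obtain ⟨a, ha, b, hb, rfl⟩ := S.exists_add x
  exact add _ _ (hom 0 a ha) (hom 1 b hb)

/-- The sign involves the parities of `x` and `y` alone, so the third argument need not be
homogeneous. -/
theorem jacobi' {i j : ZMod 2} {x y : L} (hx : x ∈ S.grade i) (hy : y ∈ S.grade j) (z : L) :
    S.bracket x (S.bracket y z) =
      S.bracket (S.bracket x y) z + koszul i j • S.bracket y (S.bracket x z) := by
  refine S.induction (P := fun z => S.bracket x (S.bracket y z) =
      S.bracket (S.bracket x y) z + koszul i j • S.bracket y (S.bracket x z))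
    (fun l z hz => S.jacobi hx hy hz) (fun a b ha hb => ?_) z
  simp only [map_add, ha, hb, smul_add]
  abel

theorem bracket_eq_zero_comm {i j : ZMod 2} {x y : L} (hx : x ∈ S.grade i) (hy : y ∈ S.grade j)
    (h : S.bracket x y = 0) : S.bracket y x = 0 := by
  rw [S.skew hy hx, h, smul_zero, neg_zero]

/-- Membership of brackets in a submodule is symmetric. -/
theorem bracket_mem_comm {i j : ZMod 2} {x y : L} (hx : x ∈ S.grade i) (hy : y ∈ S.grade j)
    {N : Submodule k L} (h : S.bracket x y ∈ N) : S.bracket y x ∈ N := by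
  rw [S.skew hy hx]
  exact neg_mem (zsmul_mem h _)

/-- A Lie superalgebra as a non-unital non-associative algebra. -/
def NonAssoc (_ : LieSuperalgebra k L) : Type _ := L

instance : AddCommGroup S.NonAssoc := inferInstanceAs (AddCommGroup L)

instance : Module k S.NonAssoc := inferInstanceAs (Module k L)

instance : NonUnitalNonAssocRing S.NonAssoc where
  mul x y := (S.bracket x y : L)
  left_distrib x y z := map_add (S.bracket x) y z
  right_distrib x y z := LinearMap.congr_fun (map_add S.bracket x y) z
  zero_mul x := LinearMap.congr_fun (map_zero S.bracket) x
  mul_zero x := map_zero (S.bracket x)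

instance : IsScalarTower k S.NonAssoc S.NonAssoc :=
  ⟨fun c x y => LinearMap.congr_fun (map_smul S.bracket c x) y⟩

instance : SMulCommClass k S.NonAssoc S.NonAssoc :=
  ⟨fun c x y => (map_smul (S.bracket x) c y).symm⟩

/-- The linear map from the free algebra to a Lie superalgebra that is given on generators and
turns products into brackets. -/
def freeLift {X : Type*} (y : X → L) : Free k X →ₗ[k] L :=
  ((FreeNonUnitalNonAssocAlgebra.lift k (A := S.NonAssoc) y :
    Free k X →ₙₐ[k] S.NonAssoc) : Free k X →ₗ[k] S.NonAssoc)

variable {X : Type*} (y : X → L)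

theorem freeLift_of (x : X) : S.freeLift y (FreeNonUnitalNonAssocAlgebra.of k x) = y x :=
  FreeNonUnitalNonAssocAlgebra.lift_of_apply k (A := S.NonAssoc) y x

theorem freeLift_mul (a b : Free k X) :
    S.freeLift y (a * b) = S.bracket (S.freeLift y a) (S.freeLift y b) :=
  map_mul (FreeNonUnitalNonAssocAlgebra.lift k (A := S.NonAssoc) y) a b

end LieSuperalgebra

/-- Sending generators to themselves defines a homomorphism from the free algebra into the
subalgebra `N`. Composed with the inclusion it fixes the generators, hence is the identity. -/
theorem Free.eq_top_of_mul_mem {k X : Type*} [CommRing k] {N : Submodule k (Free k X)}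
    (hof : ∀ x, FreeNonUnitalNonAssocAlgebra.of k x ∈ N)
    (hmul : ∀ x y, x ∈ N → y ∈ N → x * y ∈ N) : N = ⊤ := by
  let S : NonUnitalSubalgebra k (Free k X) :=
    { N with mul_mem' := fun {x y} hx hy => hmul x y hx hy }
  let F : Free k X →ₙₐ[k] S := FreeNonUnitalNonAssocAlgebra.lift k fun x => ⟨_, hof x⟩
  have h : (NonUnitalSubalgebraClass.subtype S).comp F = NonUnitalAlgHom.id k (Free k X) := by
    refine FreeNonUnitalNonAssocAlgebra.hom_ext k fun x => ?_
    change ((F (FreeNonUnitalNonAssocAlgebra.of k x) : S) : Free k X) = _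
    rw [FreeNonUnitalNonAssocAlgebra.lift_of_apply]
    rfl
  refine eq_top_iff.2 fun x _ => ?_
  have := DFunLike.congr_fun h x
  change ((F x : S) : Free k X) = x at this
  rw [← this]
  exact (F x).2

section PresentedHom

variable {k X L : Type*} [CommRing k] [AddCommGroup L] [Module k L] {par : X → ZMod 2}
  {rels : Set (Free k X)} [Invertible (2 : k)]

theorem eq_zero_of_add_self {M : Type*} [AddCommGroup M] [Module k M] {z : M} (hz : z + z = 0) :
    z = 0 := by
  rw [← one_smul k z, ← invOf_mul_self (2 : k), mul_smul, two_smul, hz, smul_zero]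

theorem freeGrade_disjoint {x : Free k X} (h0 : x ∈ freeGrade par 0) (h1 : x ∈ freeGrade par 1) :
    x = 0 := by
  have h0' : freeSign par x = (1 : ℤ) • x := h0
  have h1' : freeSign par x = (-1 : ℤ) • x := h1
  refine eq_zero_of_add_self (k := k) ?_
  rw [h0', one_smul, neg_one_zsmul] at h1'
  nth_rewrite 1 [h1']
  exact neg_add_cancel x

/-- The grading of the free algebra is by eigenvalues of the parity automorphism, not by spans of
monomials. So one takes the elements of parity `i` whose image also has parity `i`: over both
parities they span a subalgebra containing the generators, which is everything. The component of the
wrong parity then lies in both eigenspaces and vanishes. -/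
theorem freeLift_mem (S : LieSuperalgebra k L) {y : X → L} (hy : ∀ x, y x ∈ S.grade (par x))
    {i : ZMod 2} {x : Free k X} (hx : x ∈ freeGrade par i) : S.freeLift y x ∈ S.grade i := by
  let N : ZMod 2 → Submodule k (Free k X) := fun i =>
    freeGrade par i ⊓ (S.grade i).comap (S.freeLift y)
  have hN : ∀ {i} {x : Free k X}, x ∈ N i → x ∈ N 0 ⊔ N 1 := by
    intro i x hx
    fin_cases i
    · exact Submodule.mem_sup_left hx
    · exact Submodule.mem_sup_right hx
  have hmul : ∀ {i j} {a b : Free k X}, a ∈ N i → b ∈ N j → a * b ∈ N (i + j) := by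
    intro i j a b ha hb
    refine ⟨freeGrade_mul ha.1 hb.1, ?_⟩
    change S.freeLift y (a * b) ∈ S.grade (i + j)
    rw [S.freeLift_mul]
    exact S.bracket_mem ha.2 hb.2
  have htop : N 0 ⊔ N 1 = ⊤ := by
    refine Free.eq_top_of_mul_mem (fun x => hN (i := par x) ⟨freeGrade_of x, ?_⟩) ?_
    · change S.freeLift y (FreeNonUnitalNonAssocAlgebra.of k x) ∈ S.grade (par x)
      rw [S.freeLift_of]
      exact hy x
    · intro a b ha hb
      obtain ⟨a0, ha0, a1, ha1, rfl⟩ := Submodule.mem_sup.1 ha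
      obtain ⟨b0, hb0, b1, hb1, rfl⟩ := Submodule.mem_sup.1 hb
      rw [add_mul, mul_add, mul_add]
      exact add_mem (add_mem (hN (hmul ha0 hb0)) (hN (hmul ha0 hb1)))
        (add_mem (hN (hmul ha1 hb0)) (hN (hmul ha1 hb1)))
  obtain ⟨a, ha, b, hb, hab⟩ := Submodule.mem_sup.1 (htop.ge (Submodule.mem_top (x := x)))
  fin_cases i
  · have : b = 0 := freeGrade_disjoint (par := par)
      (by rw [← add_sub_cancel_left a b, hab]; exact sub_mem hx ha.1) hb.1
    rw [this, add_zero] at hab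
    exact hab ▸ ha.2
  · have : a = 0 := freeGrade_disjoint (par := par) ha.1
      (by rw [← add_sub_cancel_right a b, hab]; exact sub_mem hx hb.1)
    rw [this, zero_add] at hab
    exact hab ▸ hb.2

theorem lieIdeal_le_ker (S : LieSuperalgebra k L) {y : X → L} (hy : ∀ x, y x ∈ S.grade (par x))
    (hr : ∀ r ∈ rels, S.freeLift y r = 0) :
    lieIdeal par rels ≤ LinearMap.ker (S.freeLift y) := by
  intro x hx
  refine mem_lieIdeal.1 hx _ ?_ ?_
  · rintro r ((hr' | ⟨i, j, a, b, ha, hb, rfl⟩) | ⟨i, j, l, a, b, c, ha, hb, hc, rfl⟩)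
    · exact hr r hr'
    · change S.freeLift y _ = 0
      rw [map_add, map_zsmul, S.freeLift_mul, S.freeLift_mul,
        S.skew (freeLift_mem S hy ha) (freeLift_mem S hy hb), neg_add_cancel]
    · change S.freeLift y _ = 0
      simp only [map_sub, map_add, map_zsmul, S.freeLift_mul]
      rw [S.jacobi (freeLift_mem S hy ha) (freeLift_mem S hy hb) (freeLift_mem S hy hc), sub_self]
  · intro a b hb
    change S.freeLift y _ = 0 ∧ S.freeLift y _ = 0
    have hb' : S.freeLift y b = 0 := hb
    rw [S.freeLift_mul, S.freeLift_mul, hb']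
    simp

/-- A homomorphism from a Lie superalgebra given by generators and relations. -/
def presentedHom (h : Homog par rels) (S : LieSuperalgebra k L) (y : X → L)
    (hy : ∀ x, y x ∈ S.grade (par x)) (hr : ∀ r ∈ rels, S.freeLift y r = 0) :
    LieSuperHom (presentedLie h) S where
  toLinearMap := (lieIdeal par rels).liftQ (S.freeLift y) (lieIdeal_le_ker S hy hr)
  map_grade := by
    rintro i _ ⟨x, hx, rfl⟩
    exact freeLift_mem S hy hx
  map_bracket := by
    intro a b
    obtain ⟨a, rfl⟩ := Submodule.mkQ_surjective _ a
    obtain ⟨b, rfl⟩ := Submodule.mkQ_surjective _ b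
    exact S.freeLift_mul y a b

/-- A submodule of a presented Lie superalgebra that contains the generators and is closed under
brackets is everything. -/
theorem presented_eq_top (h : Homog par rels) {N : Submodule k (Presented par rels)}
    (hof : ∀ x, (lieIdeal par rels).mkQ (FreeNonUnitalNonAssocAlgebra.of k x) ∈ N)
    (hb : ∀ x y, x ∈ N → y ∈ N → (presentedLie h).bracket x y ∈ N) : N = ⊤ := by
  have : N.comap (lieIdeal par rels).mkQ = ⊤ :=
    Free.eq_top_of_mul_mem hof fun x y hx hy => hb _ _ hx hy
  refine eq_top_iff.2 fun x _ => ?_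
  obtain ⟨x, rfl⟩ := Submodule.mkQ_surjective _ x
  exact this.ge (Submodule.mem_top (x := x))

theorem presentedHom_ext (h : Homog par rels) {S : LieSuperalgebra k L}
    {φ ψ : LieSuperHom (presentedLie h) S}
    (hof : ∀ x, φ.toLinearMap ((lieIdeal par rels).mkQ (FreeNonUnitalNonAssocAlgebra.of k x)) =
      ψ.toLinearMap ((lieIdeal par rels).mkQ (FreeNonUnitalNonAssocAlgebra.of k x))) : φ = ψ := by
  have : LinearMap.eqLocus φ.toLinearMap ψ.toLinearMap = ⊤ := by
    refine presented_eq_top h hof fun x y hx hy => ?_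
    have hx' : φ.toLinearMap x = ψ.toLinearMap x := hx
    have hy' : φ.toLinearMap y = ψ.toLinearMap y := hy
    change φ.toLinearMap _ = ψ.toLinearMap _
    rw [φ.map_bracket, ψ.map_bracket, hx', hy']
  exact LieSuperHom.ext (LinearMap.ext fun x => this.ge (Submodule.mem_top (x := x)))

/-- An ideal of a presented Lie superalgebra, that is, a submodule stable under bracketing with
generators, which contains the generators is everything. -/
theorem presented_eq_top_of_ad (h : Homog par rels) {N : Submodule k (Presented par rels)}
    (hof : ∀ x, (lieIdeal par rels).mkQ (FreeNonUnitalNonAssocAlgebra.of k x) ∈ N)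
    (hb : ∀ x, ∀ y ∈ N, (presentedLie h).bracket
      ((lieIdeal par rels).mkQ (FreeNonUnitalNonAssocAlgebra.of k x)) y ∈ N) : N = ⊤ := by
  let S := presentedLie h
  -- The homogeneous elements whose adjoint action preserves `N`. By the Jacobi identity they span a
  -- subalgebra, and it contains the generators.
  let T : ZMod 2 → Submodule k (Presented par rels) := fun i =>
    S.grade i ⊓ ⨅ y ∈ N, N.comap (S.bracket.flip y)
  have hT : ∀ {i x}, x ∈ T i ↔ x ∈ S.grade i ∧ ∀ y ∈ N, S.bracket x y ∈ N := by
    intro i x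
    simp [T, Submodule.mem_iInf]
  have hT' : ∀ {i x}, x ∈ T i → x ∈ T 0 ⊔ T 1 := by
    intro i x hx
    fin_cases i
    · exact Submodule.mem_sup_left hx
    · exact Submodule.mem_sup_right hx
  have hmul : ∀ {i j x y}, x ∈ T i → y ∈ T j → S.bracket x y ∈ T (i + j) := by
    intro i j x y hx hy
    rw [hT] at hx hy ⊢
    refine ⟨S.bracket_mem hx.1 hy.1, fun z hz => ?_⟩
    have := S.jacobi' hx.1 hy.1 z
    rw [← sub_eq_iff_eq_add] at this
    rw [← this]
    exact sub_mem (hx.2 _ (hy.2 _ hz)) (zsmul_mem (hy.2 _ (hx.2 _ hz)) _)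
  have htop : T 0 ⊔ T 1 = ⊤ := by
    refine presented_eq_top h (fun x => hT' (i := par x) (hT.2 ⟨⟨_, freeGrade_of x, rfl⟩, hb x⟩)) ?_
    intro a b ha hb
    obtain ⟨a0, ha0, a1, ha1, rfl⟩ := Submodule.mem_sup.1 ha
    obtain ⟨b0, hb0, b1, hb1, rfl⟩ := Submodule.mem_sup.1 hb
    simp only [map_add, LinearMap.add_apply]
    exact add_mem (add_mem (hT' (hmul ha0 hb0)) (hT' (hmul ha1 hb0)))
      (add_mem (hT' (hmul ha0 hb1)) (hT' (hmul ha1 hb1)))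
  refine presented_eq_top h hof fun x y _ hy => ?_
  obtain ⟨a, ha, b, hb, rfl⟩ := Submodule.mem_sup.1 (htop.ge (Submodule.mem_top (x := x)))
  rw [map_add, LinearMap.add_apply]
  exact add_mem ((hT.1 ha).2 y hy) ((hT.1 hb).2 y hy)

end PresentedHom

/-! ### Signed indices -/

section Index

variable {m : ℕ}

/-- The absolute value of an index. -/
def absIdx : Fin m ⊕ Fin m → Fin m := Sum.elim id id

@[simp] theorem absIdx_swap (p : Fin m ⊕ Fin m) : absIdx p.swap = absIdx p := by
  rcases p with i | i <;> rfl

theorem eq_or_eq_swap {p q : Fin m ⊕ Fin m} (h : absIdx p = absIdx q) : p = q ∨ p = q.swap := by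
  rcases p with i | i <;> rcases q with j | j <;> simp_all [absIdx]

/-- Indices with distinct absolute values. -/
def Far (p q : Fin m ⊕ Fin m) : Prop := absIdx p ≠ absIdx q

theorem Far.symm {p q : Fin m ⊕ Fin m} (h : Far p q) : Far q p := Ne.symm h

@[simp] theorem far_swap_left {p q : Fin m ⊕ Fin m} : Far p.swap q ↔ Far p q := by
  simp [Far]

@[simp] theorem far_swap_right {p q : Fin m ⊕ Fin m} : Far p q.swap ↔ Far p q := by
  simp [Far]

theorem Far.ne {p q : Fin m ⊕ Fin m} (h : Far p q) : p ≠ q := fun e => h (congrArg absIdx e)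

theorem Far.ne_swap {p q : Fin m ⊕ Fin m} (h : Far p q) : p ≠ q.swap := fun e =>
  h ((congrArg absIdx e).trans (absIdx_swap q))

theorem Far.swap_ne {p q : Fin m ⊕ Fin m} (h : Far p q) : p.swap ≠ q := fun e =>
  h ((absIdx_swap p).symm.trans (congrArg absIdx e))

theorem ne_swap_self (p : Fin m ⊕ Fin m) : p ≠ p.swap := by
  rcases p with i | i <;> simp

/-- This is where `3 ≤ m` is needed: two absolute values do not exhaust `Fin m`. -/
theorem exists_far (hm : 3 ≤ m) (p q : Fin m ⊕ Fin m) : ∃ r, Far r p ∧ Far r q := by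
  have : ∃ i : Fin m, i ∉ ({absIdx p, absIdx q} : Finset (Fin m)) := by
    by_contra! h
    have h1 : (Finset.univ : Finset (Fin m)).card ≤ ({absIdx p, absIdx q} : Finset (Fin m)).card :=
      Finset.card_le_card fun i _ => h i
    have h2 := Finset.card_le_two (a := absIdx p) (b := absIdx q)
    rw [Finset.card_univ, Fintype.card_fin] at h1
    omega
  obtain ⟨i, hi⟩ := this
  rw [Finset.mem_insert, Finset.mem_singleton, not_or] at hi
  exact ⟨Sum.inl i, hi.1, hi.2⟩

/-- An index whose absolute value differs from two given ones. -/
def third (hm : 3 ≤ m) (p q : Fin m ⊕ Fin m) : Fin m ⊕ Fin m := (exists_far hm p q).choose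

theorem third_far_left (hm : 3 ≤ m) (p q : Fin m ⊕ Fin m) : Far (third hm p q) p :=
  (exists_far hm p q).choose_spec.1

theorem third_far_right (hm : 3 ≤ m) (p q : Fin m ⊕ Fin m) : Far (third hm p q) q :=
  (exists_far hm p q).choose_spec.2

end Index

/-! ### Systems of root elements -/

section System

variable {k R L : Type*} [CommRing k] [Ring R] [Algebra k R]
  {𝒜 : ZMod 2 → Submodule k R} [GradedAlgebra 𝒜] {m : ℕ}
  [AddCommGroup L] [Module k L]

/-- The map with `prp (e_{pq}(a)) = - e_{q*p*}(tau a)`. -/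
def tau (bar : SuperInvolution 𝒜) (p q : Fin m ⊕ Fin m) : R →ₗ[k] R :=
  -(psign ((1 + idx p) * idx q)) •
    (bar.toFun ∘ₗ if idx p = idx q then LinearMap.id else rho 𝒜)

theorem tau_of_mem (bar : SuperInvolution 𝒜) (p q : Fin m ⊕ Fin m) {α : ZMod 2} {a : R}
    (ha : a ∈ 𝒜 α) : tau bar p q a =
      -(psign ((idx p + idx q) * α + (1 + idx p) * idx q)) • bar.toFun a := by
  rw [tau, LinearMap.smul_apply, LinearMap.comp_apply]
  split_ifs with h
  · rw [h, CharTwo.add_self_eq_zero, zero_mul, zero_add, LinearMap.id_apply]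
  · rw [rho_of_mem 𝒜 ha, map_zsmul, smul_smul, neg_mul, psign_mul_psign]
    have h1 : idx p + idx q = 1 := by
      generalize idx p = x, idx q = y at *
      clear ha
      revert x y; decide
    rw [h1, one_mul, add_comm]

theorem tau_mem (bar : SuperInvolution 𝒜) (p q : Fin m ⊕ Fin m) {α : ZMod 2} {a : R}
    (ha : a ∈ 𝒜 α) : tau bar p q a ∈ 𝒜 α := by
  rw [tau_of_mem bar p q ha]
  exact zsmul_mem (bar.map_mem ha) _

theorem tau_tau (bar : SuperInvolution 𝒜) (p q : Fin m ⊕ Fin m) (a : R) :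
    tau bar q.swap p.swap (tau bar p q a) = a := by
  refine homogeneous_induction 𝒜 (P := fun a => tau bar q.swap p.swap (tau bar p q a) = a)
    (fun α a ha => ?_) (fun a b ha hb => by rw [map_add, map_add, ha, hb]) a
  rw [tau_of_mem bar _ _ (tau_mem bar p q ha), tau_of_mem bar p q ha, map_zsmul, bar.invol,
    smul_smul, idx_swap, idx_swap]
  convert one_smul ℤ a
  generalize idx p = x, idx q = y
  clear ha
  revert x y α; decide

/-- This is the antimultiplicativity of `prp` on `e_{pq}(a) e_{qr}(b)`. Each `prp (e_{pq}(a))`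
carries a minus sign, two on one side against one on the other, which leaves the minus in front. -/
theorem tau_mul (bar : SuperInvolution 𝒜) (p q r : Fin m ⊕ Fin m) {α β : ZMod 2} {a b : R}
    (ha : a ∈ 𝒜 α) (hb : b ∈ 𝒜 β) : tau bar p r (a * b) =
      -koszul (idx p + idx q + α) (idx q + idx r + β) • (tau bar q r b * tau bar p q a) := by
  rw [tau_of_mem bar _ _ (SetLike.mul_mem_graded ha hb), tau_of_mem bar _ _ ha,
    tau_of_mem bar _ _ hb, bar.map_mul ha hb, smul_mul_smul_comm, smul_smul, smul_smul]
  congr 1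
  generalize idx p = x, idx q = y, idx r = z
  clear ha hb
  revert x y z α β; decide

/-- A family of elements `u_{pq}(a)` of a Lie superalgebra with the commutation relations of the
matrices `e_{pq}(a) - prp (e_{pq}(a))`, `q ≠ p, p*`. -/
structure PeriplecticSystem (bar : SuperInvolution 𝒜) (S : LieSuperalgebra k L)
    (u : Fin m ⊕ Fin m → Fin m ⊕ Fin m → R →ₗ[k] L) : Prop where
  mem : ∀ {p q}, Far p q → ∀ {α a}, a ∈ 𝒜 α → u p q a ∈ S.grade (idx p + idx q + α)
  star : ∀ {p q}, Far p q → ∀ a, u p q a = u q.swap p.swap (tau bar p q a)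
  mul : ∀ {p q r}, Far p q → Far q r → Far p r → ∀ a b,
    S.bracket (u p q a) (u q r b) = u p r (a * b)
  zero : ∀ {p q r s}, Far p q → Far r s → q ≠ r → p ≠ s → q ≠ s.swap → p ≠ r.swap → ∀ a b,
    S.bracket (u p q a) (u r s b) = 0

namespace PeriplecticSystem

variable {bar : SuperInvolution 𝒜} {S : LieSuperalgebra k L}
  {u : Fin m ⊕ Fin m → Fin m ⊕ Fin m → R →ₗ[k] L}

theorem one_mem_zero : (1 : R) ∈ 𝒜 0 := SetLike.one_mem_graded 𝒜

variable (hu : PeriplecticSystem bar S u)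

include hu

theorem bracket_mem_comm {p q r s : Fin m ⊕ Fin m} (hpq : Far p q) (hrs : Far r s)
    {N : Submodule k L} (h : ∀ a b, S.bracket (u r s b) (u p q a) ∈ N) (a b : R) :
    S.bracket (u p q a) (u r s b) ∈ N := by
  refine homogeneous_induction 𝒜 (P := fun a => S.bracket (u p q a) (u r s b) ∈ N)
    (fun α a ha => ?_) (fun a a' h h' => by
      rw [map_add, map_add, LinearMap.add_apply]; exact add_mem h h') a
  refine homogeneous_induction 𝒜 (P := fun b => S.bracket (u p q a) (u r s b) ∈ N)
    (fun β b hb => ?_) (fun a a' h h' => by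
      rw [map_add, map_add]; exact add_mem h h') b
  exact S.bracket_mem_comm (hu.mem hrs hb) (hu.mem hpq ha) (h a b)

/-- A bracket of two root elements lies in a submodule as soon as all brackets
`[u_{xy}(a), u_{yz}(b)]` of the same shape do. -/
theorem bracket_mem_of_adjacent {p q r s : Fin m ⊕ Fin m} (hpq : Far p q) (hrs : Far r s)
    {N : Submodule k L}
    (h : ∀ {x y z}, Far x y → Far y z →
      ((Far p r ∨ Far q s) ∧ (Far p s ∨ Far q r) → Far x z) →
      ∀ a b, S.bracket (u x y a) (u y z b) ∈ N) (a b : R) :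
    S.bracket (u p q a) (u r s b) ∈ N := by
  -- The index pairs can meet in four ways. Skew-symmetry reduces `p = s` to `q = r`, and reflecting
  -- the second root element brings the other two cases to these. The condition in `h` says that the
  -- unordered pairs of absolute values of `(p, q)` and `(r, s)` differ.
  by_cases h1 : q = r
  · subst h1
    exact h hpq hrs (fun hd => hd.2.resolve_right fun h => h rfl) a b
  by_cases h2 : p = s
  · subst h2
    exact hu.bracket_mem_comm hpq hrs
      (fun a b => h hrs hpq (fun hd => (hd.2.resolve_left fun h => h rfl).symm) b a) a b
  by_cases h3 : q = s.swap
  · subst h3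
    rw [hu.star hrs]
    exact h hpq (by simpa using hrs.symm) (fun hd => by
      simpa using hd.1.resolve_right fun h => by simp [Far] at h) a _
  by_cases h4 : p = r.swap
  · subst h4
    rw [hu.star hrs]
    refine hu.bracket_mem_comm hpq (by simpa using hrs.symm) (fun a b => ?_) a _
    exact h (by simpa using hrs.symm) hpq (fun hd => by
      simpa using (hd.1.resolve_left fun h => by simp [Far] at h).symm) b a
  rw [hu.zero hpq hrs h1 h2 h3 h4]
  exact zero_mem _

/-- The Jacobi identity for `u_{pq}(a)`, `u_{qr}(b)`, `u_{rp*}(c)`; the third term contains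
`[u_{pq}, u_{rp*}]`, which vanishes. -/
theorem bracket_long_assoc {p q r : Fin m ⊕ Fin m} (hpq : Far p q) (hqr : Far q r)
    (hpr : Far p r) (a b c : R) :
    S.bracket (u p q a) (u q p.swap (b * c)) = S.bracket (u p r (a * b)) (u r p.swap c) := by
  refine homogeneous_induction 𝒜 (P := fun a => S.bracket (u p q a) (u q p.swap (b * c)) =
    S.bracket (u p r (a * b)) (u r p.swap c)) (fun α a ha => ?_) (fun a a' h h' => by
      rw [add_mul, map_add, map_add, map_add, map_add, LinearMap.add_apply, LinearMap.add_apply,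
        h, h']) a
  refine homogeneous_induction 𝒜 (P := fun b => S.bracket (u p q a) (u q p.swap (b * c)) =
    S.bracket (u p r (a * b)) (u r p.swap c)) (fun β b hb => ?_) (fun a a' h h' => by
      rw [mul_add, add_mul, map_add, map_add, map_add, map_add, LinearMap.add_apply, h, h']) b
  rw [← hu.mul hqr (by simpa using hpr.symm) (by simpa using hpq.symm),
    S.jacobi' (hu.mem hpq ha) (hu.mem hqr hb), hu.mul hpq hqr hpr,
    hu.zero hpq (by simpa using hpr.symm) hqr.ne (ne_swap_self p) (by simpa using hpq.ne.symm)
      hpr.ne_swap, map_zero, smul_zero, add_zero]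

/-- For `q`, `r` with distinct absolute values take middle coefficient `1` in `bracket_long_assoc`;
otherwise pass through a third index. -/
theorem bracket_long_indep (hm : 3 ≤ m) {p q r : Fin m ⊕ Fin m} (hpq : Far p q) (hpr : Far p r)
    (a b : R) :
    S.bracket (u p q a) (u q p.swap b) = S.bracket (u p r a) (u r p.swap b) := by
  have key : ∀ {q r : Fin m ⊕ Fin m}, Far p q → Far p r → Far q r →
      S.bracket (u p q a) (u q p.swap b) = S.bracket (u p r a) (u r p.swap b) := by
    intro q r hpq hpr hqr
    simpa using hu.bracket_long_assoc hpq hqr hpr a 1 b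
  by_cases hqr : Far q r
  · exact key hpq hpr hqr
  · obtain ⟨s, hsp, hsq⟩ := exists_far hm p q
    have hsr : Far s r := by
      intro h
      exact hsq (h.trans (not_not.1 hqr).symm)
    exact (key hpq hsp.symm hsq.symm).trans (key hsp.symm hpr hsr)

omit hu in
variable (S u) in
/-- The long root element `u_{p p*}(a)`. -/
def longRoot (hm : 3 ≤ m) (p : Fin m ⊕ Fin m) : R →ₗ[k] L :=
  S.bracket.flip (u (third hm p p) p.swap 1) ∘ₗ u p (third hm p p)

theorem bracket_long (hm : 3 ≤ m) {p q : Fin m ⊕ Fin m} (hpq : Far p q) (a b : R) :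
    S.bracket (u p q a) (u q p.swap b) = longRoot S u hm p (a * b) := by
  obtain ⟨r, hrp, hrq⟩ := exists_far hm p q
  have := hu.bracket_long_assoc hpq hrq.symm hrp.symm a b 1
  rw [mul_one] at this
  rw [this]
  exact hu.bracket_long_indep hm hrp.symm (third_far_left hm p p).symm _ _

/-- Reflecting both factors of `[u_{pq}(a), u_{qp*}(1)]` gives a bracket of the same shape in the
opposite order, so skew-symmetry yields the reflection rule for long roots. -/
theorem longRoot_tau (hm : 3 ≤ m) (p : Fin m ⊕ Fin m) (a : R) :
    longRoot S u hm p (tau bar p p.swap a) = longRoot S u hm p a := by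
  refine homogeneous_induction 𝒜 (P := fun a => longRoot S u hm p (tau bar p p.swap a) =
    longRoot S u hm p a) (fun α a ha => ?_) (fun a b h h' => by simp only [map_add, h, h']) a
  obtain ⟨q, hqp, -⟩ := exists_far hm p p
  have h1 := hu.bracket_long hm hqp.symm a 1
  have hq : Far q p.swap := by simpa using hqp
  rw [mul_one, S.skew (hu.mem hqp.symm ha) (hu.mem hq one_mem_zero), hu.star hq,
    hu.star hqp.symm, Sum.swap_swap, hu.bracket_long hm (by simpa using hqp.symm)] at h1
  rw [← h1, tau_of_mem bar p p.swap ha, tau_of_mem bar p q ha, tau_of_mem bar _ _ one_mem_zero,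
    bar.map_one, smul_mul_smul_comm, one_mul, map_zsmul, map_zsmul, smul_smul, ← neg_smul,
    idx_swap]
  congr 1
  generalize idx p = x, idx q = y
  clear h1 ha
  revert x y α; decide

/-! ### Cartan-type elements and their identities -/

/-- The Cartan-type elements `[u_{pq}(a), u_{qp}(b)]` satisfy a three-term relation. -/
theorem bracket_cartan {p q r : Fin m ⊕ Fin m} (hpq : Far p q) (hqr : Far q r)
    (hpr : Far p r) {α β γ : ZMod 2} {a b c : R} (ha : a ∈ 𝒜 α) (hb : b ∈ 𝒜 β) (hc : c ∈ 𝒜 γ) :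
    S.bracket (u p q a) (u q p (b * c)) = S.bracket (u p r (a * b)) (u r p c) +
      psign ((idx p + idx q + α) * (idx q + idx r + β) + (idx p + idx q + α) * (idx r + idx p + γ)
        + (idx q + idx r + β) * (idx r + idx q + (γ + α))) •
        S.bracket (u r q (c * a)) (u q r b) := by
  rw [← hu.mul hqr hpr.symm hpq.symm, S.jacobi' (hu.mem hpq ha) (hu.mem hqr hb),
    hu.mul hpq hqr hpr, S.skew (hu.mem hpq ha) (hu.mem hpr.symm hc),
    hu.mul hpr.symm hpq hqr.symm, map_neg, map_zsmul,
    S.skew (hu.mem hqr hb) (hu.mem hqr.symm (SetLike.mul_mem_graded hc ha))]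
  simp only [smul_neg, neg_neg, smul_smul, koszul_eq, psign_mul_psign, ← add_assoc]

omit hu in
variable (𝒜 S u) in
/-- The elements `± [u_{pq}(a), u_{qp}(b)]` with normalized signs. -/
def cartan (p q : Fin m ⊕ Fin m) : R →ₗ[k] R →ₗ[k] L :=
  psign (idx p) • S.bracket.compl₁₂ (u p q ∘ₗ if idx p = 0 then LinearMap.id else rho 𝒜)
    (u q p ∘ₗ if idx p = 0 then LinearMap.id else rho 𝒜)

omit hu in
theorem cartan_of_mem (p q : Fin m ⊕ Fin m) {α β : ZMod 2} {a b : R}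
    (ha : a ∈ 𝒜 α) (hb : b ∈ 𝒜 β) : cartan 𝒜 S u p q a b =
      psign (idx p * (1 + α + β)) • S.bracket (u p q a) (u q p b) := by
  simp only [cartan, LinearMap.smul_apply, LinearMap.compl₁₂_apply, LinearMap.comp_apply]
  split_ifs with h
  · rw [h, zero_mul]
    rfl
  · have h1 : idx p = 1 := by
      generalize idx p = x at *
      clear ha hb
      revert x; decide
    rw [rho_of_mem 𝒜 ha, rho_of_mem 𝒜 hb, h1]
    simp only [map_zsmul, LinearMap.smul_apply, smul_smul]
    congr 1
    clear ha hb
    revert α β; decide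

/-- The signs in `cartan` are normalized so that the parities of `p` and `q` drop out here, leaving
the Koszul sign of the coefficients. -/
theorem cartan_skew {p q : Fin m ⊕ Fin m} (hpq : Far p q) {α β : ZMod 2} {a b : R}
    (ha : a ∈ 𝒜 α) (hb : b ∈ 𝒜 β) :
    cartan 𝒜 S u p q a b = -(koszul α β • cartan 𝒜 S u q p b a) := by
  rw [cartan_of_mem p q ha hb, cartan_of_mem q p hb ha, S.skew (hu.mem hpq ha) (hu.mem hpq.symm hb),
    smul_neg, smul_smul, smul_smul]
  congr 2
  generalize idx p = x, idx q = y
  clear ha hb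
  revert x y α β; decide

/-- Reflecting both factors produces `bar` with signs depending on the parities of `a` and `b`;
these signs are exactly those of `ρ`. This is why the twisted involution, and not `bar`, governs the
kernel. -/
theorem cartan_star {p q : Fin m ⊕ Fin m} (hpq : Far p q) {α β : ZMod 2} {a b : R}
    (ha : a ∈ 𝒜 α) (hb : b ∈ 𝒜 β) : cartan 𝒜 S u p q a b =
      -cartan 𝒜 S u q.swap p.swap (bar.twist.toFun a) (bar.twist.toFun b) := by
  rw [cartan_of_mem p q ha hb, cartan_of_mem _ _ (bar.twist.map_mem ha) (bar.twist.map_mem hb),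
    hu.star hpq, hu.star hpq.symm, tau_of_mem bar _ _ ha, tau_of_mem bar _ _ hb]
  change _ = -(_ • S.bracket (u _ _ (bar.toFun (rho 𝒜 a))) (u _ _ (bar.toFun (rho 𝒜 b))))
  rw [rho_of_mem 𝒜 ha, rho_of_mem 𝒜 hb, idx_swap]
  simp only [map_zsmul, LinearMap.smul_apply, smul_smul, ← neg_smul]
  congr 1
  generalize idx p = x, idx q = y
  clear ha hb
  revert x y α β; decide

theorem cartan_cyclic {p q r : Fin m ⊕ Fin m} (hpq : Far p q) (hqr : Far q r)
    (hpr : Far p r) {α β γ : ZMod 2} {a b c : R} (ha : a ∈ 𝒜 α) (hb : b ∈ 𝒜 β) (hc : c ∈ 𝒜 γ) :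
    cartan 𝒜 S u p q a (b * c) = cartan 𝒜 S u p r (a * b) c +
      koszul (α + β) γ • cartan 𝒜 S u r q (c * a) b := by
  rw [cartan_of_mem p q ha (SetLike.mul_mem_graded hb hc),
    cartan_of_mem p r (SetLike.mul_mem_graded ha hb) hc,
    cartan_of_mem r q (SetLike.mul_mem_graded hc ha) hb, hu.bracket_cartan hpq hqr hpr ha hb hc,
    smul_add, smul_smul, smul_smul]
  congr 2
  · congr 1
    ring
  · generalize idx p = x, idx q = y, idx r = z
    clear ha hb hc
    revert x y z α β γ; decide

/-! ### The span of root and Cartan-type elements -/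

omit hu in
variable (S u) in
/-- The span of the short root elements. -/
def shortSpan : Submodule k L :=
  Submodule.span k {x | ∃ p q a, Far p q ∧ x = u p q a}

omit hu in
variable (S u) in
/-- The span of all root elements and the Cartan-type elements. -/
def fullSpan (hm : 3 ≤ m) : Submodule k L :=
  Submodule.span k ({x | ∃ p q a, Far p q ∧ x = u p q a} ∪ {x | ∃ p a, x = longRoot S u hm p a} ∪
    {x | ∃ p q a b, Far p q ∧ x = S.bracket (u p q a) (u q p b)})

omit hu in
theorem short_mem_shortSpan {p q : Fin m ⊕ Fin m} (h : Far p q) (a : R) :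
    u p q a ∈ shortSpan u := Submodule.subset_span ⟨p, q, a, h, rfl⟩

omit hu in
theorem short_mem_fullSpan (hm : 3 ≤ m) {p q : Fin m ⊕ Fin m} (h : Far p q) (a : R) :
    u p q a ∈ fullSpan S u hm := Submodule.subset_span (Or.inl (Or.inl ⟨p, q, a, h, rfl⟩))

theorem bracket_short_mem_shortSpan {p q r s : Fin m ⊕ Fin m} (hpq : Far p q) (hrs : Far r s)
    (hd : (Far p r ∨ Far q s) ∧ (Far p s ∨ Far q r)) (a b : R) :
    S.bracket (u p q a) (u r s b) ∈ shortSpan u := by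
  refine hu.bracket_mem_of_adjacent hpq hrs (fun {x y z} hxy hyz h a b => ?_) a b
  rw [hu.mul hxy hyz (h hd)]
  exact short_mem_shortSpan (h hd) _

/-- After reduction to `[u_{xy}(a), u_{yz}(b)]` the outer indices are far apart, equal or swapped,
which gives a short, a Cartan-type or a long element. -/
theorem bracket_short_mem_fullSpan (hm : 3 ≤ m) {p q r s : Fin m ⊕ Fin m} (hpq : Far p q)
    (hrs : Far r s) (a b : R) : S.bracket (u p q a) (u r s b) ∈ fullSpan S u hm := by
  refine hu.bracket_mem_of_adjacent hpq hrs (fun {x y z} hxy hyz h a b => ?_) a b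
  by_cases hxz : Far x z
  · rw [hu.mul hxy hyz hxz]
    exact short_mem_fullSpan hm hxz _
  · rcases eq_or_eq_swap (not_not.1 hxz) with rfl | e
    · exact Submodule.subset_span (Or.inr ⟨x, y, a, b, hxy, rfl⟩)
    · have : z = x.swap := by rw [e, Sum.swap_swap]
      subst this
      rw [hu.bracket_long hm hxy]
      exact Submodule.subset_span (Or.inl (Or.inr ⟨x, _, rfl⟩))

theorem bracket_shortSpan_mem_fullSpan (hm : 3 ≤ m) {x y : L} (hx : x ∈ shortSpan u)
    (hy : y ∈ shortSpan u) : S.bracket x y ∈ fullSpan S u hm := by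
  have : shortSpan u ≤ (fullSpan S u hm).comap (S.bracket.flip y) := by
    refine Submodule.span_le.2 ?_
    rintro _ ⟨p, q, a, hpq, rfl⟩
    have : shortSpan u ≤ (fullSpan S u hm).comap (S.bracket (u p q a)) := by
      refine Submodule.span_le.2 ?_
      rintro _ ⟨r, s, b, hrs, rfl⟩
      exact hu.bracket_short_mem_fullSpan hm hpq hrs a b
    exact this hy
  exact this hx

/-- The hypotheses say that the outer index pair differs, in absolute values and up to order, from
each inner pair. After the Jacobi identity every inner bracket is then short, and only brackets of
two short elements remain. -/
theorem bracket_bracket_mem_fullSpan (hm : 3 ≤ m) {p q r s t n : Fin m ⊕ Fin m} (hpq : Far p q)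
    (hrs : Far r s) (htn : Far t n)
    (h1 : (Far p r ∨ Far q s) ∧ (Far p s ∨ Far q r))
    (h2 : (Far p t ∨ Far q n) ∧ (Far p n ∨ Far q t)) (a b c : R) :
    S.bracket (u p q a) (S.bracket (u r s b) (u t n c)) ∈ fullSpan S u hm := by
  refine homogeneous_induction 𝒜 (P := fun a =>
    S.bracket (u p q a) (S.bracket (u r s b) (u t n c)) ∈ fullSpan S u hm)
    (fun α a ha => ?_) (fun a a' h h' => by
      rw [map_add, map_add, LinearMap.add_apply]; exact add_mem h h') a
  refine homogeneous_induction 𝒜 (P := fun b =>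
    S.bracket (u p q a) (S.bracket (u r s b) (u t n c)) ∈ fullSpan S u hm)
    (fun β b hb => ?_) (fun a a' h h' => by
      rw [map_add, map_add, LinearMap.add_apply, map_add]; exact add_mem h h') b
  rw [S.jacobi' (hu.mem hpq ha) (hu.mem hrs hb)]
  exact add_mem (hu.bracket_shortSpan_mem_fullSpan hm
    (hu.bracket_short_mem_shortSpan hpq hrs h1 _ _) (short_mem_shortSpan htn _))
    (zsmul_mem (hu.bracket_shortSpan_mem_fullSpan hm (short_mem_shortSpan hrs _)
      (hu.bracket_short_mem_shortSpan hpq htn h2 _ _)) _)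

/-- The span of all root and Cartan-type elements is stable under brackets with root elements. -/
theorem bracket_mem_fullSpan (hm : 3 ≤ m) {r s : Fin m ⊕ Fin m} (hrs : Far r s) (c : R) {x : L}
    (hx : x ∈ fullSpan S u hm) : S.bracket (u r s c) x ∈ fullSpan S u hm := by
  have : fullSpan S u hm ≤ (fullSpan S u hm).comap (S.bracket (u r s c)) := by
    refine Submodule.span_le.2 ?_
    rintro _ ((⟨p, q, a, hpq, rfl⟩ | ⟨p, a, rfl⟩) | ⟨p, q, a, b, hpq, rfl⟩)
    · exact hu.bracket_short_mem_fullSpan hm hrs hpq _ _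
    -- A long root element at `p` can be written through any `q` far from `p`; it remains to choose
    -- `q` so that `{p, q}` and `{r, s}` differ in absolute values.
    · have key : ∀ q, Far q p → (Far r p ∨ Far s q) ∧ (Far r q ∨ Far s p) →
          S.bracket (u r s c) (longRoot S u hm p a) ∈ fullSpan S u hm := by
        intro q hqp hd
        rw [← mul_one a, ← hu.bracket_long hm hqp.symm]
        exact hu.bracket_bracket_mem_fullSpan hm hrs hqp.symm (by simpa using hqp) hd
          (by simpa [or_comm, and_comm] using hd) _ _ _
      by_cases hrp : Far r p
      · obtain ⟨q, hqp, hqr⟩ := exists_far hm p r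
        exact key q hqp ⟨Or.inl hrp, Or.inl hqr.symm⟩
      · obtain ⟨q, hqp, hqs⟩ := exists_far hm p s
        refine key q hqp ⟨Or.inr hqs.symm, Or.inl ?_⟩
        intro h
        exact hqp (h.symm.trans (not_not.1 hrp))
    · change S.bracket (u r s c) (S.bracket (u p q a) (u q p b)) ∈ fullSpan S u hm
      have key : ∀ {p q}, Far p q → (Far r p ∨ Far s q) ∧ (Far r q ∨ Far s p) → ∀ a b,
          S.bracket (u r s c) (S.bracket (u p q a) (u q p b)) ∈ fullSpan S u hm :=
        fun hpq hd a b =>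
          hu.bracket_bracket_mem_fullSpan hm hrs hpq hpq.symm hd ⟨hd.2, hd.1⟩ _ _ _
      by_cases hd : (Far r p ∨ Far s q) ∧ (Far r q ∨ Far s p)
      · exact key hpq hd a b
      -- Here `{p, q}` and `{r, s}` agree in absolute values. The three-term relation with middle
      -- coefficient `1` replaces the pair `p, q` by the pairs `p, t` and `t, q`, to which `key`
      -- applies.
      · obtain ⟨t, htp, htq⟩ := exists_far hm p q
        have hd1 : (Far r p ∨ Far s t) ∧ (Far r t ∨ Far s p) := by
          simp only [Far] at *
          grind
        have hd2 : (Far r t ∨ Far s q) ∧ (Far r q ∨ Far s t) := by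
          simp only [Far] at *
          grind
        refine homogeneous_induction 𝒜 (P := fun a => S.bracket (u r s c)
          (S.bracket (u p q a) (u q p b)) ∈ fullSpan S u hm) (fun α a ha => ?_)
          (fun a a' h h' => by
            rw [map_add, map_add, LinearMap.add_apply, map_add]; exact add_mem h h') a
        refine homogeneous_induction 𝒜 (P := fun b => S.bracket (u r s c)
          (S.bracket (u p q a) (u q p b)) ∈ fullSpan S u hm) (fun β b hb => ?_)
          (fun a a' h h' => by
            rw [map_add, map_add, map_add]; exact add_mem h h') b
        rw [← one_mul b, hu.bracket_cartan hpq htq.symm htp.symm ha one_mem_zero hb, map_add,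
          map_zsmul]
        exact add_mem (key htp.symm hd1 _ _) (zsmul_mem (key htq hd2 _ _) _)
  exact this hx

end PeriplecticSystem

end System

/-! ### Systems of Cartan-type elements -/

theorem koszul_eq_one_or (i j : ZMod 2) : koszul i j = 1 ∨ koszul i j = -1 := by
  revert i j; decide

section SFlip

variable {k R : Type*} [CommRing k] [Ring R] [Algebra k R]
  (𝒜 : ZMod 2 → Submodule k R) [GradedAlgebra 𝒜]

/-- The opposite multiplication `(a, b) ↦ (-1) ^ (|a| |b|) b a`. -/
def superFlip : R →ₗ[k] R →ₗ[k] R := LinearMap.mul k R - superBracket 𝒜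

theorem superFlip_of_mem {α β : ZMod 2} {a b : R} (ha : a ∈ 𝒜 α) (hb : b ∈ 𝒜 β) :
    superFlip 𝒜 a b = koszul α β • (b * a) := by
  rw [superFlip, LinearMap.sub_apply, LinearMap.sub_apply, superBracket_of_mem 𝒜 ha hb,
    LinearMap.mul_apply', sub_sub_cancel]

variable {𝒜}

/-- An anti-automorphism exchanges the two terms of a supercommutator. -/
theorem SuperInvolution.map_superBracket (σ : SuperInvolution 𝒜) (a b : R) :
    σ.toFun (superBracket 𝒜 a b) = -superBracket 𝒜 (σ.toFun a) (σ.toFun b) := by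
  have : (superBracket 𝒜).compr₂ σ.toFun = -(superBracket 𝒜).compl₁₂ σ.toFun σ.toFun := by
    refine linearMap_ext_homogeneous₂ 𝒜 fun i j a ha b hb => ?_
    simp only [LinearMap.compr₂_apply, LinearMap.neg_apply, LinearMap.compl₁₂_apply]
    rw [superBracket_of_mem 𝒜 ha hb, superBracket_of_mem 𝒜 (σ.map_mem ha) (σ.map_mem hb), map_sub,
      map_zsmul, σ.map_mul ha hb, σ.map_mul hb ha, smul_smul, koszul_comm j i, koszul_sq, one_smul,
      neg_sub]
  exact LinearMap.congr_fun₂ this a b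

theorem SuperInvolution.map_superFlip (σ : SuperInvolution 𝒜) (a b : R) :
    superFlip 𝒜 (σ.toFun a) (σ.toFun b) = σ.toFun (a * b) := by
  have : (superFlip 𝒜).compl₁₂ σ.toFun σ.toFun = (LinearMap.mul k R).compr₂ σ.toFun := by
    refine linearMap_ext_homogeneous₂ 𝒜 fun i j a ha b hb => ?_
    simp only [LinearMap.compr₂_apply, LinearMap.compl₁₂_apply, LinearMap.mul_apply']
    rw [superFlip_of_mem 𝒜 (σ.map_mem ha) (σ.map_mem hb), σ.map_mul ha hb]
  exact LinearMap.congr_fun₂ this a b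

theorem mul_sub_superFlip (a b : R) : a * b - superFlip 𝒜 a b = superBracket 𝒜 a b := by
  rw [superFlip, LinearMap.sub_apply, LinearMap.sub_apply, LinearMap.mul_apply', sub_sub_cancel]

end SFlip

section CartanSystem

variable {k R M : Type*} [CommRing k] [Ring R] [Algebra k R]
  {𝒜 : ZMod 2 → Submodule k R} [GradedAlgebra 𝒜] {m : ℕ}
  [AddCommGroup M] [Module k M]

/-- The identities between the elements `± [u_{pq}(a), u_{qp}(b)]`. -/
structure CartanSystem (σ : SuperInvolution 𝒜)
    (c : Fin m ⊕ Fin m → Fin m ⊕ Fin m → R →ₗ[k] R →ₗ[k] M) : Prop where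
  skew : ∀ {p q}, Far p q → ∀ {α β a b}, a ∈ 𝒜 α → b ∈ 𝒜 β →
    c p q a b = -(koszul α β • c q p b a)
  star : ∀ {p q}, Far p q → ∀ a b,
    c p q a b = -c q.swap p.swap (σ.toFun a) (σ.toFun b)
  cyclic : ∀ {p q r}, Far p q → Far q r → Far p r → ∀ {α β γ x y z}, x ∈ 𝒜 α → y ∈ 𝒜 β →
    z ∈ 𝒜 γ → c p q x (y * z) = c p r (x * y) z + koszul (α + β) γ • c r q (z * x) y

theorem PeriplecticSystem.cartanSystem {L : Type*} [AddCommGroup L] [Module k L]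
    {bar : SuperInvolution 𝒜} {S : LieSuperalgebra k L}
    {u : Fin m ⊕ Fin m → Fin m ⊕ Fin m → R →ₗ[k] L} (hu : PeriplecticSystem bar S u) :
    CartanSystem bar.twist (PeriplecticSystem.cartan 𝒜 S u) where
  skew h _ _ _ _ ha hb := hu.cartan_skew h ha hb
  star {p q} h a b := by
    have : PeriplecticSystem.cartan 𝒜 S u p q =
        -(PeriplecticSystem.cartan 𝒜 S u q.swap p.swap).compl₁₂ bar.twist.toFun
          bar.twist.toFun :=
      linearMap_ext_homogeneous₂ 𝒜 fun i j a ha b hb => hu.cartan_star h ha hb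
    exact LinearMap.congr_fun₂ this a b
  cyclic h1 h2 h3 _ _ _ _ _ _ ha hb hc := hu.cartan_cyclic h1 h2 h3 ha hb hc

namespace CartanSystem

variable {σ : SuperInvolution 𝒜} {c : Fin m ⊕ Fin m → Fin m ⊕ Fin m → R →ₗ[k] R →ₗ[k] M}

theorem one_mem_zero : (1 : R) ∈ 𝒜 0 := SetLike.one_mem_graded 𝒜

variable (hc : CartanSystem σ c)

include hc

/-- The cyclic identity with `z = 1`: the first index moves from `p` to `r` at the cost of a term
with second argument `1`. The choice `y = 1` in `right_sub` moves the second index. -/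
theorem left_sub {p q r : Fin m ⊕ Fin m} (hpq : Far p q) (hqr : Far q r) (hpr : Far p r)
    {α β : ZMod 2} {a b : R} (ha : a ∈ 𝒜 α) (hb : b ∈ 𝒜 β) :
    c p q a b = c p r (a * b) 1 + c r q a b := by
  have := hc.cyclic hpq hqr hpr ha hb one_mem_zero
  rwa [mul_one, one_mul, koszul_zero_right, one_smul] at this

theorem right_sub {p q r : Fin m ⊕ Fin m} (hpq : Far p q) (hqr : Far q r) (hpr : Far p r)
    {α β : ZMod 2} {a b : R} (ha : a ∈ 𝒜 α) (hb : b ∈ 𝒜 β) :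
    c p q a b = c p r a b + koszul α β • c r q (b * a) 1 := by
  have := hc.cyclic hpq hqr hpr ha one_mem_zero hb
  rwa [mul_one, one_mul, add_zero] at this

/-- The elements `c p q a 1` behave like "`a` at `p` minus `a` at `q`"; this is the telescoping
rule. -/
theorem one_add {p q r : Fin m ⊕ Fin m} (hpq : Far p q) (hqr : Far q r) (hpr : Far p r)
    (a : R) : c p q a 1 = c p r a 1 + c r q a 1 :=
  homogeneous_induction 𝒜 (P := fun a => c p q a 1 = c p r a 1 + c r q a 1)
    (fun α a ha => by simpa using hc.left_sub hpq hqr hpr ha one_mem_zero)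
    (fun a b h h' => by simp only [map_add, LinearMap.add_apply, h, h']; abel) a

/-- Antisymmetry comes from adding two telescoping identities on `p`, `q`, `r`, since `one_add`
itself requires three far indices. -/
theorem one_neg (hm : 3 ≤ m) {p q : Fin m ⊕ Fin m} (hpq : Far p q) (a : R) :
    c q p a 1 = -c p q a 1 := by
  obtain ⟨r, hrp, hrq⟩ := exists_far hm p q
  have h1 := hc.one_add hrp hpq hrq a
  have h2 := hc.one_add hrq hpq.symm hrp a
  linear_combination (norm := module) -h1 - h2

theorem one_star (hm : 3 ≤ m) {p q : Fin m ⊕ Fin m} (hpq : Far p q) (a : R) :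
    c p q (σ.toFun a) 1 = c p.swap q.swap a 1 := by
  rw [hc.star hpq, σ.invol, σ.map_one, hc.one_neg hm (by simpa using hpq), neg_neg]

/-- Removing the diagonal contribution at the second index leaves something attached to `p` alone.
-/
theorem lam_indep (hm : 3 ≤ m) {p q r : Fin m ⊕ Fin m} (hpq : Far p q) (hpr : Far p r)
    (a b : R) : c p q a b - c p q (superFlip 𝒜 a b) 1 = c p r a b - c p r (superFlip 𝒜 a b) 1 := by
  have key : ∀ {q r : Fin m ⊕ Fin m}, Far p q → Far p r → Far q r →
      c p q a b - c p q (superFlip 𝒜 a b) 1 = c p r a b - c p r (superFlip 𝒜 a b) 1 := by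
    intro q r hpq hpr hqr
    have : c p q - (superFlip 𝒜).compr₂ ((c p q).flip 1) =
        c p r - (superFlip 𝒜).compr₂ ((c p r).flip 1) := by
      refine linearMap_ext_homogeneous₂ 𝒜 fun i j a ha b hb => ?_
      simp only [LinearMap.sub_apply, LinearMap.compr₂_apply, LinearMap.flip_apply]
      rw [superFlip_of_mem 𝒜 ha hb, map_zsmul, map_zsmul, LinearMap.smul_apply,
        LinearMap.smul_apply, hc.right_sub hpq hqr hpr ha hb, hc.one_add hpq hqr hpr]
      module
    exact LinearMap.congr_fun₂ this a b
  by_cases hqr : Far q r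
  · exact key hpq hpr hqr
  · obtain ⟨s, hsp, hsq⟩ := exists_far hm p q
    have hsr : Far s r := by
      intro h
      exact hsq (h.trans (not_not.1 hqr).symm)
    exact (key hpq hsp.symm hsq.symm).trans (key hsp.symm hpr hsr)

omit hc in
variable (𝒜 c) in
/-- The elements `λ_p(a, b)`, corresponding to diagonal entries `[a, b]` at `p`. -/
def lam (hm : 3 ≤ m) (p : Fin m ⊕ Fin m) : R →ₗ[k] R →ₗ[k] M :=
  c p (third hm p p) - (superFlip 𝒜).compr₂ ((c p (third hm p p)).flip 1)

theorem eq_lam_add (hm : 3 ≤ m) {p q : Fin m ⊕ Fin m} (hpq : Far p q) (a b : R) :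
    c p q a b = lam 𝒜 c hm p a b + c p q (superFlip 𝒜 a b) 1 := by
  rw [← sub_eq_iff_eq_add, hc.lam_indep hm hpq (third_far_left hm p p).symm]
  rfl

/-- Express `c p q` and `c r q` through `lam` and compare them by `left_sub`: the diagonal terms
`ab` and `± ba` combine to the supercommutator. -/
theorem lam_sub_lam_far (hm : 3 ≤ m) {p r : Fin m ⊕ Fin m} (hpr : Far p r) (a b : R) :
    lam 𝒜 c hm p a b - lam 𝒜 c hm r a b = c p r (superBracket 𝒜 a b) 1 := by
  have : lam 𝒜 c hm p - lam 𝒜 c hm r = (superBracket 𝒜).compr₂ ((c p r).flip 1) := by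
    refine linearMap_ext_homogeneous₂ 𝒜 fun i j a ha b hb => ?_
    obtain ⟨q, hqp, hqr⟩ := exists_far hm p r
    have h1 := hc.eq_lam_add hm hqp.symm a b
    have h2 := hc.eq_lam_add hm hqr.symm a b
    have h3 := hc.left_sub hqp.symm hqr hpr ha hb
    have h4 := hc.one_add hqp.symm hqr hpr (superFlip 𝒜 a b)
    simp only [LinearMap.sub_apply, LinearMap.compr₂_apply, LinearMap.flip_apply]
    rw [← mul_sub_superFlip, map_sub, LinearMap.sub_apply]
    rw [h1, h2, h4] at h3
    linear_combination (norm := module) h3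
  exact LinearMap.congr_fun₂ this a b

/-- Substitute `eq_lam_add` into the cyclic identity. One term is based at `r`; moving it to `p`
produces a supercommutator correction, which cancels the remaining diagonal terms. -/
theorem lam_cyclic (hm : 3 ≤ m) (p : Fin m ⊕ Fin m) {α β γ : ZMod 2} {x y z : R}
    (hx : x ∈ 𝒜 α) (hy : y ∈ 𝒜 β) (hz : z ∈ 𝒜 γ) :
    lam 𝒜 c hm p x (y * z) =
      lam 𝒜 c hm p (x * y) z + koszul (α + β) γ • lam 𝒜 c hm p (z * x) y := by
  obtain ⟨q, hqp, -⟩ := exists_far hm p p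
  obtain ⟨r, hrp, hrq⟩ := exists_far hm p q
  have h0 := hc.cyclic hqp.symm hrq.symm hrp.symm hx hy hz
  have h1 := hc.lam_sub_lam_far hm hrp.symm (z * x) y
  have h2 := hc.one_add hqp.symm hrq.symm hrp.symm (y * z * x)
  rw [hc.eq_lam_add hm hqp.symm, hc.eq_lam_add hm hrp.symm, hc.eq_lam_add hm hrq,
    superFlip_of_mem 𝒜 hx (SetLike.mul_mem_graded hy hz),
    superFlip_of_mem 𝒜 (SetLike.mul_mem_graded hx hy) hz,
    superFlip_of_mem 𝒜 (SetLike.mul_mem_graded hz hx) hy] at h0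
  rw [superBracket_of_mem 𝒜 (SetLike.mul_mem_graded hz hx) hy] at h1
  simp only [koszul_add_left, koszul_add_right, map_zsmul, LinearMap.smul_apply, map_sub,
    LinearMap.sub_apply, mul_assoc, koszul_comm γ β] at h0 h1 h2 ⊢
  rcases koszul_eq_one_or α β with e1 | e1 <;> rcases koszul_eq_one_or β γ with e2 | e2 <;>
    rcases koszul_eq_one_or α γ with e3 | e3 <;>
    simp only [e1, e2, e3, one_smul, neg_smul, mul_one, mul_neg, neg_neg, h2] at h0 h1 ⊢ <;>
    first
      | linear_combination (norm := module) h0 + h1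
      | linear_combination (norm := module) h0 - h1

theorem lam_skew (hm : 3 ≤ m) (p : Fin m ⊕ Fin m) {α β : ZMod 2} {a b : R}
    (ha : a ∈ 𝒜 α) (hb : b ∈ 𝒜 β) :
    lam 𝒜 c hm p a b = -(koszul α β • lam 𝒜 c hm p b a) := by
  obtain ⟨q, hqp, -⟩ := exists_far hm p p
  have h0 := hc.skew hqp.symm ha hb
  have h1 := hc.lam_sub_lam_far hm hqp.symm b a
  rw [hc.eq_lam_add hm hqp.symm, hc.eq_lam_add hm hqp, superFlip_of_mem 𝒜 ha hb,
    superFlip_of_mem 𝒜 hb ha, hc.one_neg hm hqp.symm] at h0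
  rw [superBracket_of_mem 𝒜 hb ha] at h1
  simp only [map_zsmul, LinearMap.smul_apply, map_sub, LinearMap.sub_apply,
    koszul_comm β α] at h0 h1
  rcases koszul_eq_one_or α β with e1 | e1 <;>
    simp only [e1, one_smul, neg_smul, neg_neg] at h0 h1 ⊢
  · linear_combination (norm := module) h0 + h1
  · linear_combination (norm := module) h0 - h1

/-- The reflection moves the base index from `p` to `p.swap`. Hence a single `lam` does not satisfy
the involution relation of dihedral homology, and an average over both indices is needed. -/
theorem lam_star (hm : 3 ≤ m) (p : Fin m ⊕ Fin m) (a b : R) :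
    lam 𝒜 c hm p.swap (σ.toFun a) (σ.toFun b) = -lam 𝒜 c hm p a b := by
  obtain ⟨q, hqp, -⟩ := exists_far hm p p
  have h0 := hc.star hqp a b
  have h1 := hc.lam_sub_lam_far hm hqp a b
  have hs : Far p.swap q.swap := by simpa using hqp.symm
  rw [hc.eq_lam_add hm hqp a b, hc.eq_lam_add hm hs, σ.map_superFlip, hc.one_star hm hs,
    Sum.swap_swap, Sum.swap_swap, hc.one_neg hm hqp] at h0
  rw [← mul_sub_superFlip, map_sub, LinearMap.sub_apply] at h1
  linear_combination (norm := module) h0 - h1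

/-! ### Diagonal elements relative to a base index, and symmetrization -/

omit hc in
variable (c) in
/-- The element corresponding to diagonal entries `a` at `p` and `-a` at `p₀`. -/
def diff (hm : 3 ≤ m) (p₀ p : Fin m ⊕ Fin m) : R →ₗ[k] M :=
  (c p (third hm p p₀)).flip 1 + (c (third hm p p₀) p₀).flip 1

theorem diff_far (hm : 3 ≤ m) {p₀ p : Fin m ⊕ Fin m} (h : Far p p₀) (a : R) :
    diff c hm p₀ p a = c p p₀ a 1 :=
  (hc.one_add h (third_far_right hm p p₀).symm (third_far_left hm p p₀).symm a).symm

/-- The auxiliary index in `diff` is irrelevant, even if `p` and `p₀` have equal absolute value. The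
case `p = p₀.swap` is not covered by any single `c p p₀`, so the detour through `t` is needed. -/
theorem diff_eq (hm : 3 ≤ m) {p₀ p t : Fin m ⊕ Fin m} (htp : Far t p) (ht : Far t p₀) (a : R) :
    diff c hm p₀ p a = c p t a 1 + c t p₀ a 1 := by
  have key : ∀ {s t}, Far t p → Far t p₀ → Far s p → Far s p₀ → Far s t →
      c p s a 1 + c s p₀ a 1 = c p t a 1 + c t p₀ a 1 := by
    intro s t htp ht hsp hs hst
    rw [hc.one_add hsp.symm hst htp.symm, hc.one_add ht hs.symm hst.symm, add_assoc]
  have hsp := third_far_left hm p p₀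
  have hs := third_far_right hm p p₀
  change c p (third hm p p₀) a 1 + c (third hm p p₀) p₀ a 1 = _
  generalize third hm p p₀ = s at *
  by_cases hst : Far s t
  · exact key htp ht hsp hs hst
  by_cases hp : Far p p₀
  · rw [← hc.one_add hp hs.symm hsp.symm, ← hc.one_add hp ht.symm htp.symm]
  -- Now `s` and `t` have one absolute value and `p`, `p₀` another; compare both indices with an `r`
  -- far from all of them.
  · obtain ⟨r, hrp, hrt⟩ := exists_far hm p t
    have hr : Far r p₀ := fun h => hrp (h.trans (not_not.1 hp).symm)
    have hrs : Far s r := fun h => hrt (h.symm.trans (not_not.1 hst))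
    exact (key hrp hr hsp hs hrs).trans (key htp ht hrp hr hrt)

theorem diff_sub_diff (hm : 3 ≤ m) (p₀ : Fin m ⊕ Fin m) {p q : Fin m ⊕ Fin m} (hpq : Far p q)
    (a : R) : diff c hm p₀ p a - diff c hm p₀ q a = c p q a 1 := by
  by_cases hp : Far p p₀
  · by_cases hq : Far q p₀
    · rw [hc.diff_far hm hp, hc.diff_far hm hq, hc.one_add hp hq.symm hpq, add_sub_cancel_right]
    · rw [hc.diff_far hm hp, hc.diff_eq hm hpq hp, hc.one_neg hm hpq]
      abel
  · have hq : Far q p₀ := fun h => hpq ((not_not.1 hp).trans h.symm)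
    rw [hc.diff_far hm hq, hc.diff_eq hm hpq.symm hq, add_sub_cancel_right]

theorem lam_sub_lam (hm : 3 ≤ m) (p₀ p : Fin m ⊕ Fin m) (a b : R) :
    lam 𝒜 c hm p a b - lam 𝒜 c hm p₀ a b = diff c hm p₀ p (superBracket 𝒜 a b) := by
  obtain ⟨t, htp, ht⟩ := exists_far hm p p₀
  rw [hc.diff_eq hm htp ht, ← hc.lam_sub_lam_far hm htp.symm, ← hc.lam_sub_lam_far hm ht,
    sub_add_sub_cancel]

omit hc in
variable (c) in
/-- The symmetrized version of `diff`, corresponding to the diagonal matrix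
`e_{pp}(a) ± e_{p*p*}(a)` minus a fixed one at `p₀`. -/
def symDiff [Invertible (2 : k)] (σ : SuperInvolution 𝒜) (hm : 3 ≤ m)
    (p₀ p : Fin m ⊕ Fin m) : R →ₗ[k] M :=
  (⅟2 : k) • (diff c hm p₀ p + diff c hm p₀ p.swap ∘ₗ σ.toFun)

omit hc in
variable (𝒜 c) in
/-- The symmetrized version of `lam`. -/
def symLam [Invertible (2 : k)] (hm : 3 ≤ m) (p : Fin m ⊕ Fin m) : R →ₗ[k] R →ₗ[k] M :=
  (⅟2 : k) • (lam 𝒜 c hm p + lam 𝒜 c hm p.swap)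

omit [GradedAlgebra 𝒜] hc in
theorem invOf_two_smul_add_self [Invertible (2 : k)] (x : M) : (⅟2 : k) • (x + x) = x := by
  rw [← two_smul k x, smul_smul, invOf_mul_self, one_smul]

/-- All Cartan-type elements are expressed in terms of `symLam` and `symDiff`. -/
theorem eq_symLam_add [Invertible (2 : k)] (hm : 3 ≤ m) (p₀ : Fin m ⊕ Fin m)
    {p q : Fin m ⊕ Fin m} (hpq : Far p q) (a b : R) :
    c p q a b = symLam 𝒜 c hm p₀ a b + symDiff c σ hm p₀ p (a * b) -
      symDiff c σ hm p₀ q (superFlip 𝒜 a b) := by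
  -- The identity is the average of two expansions of `c p q a b`. One moves `lam` from `p` to `p₀`;
  -- the other passes by `lam_star` to `p.swap`, moves to `p₀`, and returns to `p₀.swap`. Their
  -- `lam` terms average to `symLam` and their diagonal terms to `symDiff`.
  have h1 := hc.eq_lam_add hm hpq a b
  have h2 := hc.lam_sub_lam hm p₀ p a b
  have h3 := hc.lam_star hm p a b
  have h4 := hc.lam_sub_lam hm p₀ p.swap (σ.toFun a) (σ.toFun b)
  have h5 := hc.lam_star hm p₀.swap a b
  have h6 := hc.diff_sub_diff hm p₀ hpq (superFlip 𝒜 a b)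
  have h7 := hc.diff_sub_diff hm p₀ (p := p.swap) (q := q.swap) (by simpa using hpq)
    (σ.toFun (superFlip 𝒜 a b))
  rw [← hc.one_star hm hpq, σ.invol] at h7
  rw [← neg_neg (superBracket 𝒜 (σ.toFun a) (σ.toFun b)), ← σ.map_superBracket, h3, map_neg,
    ← mul_sub_superFlip, map_sub, map_sub] at h4
  rw [← mul_sub_superFlip, map_sub] at h2
  rw [Sum.swap_swap] at h5
  rw [h5] at h4
  simp only [symLam, symDiff, LinearMap.smul_apply, LinearMap.add_apply, LinearMap.comp_apply]
  rw [← smul_add, ← smul_sub, ← invOf_two_smul_add_self (k := k) (c p q a b)]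
  congr 1
  linear_combination (norm := module) h1 + h1 + h2 - h4 - h6 - h7

/-- `symLam` factors through the quotient defining dihedral homology. -/
theorem dihedralRel_le_ker_symLam [Invertible (2 : k)] (hm : 3 ≤ m) (p : Fin m ⊕ Fin m) :
    dihedralRel σ ≤ LinearMap.ker (TensorProduct.lift (symLam 𝒜 c hm p)) := by
  refine Submodule.span_le.2 ?_
  rintro _ ((⟨i, j, a, b, ha, hb, rfl⟩ | ⟨i, j, a, b, ha, hb, rfl⟩) |
    ⟨i, j, l, x, y, z, hx, hy, hz, rfl⟩)
  · simp only [SetLike.mem_coe, LinearMap.mem_ker, map_add, map_zsmul, TensorProduct.lift.tmul,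
      symLam, LinearMap.smul_apply, LinearMap.add_apply]
    rw [hc.lam_skew hm p ha hb, hc.lam_skew hm p.swap ha hb]
    module
  · simp only [SetLike.mem_coe, LinearMap.mem_ker, map_add, TensorProduct.lift.tmul,
      symLam, LinearMap.smul_apply, LinearMap.add_apply]
    -- `lam_star` exchanges the two summands up to sign, so the involution relation holds for their
    -- sum.
    have h1 := hc.lam_star hm p a b
    have h2 := hc.lam_star hm p.swap a b
    rw [Sum.swap_swap] at h2
    rw [h1, h2]
    module
  -- This relation already holds for each `lam`: it is `lam_cyclic` with the left side turned around
  -- by `lam_skew`.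
  · have key : ∀ p, koszul i l • lam 𝒜 c hm p (x * y) z + koszul j i • lam 𝒜 c hm p (y * z) x +
        koszul l j • lam 𝒜 c hm p (z * x) y = 0 := by
      intro p
      have h1 := hc.lam_cyclic hm p hx hy hz
      rw [hc.lam_skew hm p hx (SetLike.mul_mem_graded hy hz)] at h1
      simp only [koszul_add_left, koszul_add_right, koszul_comm j i, koszul_comm l j] at h1 ⊢
      rcases koszul_eq_one_or i j with e1 | e1 <;> rcases koszul_eq_one_or j l with e2 | e2 <;>
        rcases koszul_eq_one_or i l with e3 | e3 <;>
        simp only [e1, e2, e3, one_smul, neg_smul, mul_one, mul_neg, neg_neg] at h1 ⊢ <;>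
        first
          | linear_combination (norm := module) h1
          | linear_combination (norm := module) -h1
    have h1 := key p
    have h2 := key p.swap
    simp only [SetLike.mem_coe, LinearMap.mem_ker, map_add, map_zsmul, TensorProduct.lift.tmul,
      symLam, LinearMap.smul_apply, LinearMap.add_apply]
    rw [← smul_zero (⅟2 : k), ← add_zero (0 : M)]
    nth_rewrite 1 [← h1]
    rw [← h2]
    module

end CartanSystem

end CartanSystem

/-! ### The quotient module defining dihedral homology -/

section Dihedral

variable {k R : Type*} [CommRing k] [Ring R] [Algebra k R]
  {𝒜 : ZMod 2 → Submodule k R} (σ : SuperInvolution 𝒜)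

/-- The quotient of `R ⊗ R` whose submodule is the first dihedral homology. -/
abbrev DihedralQuotient : Type _ := (R ⊗[k] R) ⧸ dihedralRel σ

/-- The class `⟨a, b⟩` of `a ⊗ b`. -/
def dihedralClass : R →ₗ[k] R →ₗ[k] DihedralQuotient σ :=
  (TensorProduct.mk k R R).compr₂ (dihedralRel σ).mkQ

theorem dihedralClass_skew {i j : ZMod 2} {a b : R} (ha : a ∈ 𝒜 i) (hb : b ∈ 𝒜 j) :
    dihedralClass σ a b = -(koszul i j • dihedralClass σ b a) :=
  eq_neg_of_add_eq_zero_left ((Submodule.Quotient.mk_eq_zero _).2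
    (Submodule.subset_span (Or.inl (Or.inl ⟨i, j, a, b, ha, hb, rfl⟩))))

theorem dihedralClass_star {i j : ZMod 2} {a b : R} (ha : a ∈ 𝒜 i) (hb : b ∈ 𝒜 j) :
    dihedralClass σ (σ.toFun a) (σ.toFun b) = -dihedralClass σ a b :=
  eq_neg_of_add_eq_zero_right ((Submodule.Quotient.mk_eq_zero _).2
    (Submodule.subset_span (Or.inl (Or.inr ⟨i, j, a, b, ha, hb, rfl⟩))))

theorem dihedralClass_cyclic {i j l : ZMod 2} {a b c : R} (ha : a ∈ 𝒜 i) (hb : b ∈ 𝒜 j)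
    (hc : c ∈ 𝒜 l) : koszul i l • dihedralClass σ (a * b) c +
      koszul j i • dihedralClass σ (b * c) a + koszul l j • dihedralClass σ (c * a) b = 0 :=
  (Submodule.Quotient.mk_eq_zero _).2
    (Submodule.subset_span (Or.inr ⟨i, j, l, a, b, c, ha, hb, hc, rfl⟩))

theorem dihedralQuotient_ext {M : Type*} [AddCommGroup M] [Module k M]
    {f g : DihedralQuotient σ →ₗ[k] M}
    (h : ∀ a b, f (dihedralClass σ a b) = g (dihedralClass σ a b)) : f = g :=
  Submodule.linearMap_qext _ (TensorProduct.ext' h)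

theorem zsmul_tmul_zsmul (s t : ℤ) (a b : R) :
    (s • a) ⊗ₜ[k] (t • b) = (s * t) • (a ⊗ₜ[k] b) := by
  change TensorProduct.mk k R R (s • a) (t • b) = _
  rw [map_zsmul, map_zsmul, LinearMap.smul_apply, smul_smul, mul_comm]
  rfl

variable [GradedAlgebra 𝒜]

/-- The parity automorphism of the dihedral quotient. -/
def dihedralParity : DihedralQuotient σ →ₗ[k] DihedralQuotient σ :=
  (dihedralRel σ).mapQ (dihedralRel σ) (TensorProduct.map (rho 𝒜) (rho 𝒜)) (by
    refine Submodule.span_le.2 ?_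
    rintro _ ((⟨i, j, a, b, ha, hb, rfl⟩ | ⟨i, j, a, b, ha, hb, rfl⟩) |
      ⟨i, j, l, x, y, z, hx, hy, hz, rfl⟩)
    · have h : a ⊗ₜ[k] b + koszul i j • (b ⊗ₜ[k] a) ∈ dihedralRel σ :=
        Submodule.subset_span (Or.inl (Or.inl ⟨i, j, a, b, ha, hb, rfl⟩))
      rw [SetLike.mem_coe, Submodule.mem_comap]
      convert zsmul_mem h (psign (i + j)) using 1
      simp only [map_add, map_zsmul, TensorProduct.map_tmul]
      rw [rho_of_mem 𝒜 ha, rho_of_mem 𝒜 hb, zsmul_tmul_zsmul,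
        zsmul_tmul_zsmul, psign_add, mul_comm (psign j)]
      module
    · have h : a ⊗ₜ[k] b + σ.toFun a ⊗ₜ[k] σ.toFun b ∈ dihedralRel σ :=
        Submodule.subset_span (Or.inl (Or.inr ⟨i, j, a, b, ha, hb, rfl⟩))
      rw [SetLike.mem_coe, Submodule.mem_comap]
      convert zsmul_mem h (psign (i + j)) using 1
      simp only [map_add, TensorProduct.map_tmul]
      rw [rho_of_mem 𝒜 ha, rho_of_mem 𝒜 hb, rho_of_mem 𝒜 (σ.map_mem ha),
        rho_of_mem 𝒜 (σ.map_mem hb), zsmul_tmul_zsmul,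
        zsmul_tmul_zsmul, psign_add]
      module
    · have h : koszul i l • ((x * y) ⊗ₜ[k] z) + koszul j i • ((y * z) ⊗ₜ[k] x) +
          koszul l j • ((z * x) ⊗ₜ[k] y) ∈ dihedralRel σ :=
        Submodule.subset_span (Or.inr ⟨i, j, l, x, y, z, hx, hy, hz, rfl⟩)
      rw [SetLike.mem_coe, Submodule.mem_comap]
      convert zsmul_mem h (psign (i + j + l)) using 1
      simp only [map_add, map_zsmul, TensorProduct.map_tmul]
      rw [rho_of_mem 𝒜 (SetLike.mul_mem_graded hx hy), rho_of_mem 𝒜 (SetLike.mul_mem_graded hy hz),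
        rho_of_mem 𝒜 (SetLike.mul_mem_graded hz hx), rho_of_mem 𝒜 hx, rho_of_mem 𝒜 hy,
        rho_of_mem 𝒜 hz, zsmul_tmul_zsmul, zsmul_tmul_zsmul,
        zsmul_tmul_zsmul]
      simp only [psign_add]
      module)

theorem dihedralParity_class (a b : R) : dihedralParity σ (dihedralClass σ a b) =
    dihedralClass σ (rho 𝒜 a) (rho 𝒜 b) := rfl

theorem dihedralParity_dihedralParity (x : DihedralQuotient σ) :
    dihedralParity σ (dihedralParity σ x) = x := by
  have : dihedralParity σ ∘ₗ dihedralParity σ = LinearMap.id :=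
    dihedralQuotient_ext σ fun a b => by
      simp only [LinearMap.comp_apply, dihedralParity_class, rho_rho, LinearMap.id_apply]
  exact LinearMap.congr_fun this x

/-- The grading of the dihedral quotient. -/
def dihedralGrade (i : ZMod 2) : Submodule k (DihedralQuotient σ) :=
  LinearMap.ker (dihedralParity σ - psign i • LinearMap.id)

theorem mem_dihedralGrade {i : ZMod 2} {x : DihedralQuotient σ} :
    x ∈ dihedralGrade σ i ↔ dihedralParity σ x = psign i • x := by
  simp [dihedralGrade, sub_eq_zero]

theorem dihedralClass_mem {i j : ZMod 2} {a b : R} (ha : a ∈ 𝒜 i) (hb : b ∈ 𝒜 j) :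
    dihedralClass σ a b ∈ dihedralGrade σ (i + j) := by
  rw [mem_dihedralGrade, dihedralParity_class, rho_of_mem 𝒜 ha, rho_of_mem 𝒜 hb]
  simp only [map_zsmul, LinearMap.smul_apply, smul_smul, psign_add]
  rw [mul_comm]

/-- These are the eigenspaces of an involution for `1` and `-1`, and `2` is invertible. -/
theorem dihedralGrade_isCompl [Invertible (2 : k)] :
    IsCompl (dihedralGrade σ 0) (dihedralGrade σ 1) := by
  constructor
  · rw [Submodule.disjoint_def]
    intro x h0 h1
    rw [mem_dihedralGrade] at h0 h1
    refine eq_zero_of_add_self (k := k) ?_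
    rw [h0, show psign 0 = 1 from rfl, show psign 1 = -1 from rfl, one_smul, neg_one_zsmul] at h1
    nth_rewrite 1 [h1]
    exact neg_add_cancel x
  · rw [codisjoint_iff_le_sup]
    intro x _
    refine Submodule.mem_sup.2 ⟨(⅟2 : k) • (x + dihedralParity σ x), ?_,
      (⅟2 : k) • (x - dihedralParity σ x), ?_, ?_⟩
    · rw [mem_dihedralGrade, map_smul, map_add, dihedralParity_dihedralParity, psign_zero, one_smul,
        add_comm]
    · rw [mem_dihedralGrade, map_smul, map_sub, dihedralParity_dihedralParity,
        show psign 1 = -1 from rfl, neg_one_zsmul, ← smul_neg, neg_sub]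
    · rw [← smul_add, add_add_sub_cancel, ← two_smul k x, smul_smul, invOf_mul_self, one_smul]

/-- The map `⟨a, b⟩ ↦ [a, b] + σ [a, b]`, whose kernel is the dihedral homology. -/
def dihedralBracket : DihedralQuotient σ →ₗ[k] R :=
  (dihedralRel σ).liftQ
    ((σ.toFun + LinearMap.id) ∘ₗ TensorProduct.lift (superBracket 𝒜)) (by
    refine Submodule.span_le.2 ?_
    rintro _ ((⟨i, j, a, b, ha, hb, rfl⟩ | ⟨i, j, a, b, ha, hb, rfl⟩) |
      ⟨i, j, l, x, y, z, hx, hy, hz, rfl⟩)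
    · simp only [SetLike.mem_coe, LinearMap.mem_ker, LinearMap.comp_apply, map_add, map_zsmul,
        TensorProduct.lift.tmul]
      rw [superBracket_of_mem 𝒜 ha hb, superBracket_of_mem 𝒜 hb ha, koszul_comm j i,
        ← map_zsmul, ← map_add, smul_sub, smul_smul, koszul_sq, one_smul, sub_add_sub_cancel,
        sub_self, map_zero]
    · simp only [SetLike.mem_coe, LinearMap.mem_ker, LinearMap.comp_apply, map_add,
        TensorProduct.lift.tmul]
      -- The supercommutator alone does not kill this relation: it gives `[a, b] - σ [a, b]`, which
      -- only `σ + id` annihilates.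
      rw [← neg_neg (superBracket 𝒜 (σ.toFun a) (σ.toFun b)), ← σ.map_superBracket]
      simp only [LinearMap.add_apply, LinearMap.id_apply, map_neg, σ.invol]
      abel
    · simp only [SetLike.mem_coe, LinearMap.mem_ker, LinearMap.comp_apply, map_add, map_zsmul,
        TensorProduct.lift.tmul]
      rw [superBracket_of_mem 𝒜 (SetLike.mul_mem_graded hx hy) hz,
        superBracket_of_mem 𝒜 (SetLike.mul_mem_graded hy hz) hx,
        superBracket_of_mem 𝒜 (SetLike.mul_mem_graded hz hx) hy, ← map_zsmul, ← map_zsmul,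
        ← map_zsmul, ← map_add, ← map_add]
      refine (congrArg _ ?_).trans (map_zero (σ.toFun + LinearMap.id))
      simp only [koszul_add_left, koszul_comm j i, koszul_comm l j, koszul_comm l i, mul_assoc]
      rcases koszul_eq_one_or i j with e1 | e1 <;> rcases koszul_eq_one_or j l with e2 | e2 <;>
        rcases koszul_eq_one_or i l with e3 | e3 <;> simp only [e1, e2, e3] <;> module)

theorem dihedralBracket_class (a b : R) : dihedralBracket σ (dihedralClass σ a b) =
    σ.toFun (superBracket 𝒜 a b) + superBracket 𝒜 a b := rfl

/-- The defining map kills `I`, so the image of its kernel in the quotient is the kernel of the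
induced map. -/
theorem dihedralHomology_eq_ker : dihedralHomology σ = LinearMap.ker (dihedralBracket σ) := by
  ext x
  constructor
  · rintro ⟨z, hz, rfl⟩
    exact hz
  · intro hx
    obtain ⟨z, rfl⟩ := Submodule.mkQ_surjective _ x
    exact ⟨z, hx, rfl⟩

end Dihedral

/-! ### Central extensions -/

/-- The central extension of a Lie superalgebra by an even 2-cocycle. -/
def LieSuperalgebra.extend {k L Q : Type*} [CommRing k] [AddCommGroup L] [Module k L]
    [AddCommGroup Q] [Module k Q] (S : LieSuperalgebra k L) (G : ZMod 2 → Submodule k Q)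
    (hG : IsCompl (G 0) (G 1)) (ω : L →ₗ[k] L →ₗ[k] Q)
    (mem : ∀ {i j x y}, x ∈ S.grade i → y ∈ S.grade j → ω x y ∈ G (i + j))
    (skew : ∀ {i j x y}, x ∈ S.grade i → y ∈ S.grade j → ω x y = -(koszul i j • ω y x))
    (cocycle : ∀ {i j l x y z}, x ∈ S.grade i → y ∈ S.grade j → z ∈ S.grade l →
      ω x (S.bracket y z) = ω (S.bracket x y) z + koszul i j • ω y (S.bracket x z)) :
    LieSuperalgebra k (L × Q) where
  grade i := (S.grade i).prod (G i)
  isCompl := by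
    constructor
    · rw [Submodule.disjoint_def]
      rintro ⟨x, q⟩ ⟨hx, hq⟩ ⟨hx', hq'⟩
      exact Prod.ext (Submodule.disjoint_def.1 S.isCompl.disjoint x hx hx')
        (Submodule.disjoint_def.1 hG.disjoint q hq hq')
    · rw [codisjoint_iff_le_sup]
      rintro ⟨x, q⟩ -
      obtain ⟨x0, hx0, x1, hx1, rfl⟩ := S.exists_add x
      obtain ⟨q0, hq0, q1, hq1, rfl⟩ := Submodule.mem_sup.1
        (hG.sup_eq_top.ge (Submodule.mem_top (x := q)))
      exact Submodule.mem_sup.2 ⟨(x0, q0), ⟨hx0, hq0⟩, (x1, q1), ⟨hx1, hq1⟩, rfl⟩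
  bracket := LinearMap.mk₂ k (fun x y => (S.bracket x.1 y.1, ω x.1 y.1))
    (fun _ _ _ => by simp) (fun _ _ _ => by simp) (fun _ _ _ => by simp) (fun _ _ _ => by simp)
  bracket_mem hx hy := ⟨S.bracket_mem hx.1 hy.1, mem hx.1 hy.1⟩
  skew hx hy := Prod.ext (S.skew hx.1 hy.1) (skew hx.1 hy.1)
  jacobi hx hy hz := Prod.ext (S.jacobi hx.1 hy.1 hz.1) (cocycle hx.1 hy.1 hz.1)

/-! ### The cocycle on matrices -/

section Cocycle

variable {k R : Type*} [CommRing k] [Ring R] [Algebra k R]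

/-- The map `a ↦ (-1) ^ (|p| (1 + |a|)) a`. -/
def entrySign {m : ℕ} (𝒜 : ZMod 2 → Submodule k R) [GradedAlgebra 𝒜] (p : Fin m ⊕ Fin m) :
    R →ₗ[k] R :=
  psign (idx p) • if idx p = 0 then LinearMap.id else rho 𝒜

variable {𝒜 : ZMod 2 → Submodule k R} [GradedAlgebra 𝒜] {m : ℕ}

theorem entrySign_of_mem (p : Fin m ⊕ Fin m) {α : ZMod 2} {a : R} (ha : a ∈ 𝒜 α) :
    entrySign 𝒜 p a = psign (idx p * (1 + α)) • a := by
  rw [entrySign, LinearMap.smul_apply]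
  split_ifs with h
  · rw [h, zero_mul]
    rfl
  · have h1 : idx p = 1 := by
      generalize idx p = x at *
      clear ha
      revert x; decide
    rw [rho_of_mem 𝒜 ha, smul_smul, h1, one_mul, psign_mul_psign]

theorem entrySign_mem (p : Fin m ⊕ Fin m) {α : ZMod 2} {a : R} (ha : a ∈ 𝒜 α) :
    entrySign 𝒜 p a ∈ 𝒜 α := by
  rw [entrySign_of_mem p ha]
  exact zsmul_mem ha _

theorem entrySign_entrySign (p : Fin m ⊕ Fin m) (a : R) :
    entrySign 𝒜 p (entrySign 𝒜 p a) = a :=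
  homogeneous_induction 𝒜 (P := fun a => entrySign 𝒜 p (entrySign 𝒜 p a) = a)
    (fun i a ha => by rw [entrySign_of_mem p ha, map_zsmul, entrySign_of_mem p ha, smul_smul,
      psign_sq, one_smul])
    (fun a b ha hb => by rw [map_add, map_add, ha, hb]) a

variable [Invertible (2 : k)] (σ : SuperInvolution 𝒜)

variable (m) in
/-- The cocycle `ω(X, Y) = 1/2 ∑ ± ⟨X_{pq}, Y_{qp}⟩`. -/
def cocycle : Mat m R →ₗ[k] Mat m R →ₗ[k] DihedralQuotient σ :=
  (⅟2 : k) • ∑ p, ∑ q, psign (idx p) • (dihedralClass σ).compl₁₂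
    ((if idx p = 0 then LinearMap.id else rho 𝒜) ∘ₗ Matrix.entryLinearMap k R p q)
    ((if idx p = 0 then LinearMap.id else rho 𝒜) ∘ₗ Matrix.entryLinearMap k R q p)

theorem cocycle_of_mem {d e : ZMod 2} {X Y : Mat m R} (hX : X ∈ matGrade 𝒜 m d)
    (hY : Y ∈ matGrade 𝒜 m e) : cocycle m σ X Y = (⅟2 : k) •
      ∑ p, ∑ q, psign (idx p * (1 + d + e)) • dihedralClass σ (X p q) (Y q p) := by
  simp only [cocycle, LinearMap.smul_apply, LinearMap.sum_apply]
  congr 1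
  refine Finset.sum_congr rfl fun p _ => Finset.sum_congr rfl fun q _ => ?_
  simp only [LinearMap.compl₁₂_apply, LinearMap.comp_apply, Matrix.entryLinearMap_apply]
  split_ifs with h
  · rw [h, zero_mul]
    rfl
  · rw [rho_of_mem 𝒜 (hX p q), rho_of_mem 𝒜 (hY q p)]
    simp only [map_zsmul, LinearMap.smul_apply, smul_smul]
    congr 1
    clear hX hY
    generalize idx p = x, idx q = y at *
    revert x y d e; decide

theorem cocycle_mem {d e : ZMod 2} {X Y : Mat m R} (hX : X ∈ matGrade 𝒜 m d)
    (hY : Y ∈ matGrade 𝒜 m e) : cocycle m σ X Y ∈ dihedralGrade σ (d + e) := by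
  rw [cocycle_of_mem σ hX hY]
  refine Submodule.smul_mem _ _ (sum_mem fun p _ => sum_mem fun q _ => zsmul_mem ?_ _)
  convert dihedralClass_mem σ (hX p q) (hY q p) using 2
  clear hX hY
  generalize idx p = x, idx q = y at *
  revert x y d e; decide

theorem cocycle_skew {d e : ZMod 2} {X Y : Mat m R} (hX : X ∈ matGrade 𝒜 m d)
    (hY : Y ∈ matGrade 𝒜 m e) : cocycle m σ X Y = -(koszul d e • cocycle m σ Y X) := by
  rw [cocycle_of_mem σ hX hY, cocycle_of_mem σ hY hX, smul_comm (koszul d e), ← smul_neg,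
    Finset.sum_comm]
  congr 1
  rw [Finset.smul_sum, ← Finset.sum_neg_distrib]
  refine Finset.sum_congr rfl fun q _ => ?_
  rw [Finset.smul_sum, ← Finset.sum_neg_distrib]
  refine Finset.sum_congr rfl fun p _ => ?_
  rw [dihedralClass_skew σ (hX p q) (hY q p), smul_neg, smul_smul, smul_smul]
  congr 2
  clear hX hY
  generalize idx p = x, idx q = y at *
  revert x y d e; decide

theorem cocycle_mul {d e f : ZMod 2} {X Y Z : Mat m R} (hX : X ∈ matGrade 𝒜 m d)
    (hY : Y ∈ matGrade 𝒜 m e) (hZ : Z ∈ matGrade 𝒜 m f) : cocycle m σ (X * Y) Z = (⅟2 : k) •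
      ∑ p, ∑ q, ∑ r, psign (idx p * (1 + d + e + f)) •
        dihedralClass σ (X p q * Y q r) (Z r p) := by
  rw [cocycle_of_mem σ (SetLike.mul_mem_graded hX hY) hZ]
  congr 1
  refine Finset.sum_congr rfl fun p _ => ?_
  rw [Finset.sum_comm]
  refine Finset.sum_congr rfl fun r _ => ?_
  rw [Matrix.mul_apply, map_sum, LinearMap.sum_apply, Finset.smul_sum]
  simp only [add_assoc]

/-- With the summation indices rotated to a common order, the three terms for each `p, q, r` are a
multiple of the cyclic relation for `X p q`, `Y q r`, `Z r p`. -/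
theorem cocycle_cyclic {d e f : ZMod 2} {X Y Z : Mat m R} (hX : X ∈ matGrade 𝒜 m d)
    (hY : Y ∈ matGrade 𝒜 m e) (hZ : Z ∈ matGrade 𝒜 m f) :
    koszul d f • cocycle m σ (X * Y) Z + koszul e d • cocycle m σ (Y * Z) X +
      koszul f e • cocycle m σ (Z * X) Y = 0 := by
  rw [cocycle_mul σ hX hY hZ, cocycle_mul σ hY hZ hX, cocycle_mul σ hZ hX hY,
    smul_comm (koszul d f), smul_comm (koszul e d), smul_comm (koszul f e), ← smul_add, ← smul_add]
  convert smul_zero (⅟2 : k)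
  rw [Finset.sum_comm_cycle (s := Finset.univ (α := Fin m ⊕ Fin m)) (t := Finset.univ)
      (u := Finset.univ) (f := fun q r p => psign (idx q * (1 + e + f + d)) •
        dihedralClass σ (Y q r * Z r p) (X p q)),
    ← Finset.sum_comm_cycle (s := Finset.univ (α := Fin m ⊕ Fin m)) (t := Finset.univ)
      (u := Finset.univ) (f := fun p q r => psign (idx r * (1 + f + d + e)) •
        dihedralClass σ (Z r p * X p q) (Y q r))]
  simp only [Finset.smul_sum, ← Finset.sum_add_distrib]
  refine Finset.sum_eq_zero fun p _ => Finset.sum_eq_zero fun q _ =>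
    Finset.sum_eq_zero fun r _ => ?_
  have h := dihedralClass_cyclic σ (hX p q) (hY q r) (hZ r p)
  -- The multiplier is the sign of the first summand times the Koszul sign of the first term of `h`.
  have h' := congrArg (fun x => psign (idx p * (1 + d + e + f) + d * f +
    (idx p + idx q + d) * (idx r + idx p + f)) • x) h
  simp only [smul_add, smul_zero, smul_smul] at h' ⊢
  rw [← h']
  congr 2
  · congr 1
    clear h h' hX hY hZ
    generalize idx p = x, idx q = y, idx r = z at *
    revert x y z d e f; decide
  · congr 1
    clear h h' hX hY hZ
    generalize idx p = x, idx q = y, idx r = z at *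
    revert x y z d e f; decide
  · clear h h' hX hY hZ
    generalize idx p = x, idx q = y, idx r = z at *
    revert x y z d e f; decide

/-- A combination of the cyclic identities for `X, Y, Z` and `Y, X, Z`. The involution is not
involved: `ω` is a cocycle on all matrices. -/
theorem cocycle_jacobi {d e f : ZMod 2} {X Y Z : Mat m R} (hX : X ∈ matGrade 𝒜 m d)
    (hY : Y ∈ matGrade 𝒜 m e) (hZ : Z ∈ matGrade 𝒜 m f) :
    cocycle m σ X (superBracket (matGrade 𝒜 m) Y Z) =
      cocycle m σ (superBracket (matGrade 𝒜 m) X Y) Z +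
        koszul d e • cocycle m σ Y (superBracket (matGrade 𝒜 m) X Z) := by
  have h1 := cocycle_cyclic σ hX hY hZ
  have h2 := cocycle_cyclic σ hY hX hZ
  rw [superBracket_of_mem _ hY hZ, superBracket_of_mem _ hX hY, superBracket_of_mem _ hX hZ]
  simp only [map_sub, map_zsmul, LinearMap.sub_apply, LinearMap.smul_apply]
  rw [cocycle_skew σ hX (SetLike.mul_mem_graded hY hZ),
    cocycle_skew σ hX (SetLike.mul_mem_graded hZ hY),
    cocycle_skew σ hY (SetLike.mul_mem_graded hX hZ),
    cocycle_skew σ hY (SetLike.mul_mem_graded hZ hX)]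
  simp only [koszul_add_right, koszul_comm e d, koszul_comm f e, koszul_comm f d] at h1 h2 ⊢
  rcases koszul_eq_one_or d e with e1 | e1 <;> rcases koszul_eq_one_or e f with e2 | e2 <;>
    rcases koszul_eq_one_or d f with e3 | e3 <;>
    simp only [e1, e2, e3, one_smul, neg_smul, mul_one, mul_neg, neg_neg] at h1 h2 ⊢ <;>
    first
      | linear_combination (norm := module) h1 + h2
      | linear_combination (norm := module) h1 - h2
      | linear_combination (norm := module) -h1 + h2
      | linear_combination (norm := module) -h1 - h2

variable (m) in
/-- The central extension of the Lie superalgebra of matrices. -/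
def matExt : LieSuperalgebra k (Mat m R × DihedralQuotient σ) :=
  (superLie (matGrade 𝒜 m)).extend (dihedralGrade σ) (dihedralGrade_isCompl σ) (cocycle m σ)
    (cocycle_mem σ) (cocycle_skew σ) (cocycle_jacobi σ)

theorem matExt_bracket (x y : Mat m R × DihedralQuotient σ) : (matExt m σ).bracket x y =
    (superBracket (matGrade 𝒜 m) x.1 y.1, cocycle m σ x.1 y.1) := rfl

end Cocycle

/-! ### Root matrices -/

section RootMatrices

variable {k R : Type*} [CommRing k] [Ring R] [Algebra k R]
  {𝒜 : ZMod 2 → Submodule k R} [GradedAlgebra 𝒜] {m : ℕ}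

omit [GradedAlgebra 𝒜] in
theorem single_mem (p q : Fin m ⊕ Fin m) {α : ZMod 2} {a : R} (ha : a ∈ 𝒜 α) :
    Matrix.single p q a ∈ matGrade 𝒜 m (idx p + idx q + α) := by
  intro x y
  by_cases h : p = x ∧ q = y
  · obtain ⟨rfl, rfl⟩ := h
    rw [Matrix.single_apply_same]
    convert ha using 2
    generalize idx p = x, idx q = y
    clear ha
    revert x y α; decide
  · rw [Matrix.single_apply_of_ne _ _ _ _ _ h]
    exact zero_mem _

theorem superBracket_single {p q r s : Fin m ⊕ Fin m} {α β : ZMod 2} {a b : R} (ha : a ∈ 𝒜 α)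
    (hb : b ∈ 𝒜 β) :
    superBracket (matGrade 𝒜 m) (Matrix.single p q a) (Matrix.single r s b) =
      (if q = r then Matrix.single p s (a * b) else 0) -
      koszul (idx p + idx q + α) (idx r + idx s + β) •
        (if s = p then Matrix.single r q (b * a) else 0) := by
  rw [superBracket_of_mem _ (single_mem p q ha) (single_mem r s hb)]
  congr 2
  · split_ifs with h
    · rw [h, Matrix.single_mul_single_same]
    · rw [Matrix.single_mul_single_of_ne _ _ _ _ h]
  · split_ifs with h
    · rw [h, Matrix.single_mul_single_same]
    · rw [Matrix.single_mul_single_of_ne _ _ _ _ h]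

/-- The matrix `e_{pq}(a) - prp (e_{pq}(a))`. -/
def rootMat (bar : SuperInvolution 𝒜) (p q : Fin m ⊕ Fin m) : R →ₗ[k] Mat m R :=
  Matrix.singleLinearMap k p q + Matrix.singleLinearMap k q.swap p.swap ∘ₗ tau bar p q

variable (bar : SuperInvolution 𝒜)

theorem rootMat_apply (p q : Fin m ⊕ Fin m) (a : R) : rootMat bar p q a =
    Matrix.single p q a + Matrix.single q.swap p.swap (tau bar p q a) := rfl

theorem rootMat_mem (p q : Fin m ⊕ Fin m) {α : ZMod 2} {a : R} (ha : a ∈ 𝒜 α) :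
    rootMat bar p q a ∈ matGrade 𝒜 m (idx p + idx q + α) := by
  rw [rootMat_apply]
  refine add_mem (single_mem p q ha) ?_
  convert single_mem q.swap p.swap (tau_mem bar p q ha) using 2
  rw [idx_swap, idx_swap]
  generalize idx p = x, idx q = y
  clear ha
  revert x y α; decide

theorem rootMat_star (p q : Fin m ⊕ Fin m) (a : R) :
    rootMat bar p q a = rootMat bar q.swap p.swap (tau bar p q a) := by
  rw [rootMat_apply, rootMat_apply, tau_tau, Sum.swap_swap, Sum.swap_swap, add_comm]

/-- Expanding gives four brackets of matrix units. Each of the four index coincidences occurs in two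
of them, and `tau_mul` recognizes the two resulting units as one root matrix. -/
theorem rootMat_bracket (p q r s : Fin m ⊕ Fin m) {α β : ZMod 2} {a b : R} (ha : a ∈ 𝒜 α)
    (hb : b ∈ 𝒜 β) :
    superBracket (matGrade 𝒜 m) (rootMat bar p q a) (rootMat bar r s b) =
      (if q = r then rootMat bar p s (a * b) else 0) +
      (if q = s.swap then rootMat bar p r.swap (a * tau bar r s b) else 0) -
      koszul (idx p + idx q + α) (idx r + idx s + β) •
        ((if s = p then rootMat bar r q (b * a) else 0) +
          (if r.swap = p then rootMat bar s.swap q (tau bar r s b * a) else 0)) := by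
  have ha' := tau_mem bar p q ha
  have hb' := tau_mem bar r s hb
  have e1 : p.swap = r ↔ r.swap = p := ⟨fun h => by rw [← h, Sum.swap_swap],
    fun h => by rw [← h, Sum.swap_swap]⟩
  have e2 : s = q.swap ↔ q = s.swap := ⟨fun h => by rw [h, Sum.swap_swap],
    fun h => by rw [h, Sum.swap_swap]⟩
  have e3 : p.swap = s.swap ↔ s = p := ⟨fun h => (Sum.swap_leftInverse.injective h).symm,
    fun h => by rw [h]⟩
  have e4 : r.swap = q.swap ↔ q = r := ⟨fun h => (Sum.swap_leftInverse.injective h).symm,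
    fun h => by rw [h]⟩
  have k1 : koszul (idx p + idx q + α) (idx s.swap + idx r.swap + β) =
      koszul (idx p + idx q + α) (idx r + idx s + β) := by
    rw [idx_swap, idx_swap]
    generalize idx p = x, idx q = y, idx r = z, idx s = w
    clear ha hb ha' hb'
    revert x y z w α β; decide
  have k2 : koszul (idx q.swap + idx p.swap + α) (idx r + idx s + β) =
      koszul (idx p + idx q + α) (idx r + idx s + β) := by
    rw [idx_swap, idx_swap]
    generalize idx p = x, idx q = y, idx r = z, idx s = w
    clear ha hb ha' hb' k1
    revert x y z w α β; decide
  have k3 : koszul (idx q.swap + idx p.swap + α) (idx s.swap + idx r.swap + β) =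
      koszul (idx p + idx q + α) (idx r + idx s + β) := by
    rw [idx_swap, idx_swap, idx_swap, idx_swap]
    generalize idx p = x, idx q = y, idx r = z, idx s = w
    clear ha hb ha' hb' k1 k2
    revert x y z w α β; decide
  -- One identity per coincidence: `A` and `B` collect the root matrices from products with the
  -- first factor on the left, `C` and `D` those with it on the right.
  have A : (if q = r then Matrix.single p s (a * b) else 0) -
      koszul (idx p + idx q + α) (idx r + idx s + β) •
        (if q = r then Matrix.single s.swap p.swap (tau bar r s b * tau bar p q a) else 0) =
      if q = r then rootMat bar p s (a * b) else 0 := by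
    split_ifs with h
    · subst h
      rw [rootMat_apply, tau_mul bar p q s ha hb, sub_eq_add_neg, ← neg_smul, Matrix.smul_single]
    · simp
  have B : (if q = s.swap then Matrix.single p r.swap (a * tau bar r s b) else 0) -
      koszul (idx p + idx q + α) (idx r + idx s + β) •
        (if q = s.swap then Matrix.single r p.swap (b * tau bar p q a) else 0) =
      if q = s.swap then rootMat bar p r.swap (a * tau bar r s b) else 0 := by
    split_ifs with h
    · subst h
      rw [rootMat_apply, tau_mul bar p s.swap r.swap ha hb', tau_tau, sub_eq_add_neg, ← neg_smul,
        Matrix.smul_single, Sum.swap_swap, k1]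
    · simp
  have C : (if s = p then Matrix.single q.swap r.swap (tau bar p q a * tau bar r s b) else 0) -
      koszul (idx p + idx q + α) (idx r + idx s + β) •
        (if s = p then Matrix.single r q (b * a) else 0) =
      -(koszul (idx p + idx q + α) (idx r + idx s + β) •
        (if s = p then rootMat bar r q (b * a) else 0)) := by
    split_ifs with h
    · subst h
      rw [rootMat_apply, tau_mul bar r s q hb ha, koszul_comm, ← Matrix.smul_single]
      have := koszul_sq (idx r + idx s + β) (idx s + idx q + α)
      generalize koszul (idx r + idx s + β) (idx s + idx q + α) = t at *
      rw [smul_add, smul_smul, mul_neg, this]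
      module
    · simp
  have D : (if r.swap = p then Matrix.single q.swap s (tau bar p q a * b) else 0) -
      koszul (idx p + idx q + α) (idx r + idx s + β) •
        (if r.swap = p then Matrix.single s.swap q (tau bar r s b * a) else 0) =
      -(koszul (idx p + idx q + α) (idx r + idx s + β) •
        (if r.swap = p then rootMat bar s.swap q (tau bar r s b * a) else 0)) := by
    split_ifs with h
    · subst h
      rw [rootMat_apply, tau_mul bar s.swap r.swap q hb' ha, tau_tau, ← k1,
        koszul_comm, ← Matrix.smul_single, Sum.swap_swap]
      have := koszul_sq (idx s.swap + idx r.swap + β) (idx r.swap + idx q + α)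
      generalize koszul (idx s.swap + idx r.swap + β) (idx r.swap + idx q + α) = t at *
      rw [smul_add, smul_smul, mul_neg, this]
      module
    · simp
  rw [rootMat_apply, rootMat_apply bar r s]
  simp only [map_add, LinearMap.add_apply]
  rw [superBracket_single ha hb, superBracket_single ha hb', superBracket_single ha' hb,
    superBracket_single ha' hb', k1, k2, k3]
  simp only [e1, e2, e3, e4]
  linear_combination (norm := module) A + B + C + D

theorem rootMat_swap_self (p : Fin m ⊕ Fin m) (a : R) :
    rootMat bar p.swap p.swap (entrySign 𝒜 p.swap a) =
      rootMat bar p p (entrySign 𝒜 p (bar.twist.toFun a)) := by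
  refine homogeneous_induction 𝒜 (P := fun a =>
    rootMat bar p.swap p.swap (entrySign 𝒜 p.swap a) =
      rootMat bar p p (entrySign 𝒜 p (bar.twist.toFun a))) (fun α a ha => ?_)
    (fun a b h h' => by simp only [map_add, h, h']) a
  rw [rootMat_star, Sum.swap_swap, entrySign_of_mem _ ha,
    entrySign_of_mem _ (bar.twist.map_mem ha), map_zsmul, tau_of_mem bar _ _ ha]
  change _ = rootMat bar p p (_ • bar.toFun (rho 𝒜 a))
  rw [rho_of_mem 𝒜 ha]
  simp only [map_zsmul, smul_smul, idx_swap]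
  congr 1
  generalize idx p = x
  clear ha
  revert x α; decide

/-! ### The twisted trace on root matrices -/

/-- The twisted trace, which vanishes on supercommutators modulo supercommutators. -/
def matTrace (𝒜 : ZMod 2 → Submodule k R) [GradedAlgebra 𝒜] : Mat m R →ₗ[k] R :=
  ∑ p, entrySign 𝒜 p ∘ₗ Matrix.entryLinearMap k R p p

theorem matTrace_single_same (p : Fin m ⊕ Fin m) (a : R) :
    matTrace 𝒜 (Matrix.single p p a) = entrySign 𝒜 p a := by
  simp only [matTrace, LinearMap.sum_apply, LinearMap.comp_apply, Matrix.entryLinearMap_apply]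
  rw [Finset.sum_eq_single p]
  · rw [Matrix.single_apply_same]
  · intro q _ hq
    rw [Matrix.single_apply_of_ne _ _ _ _ _ fun h => hq h.1.symm, map_zero]
  · simp

theorem matTrace_single_of_ne {p q : Fin m ⊕ Fin m} (h : p ≠ q) (a : R) :
    matTrace 𝒜 (Matrix.single p q a) = 0 := by
  simp only [matTrace, LinearMap.sum_apply, LinearMap.comp_apply, Matrix.entryLinearMap_apply]
  refine Finset.sum_eq_zero fun x _ => ?_
  rw [Matrix.single_apply_of_ne _ _ _ _ _ fun h' => h (h'.1.trans h'.2.symm), map_zero]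

theorem matTrace_rootMat_of_ne {p q : Fin m ⊕ Fin m} (h : p ≠ q) (a : R) :
    matTrace 𝒜 (rootMat bar p q a) = 0 := by
  rw [rootMat_apply, map_add, matTrace_single_of_ne h, matTrace_single_of_ne
    (fun h' => h (Sum.swap_leftInverse.injective h').symm), add_zero]

/-- With the normalization `entrySign`, the diagonal entries of a root matrix at `p` and `p.swap`
are related by the twisted involution. -/
theorem entrySign_swap_tau (p : Fin m ⊕ Fin m) (a : R) :
    entrySign 𝒜 p.swap (tau bar p p a) = bar.twist.toFun (entrySign 𝒜 p a) := by
  refine homogeneous_induction 𝒜 (P := fun a =>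
    entrySign 𝒜 p.swap (tau bar p p a) = bar.twist.toFun (entrySign 𝒜 p a)) (fun α a ha => ?_)
    (fun a b h h' => by simp only [map_add, h, h']) a
  rw [entrySign_of_mem _ (tau_mem bar p p ha), entrySign_of_mem _ ha, tau_of_mem bar _ _ ha,
    map_zsmul]
  change _ = _ • bar.toFun (rho 𝒜 a)
  rw [rho_of_mem 𝒜 ha, map_zsmul, smul_smul, smul_smul, idx_swap]
  congr 1
  generalize idx p = x
  clear ha
  revert x α; decide

theorem matTrace_rootMat_self (p : Fin m ⊕ Fin m) (a : R) :
    matTrace 𝒜 (rootMat bar p p (entrySign 𝒜 p a)) = a + bar.twist.toFun a := by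
  rw [rootMat_apply, map_add, matTrace_single_same, matTrace_single_same, entrySign_swap_tau,
    entrySign_entrySign]

/-! ### Values of the cocycle on root matrices -/

variable [Invertible (2 : k)]

theorem cocycle_single_same (σ : SuperInvolution 𝒜) (p q : Fin m ⊕ Fin m) {α β : ZMod 2}
    {a b : R} (ha : a ∈ 𝒜 α) (hb : b ∈ 𝒜 β) :
    cocycle m σ (Matrix.single p q a) (Matrix.single q p b) =
      (⅟2 : k) • psign (idx p * (1 + α + β)) • dihedralClass σ a b := by
  rw [cocycle_of_mem σ (single_mem p q ha) (single_mem q p hb), Finset.sum_eq_single p,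
    Finset.sum_eq_single q]
  · rw [Matrix.single_apply_same, Matrix.single_apply_same]
    congr 3
    generalize idx p = x, idx q = y
    clear ha hb
    revert x y α β; decide
  · intro y _ hy
    rw [Matrix.single_apply_of_ne _ _ _ _ _ fun h => hy h.2.symm, map_zero, LinearMap.zero_apply,
      smul_zero]
  · simp
  · intro x _ hx
    refine Finset.sum_eq_zero fun y _ => ?_
    rw [Matrix.single_apply_of_ne _ _ _ _ _ fun h => hx h.1.symm, map_zero, LinearMap.zero_apply,
      smul_zero]
  · simp

theorem cocycle_single_of_ne (σ : SuperInvolution 𝒜) {p q r s : Fin m ⊕ Fin m}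
    (h : ¬(p = s ∧ q = r)) (a b : R) :
    cocycle m σ (Matrix.single p q a) (Matrix.single r s b) = 0 := by
  have : (cocycle m σ).compl₁₂ (Matrix.singleLinearMap k p q) (Matrix.singleLinearMap k r s) =
      0 := by
    refine linearMap_ext_homogeneous₂ 𝒜 fun α β a ha b hb => ?_
    change cocycle m σ (Matrix.single p q a) (Matrix.single r s b) = 0
    rw [cocycle_of_mem σ (single_mem p q ha) (single_mem r s hb)]
    convert smul_zero (⅟2 : k)
    refine Finset.sum_eq_zero fun x _ => Finset.sum_eq_zero fun y _ => ?_
    by_cases h1 : p = x ∧ q = y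
    · rw [Matrix.single_apply_of_ne r s b y x fun h2 => h ⟨h1.1.trans h2.2.symm,
        h1.2.trans h2.1.symm⟩, map_zero, smul_zero]
    · rw [Matrix.single_apply_of_ne p q a x y h1, map_zero, LinearMap.zero_apply, smul_zero]
  exact LinearMap.congr_fun₂ this a b

theorem cocycle_rootMat_of_ne {p q r s : Fin m ⊕ Fin m} (h : ¬(p = s ∧ q = r))
    (h' : ¬(p = r.swap ∧ q = s.swap)) (a b : R) :
    cocycle m bar.twist (rootMat bar p q a) (rootMat bar r s b) = 0 := by
  rw [rootMat_apply, rootMat_apply]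
  simp only [map_add, LinearMap.add_apply]
  rw [cocycle_single_of_ne _ h, cocycle_single_of_ne _ h', cocycle_single_of_ne,
    cocycle_single_of_ne]
  · simp
  · rintro ⟨h1, h2⟩
    exact h ⟨Sum.swap_leftInverse.injective h2, Sum.swap_leftInverse.injective h1⟩
  · rintro ⟨h1, h2⟩
    exact h' ⟨by rw [← h2, Sum.swap_swap], by rw [← h1, Sum.swap_swap]⟩

/-- The entries at `(p, q)` and at `(q*, p*)` both contribute, equally because of the relation `⟨σ
a, σ b⟩ = -⟨a, b⟩`; the factor `1/2` in `cocycle` compensates. -/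
theorem cocycle_rootMat_far {p q : Fin m ⊕ Fin m} (hpq : Far p q) {α β : ZMod 2} {a b : R}
    (ha : a ∈ 𝒜 α) (hb : b ∈ 𝒜 β) :
    cocycle m bar.twist (rootMat bar p q a) (rootMat bar q p b) =
      psign (idx p * (1 + α + β)) • dihedralClass bar.twist a b := by
  rw [rootMat_apply, rootMat_apply]
  simp only [map_add, LinearMap.add_apply]
  rw [cocycle_single_same _ _ _ ha hb, cocycle_single_of_ne _ fun h => hpq.ne_swap h.1,
    cocycle_single_of_ne _ fun h => hpq.symm.swap_ne h.1,
    cocycle_single_same _ _ _ (tau_mem bar p q ha) (tau_mem bar q p hb)]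
  have h := dihedralClass_star bar.twist ha hb
  change dihedralClass _ (bar.toFun (rho 𝒜 a)) (bar.toFun (rho 𝒜 b)) = _ at h
  rw [rho_of_mem 𝒜 ha, rho_of_mem 𝒜 hb] at h
  simp only [map_zsmul, LinearMap.smul_apply] at h
  rw [tau_of_mem bar p q ha, tau_of_mem bar q p hb]
  simp only [map_zsmul, LinearMap.smul_apply, smul_smul, add_zero, zero_add, idx_swap] at h ⊢
  have e : psign ((idx q + 1) * (1 + α + β)) *
      (-psign ((idx q + idx p) * β + (1 + idx q) * idx p) *
        -psign ((idx p + idx q) * α + (1 + idx p) * idx q)) =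
      -psign (idx p * (1 + α + β)) * (psign β * psign α) := by
    generalize idx p = x, idx q = y
    clear ha hb h
    revert x y α β; decide
  rw [e, mul_smul _ _ (dihedralClass bar.twist (bar.toFun a) (bar.toFun b)), h, neg_smul_neg,
    ← smul_add, CartanSystem.invOf_two_smul_add_self]

end RootMatrices

/-! ### The system of root elements in the central extension -/

section ExtSystem

variable {k R : Type*} [CommRing k] [Ring R] [Algebra k R]
  {𝒜 : ZMod 2 → Submodule k R} [GradedAlgebra 𝒜] {m : ℕ}
  (bar : SuperInvolution 𝒜)

/-- The root elements of the central extension. -/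
def rootExt (p q : Fin m ⊕ Fin m) : R →ₗ[k] Mat m R × DihedralQuotient bar.twist :=
  LinearMap.inl k _ _ ∘ₗ rootMat bar p q

theorem rootExt_apply (p q : Fin m ⊕ Fin m) (a : R) : rootExt bar p q a =
    (rootMat bar p q a, 0) := rfl

/-- The cyclic relation for `a, 1, 1` reads `2 ⟨a, 1⟩ + ⟨1, a⟩ = 0`, and `⟨1, a⟩ = -⟨a, 1⟩`. -/
theorem dihedralClass_one_right (σ : SuperInvolution 𝒜) (a : R) : dihedralClass σ a 1 = 0 :=
  homogeneous_induction 𝒜 (P := fun a => dihedralClass σ a 1 = 0)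
    (fun α a ha => by
      have h1 : (1 : R) ∈ 𝒜 0 := SetLike.one_mem_graded 𝒜
      have h := dihedralClass_cyclic σ ha h1 h1
      rw [dihedralClass_skew σ (SetLike.mul_mem_graded h1 h1) ha] at h
      simpa [koszul_zero_left, koszul_zero_right] using h)
    (fun a b h h' => by rw [map_add, LinearMap.add_apply, h, h', add_zero]) a

theorem superFlip_one_right (a : R) : superFlip 𝒜 a 1 = a :=
  homogeneous_induction 𝒜 (P := fun a => superFlip 𝒜 a 1 = a)
    (fun α a ha => by
      rw [superFlip_of_mem 𝒜 ha (SetLike.one_mem_graded 𝒜), koszul_zero_right, one_smul, one_mul])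
    (fun a b h h' => by rw [map_add, LinearMap.add_apply, h, h']) a

variable [Invertible (2 : k)]

theorem rootExt_bracket_ext {p q r s : Fin m ⊕ Fin m}
    {f : R →ₗ[k] R →ₗ[k] Mat m R × DihedralQuotient bar.twist}
    (h : ∀ α β, ∀ a ∈ 𝒜 α, ∀ b ∈ 𝒜 β, (matExt m bar.twist).bracket (rootExt bar p q a)
      (rootExt bar r s b) = f a b) (a b : R) :
    (matExt m bar.twist).bracket (rootExt bar p q a) (rootExt bar r s b) = f a b := by
  have : (matExt m bar.twist).bracket.compl₁₂ (rootExt bar p q) (rootExt bar r s) = f :=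
    linearMap_ext_homogeneous₂ 𝒜 h
  exact LinearMap.congr_fun₂ this a b

/-- The cocycle pairs only transposed positions, that is opposite roots, and no axiom of the system
speaks of brackets of opposite roots. So the rules for matrices persist with zero central component.
-/
theorem rootExt_system : PeriplecticSystem bar (matExt m bar.twist) (rootExt bar) where
  mem _ _ _ ha := ⟨rootMat_mem bar _ _ ha, zero_mem _⟩
  star _ a := by rw [rootExt_apply, rootExt_apply, rootMat_star]
  mul {p q r} hpq hqr hpr := rootExt_bracket_ext bar
    (f := (LinearMap.mul k R).compr₂ (rootExt bar p r)) fun α β a ha b hb => by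
      rw [matExt_bracket]
      refine Prod.ext ?_ ?_
      · change superBracket _ (rootMat bar p q a) (rootMat bar q r b) = rootMat bar p r (a * b)
        rw [rootMat_bracket bar _ _ _ _ ha hb, if_pos rfl, if_neg hqr.ne_swap,
          if_neg hpr.symm.ne, if_neg hpq.symm.swap_ne]
        simp
      · exact cocycle_rootMat_of_ne bar (fun h => hpr.ne h.1) (fun h => hpq.ne_swap h.1) _ _
  zero {p q r s} _ _ h1 h2 h3 h4 := rootExt_bracket_ext bar (f := 0) fun α β a ha b hb => by
      rw [matExt_bracket]
      refine Prod.ext ?_ ?_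
      · change superBracket _ (rootMat bar p q a) (rootMat bar r s b) = 0
        rw [rootMat_bracket bar _ _ _ _ ha hb, if_neg h1, if_neg h3, if_neg h2.symm,
          if_neg h4.symm]
        simp
      · exact cocycle_rootMat_of_ne bar (fun h => h2 h.1) (fun h => h4 h.1) _ _

theorem rootExt_long (hm : 3 ≤ m) (p : Fin m ⊕ Fin m) (a : R) :
    PeriplecticSystem.longRoot (matExt m bar.twist) (rootExt bar) hm p a =
      rootExt bar p p.swap a := by
  have h := third_far_left hm p p
  have := rootExt_bracket_ext bar (p := p) (q := third hm p p) (r := third hm p p) (s := p.swap)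
    (f := (LinearMap.mul k R).compr₂ (rootExt bar p p.swap)) (fun α β a ha b hb => by
      rw [matExt_bracket]
      refine Prod.ext ?_ ?_
      · change superBracket _ (rootMat bar p _ a) (rootMat bar _ p.swap b) =
          rootMat bar p p.swap (a * b)
        rw [rootMat_bracket bar _ _ _ _ ha hb, if_pos rfl, Sum.swap_swap, if_neg h.ne,
          if_neg (ne_swap_self p).symm, if_neg h.swap_ne]
        simp
      · exact cocycle_rootMat_of_ne bar (fun h' => ne_swap_self p h'.1)
          (fun h' => h.symm.ne_swap h'.1) _ _) a 1
  refine this.trans ?_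
  simp

theorem rootExt_cartan {p q : Fin m ⊕ Fin m} (hpq : Far p q) (a b : R) :
    PeriplecticSystem.cartan 𝒜 (matExt m bar.twist) (rootExt bar) p q a b =
      (rootMat bar p p (entrySign 𝒜 p (a * b)) -
        rootMat bar q q (entrySign 𝒜 q (superFlip 𝒜 a b)), dihedralClass bar.twist a b) := by
  have : PeriplecticSystem.cartan 𝒜 (matExt m bar.twist) (rootExt bar) p q =
      ((LinearMap.mul k R).compr₂ (rootMat bar p p ∘ₗ entrySign 𝒜 p) -
        (superFlip 𝒜).compr₂ (rootMat bar q q ∘ₗ entrySign 𝒜 q)).compr₂ (LinearMap.inl k _ _) +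
      (dihedralClass bar.twist).compr₂ (LinearMap.inr k _ _) := by
    refine linearMap_ext_homogeneous₂ 𝒜 fun α β a ha b hb => ?_
    rw [PeriplecticSystem.cartan_of_mem p q ha hb, matExt_bracket]
    refine Prod.ext ?_ ?_
    · change psign (idx p * (1 + α + β)) • superBracket _ (rootMat bar p q a) (rootMat bar q p b) =
        rootMat bar p p (entrySign 𝒜 p (a * b)) -
          rootMat bar q q (entrySign 𝒜 q (superFlip 𝒜 a b)) + 0
      rw [rootMat_bracket bar _ _ _ _ ha hb, if_pos rfl, if_neg hpq.symm.ne_swap, if_pos rfl,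
        if_neg hpq.symm.swap_ne, superFlip_of_mem 𝒜 ha hb,
        entrySign_of_mem p (SetLike.mul_mem_graded ha hb), map_zsmul (entrySign 𝒜 q),
        entrySign_of_mem q (SetLike.mul_mem_graded hb ha)]
      simp only [map_zsmul, add_zero, smul_sub, smul_smul]
      congr 2
      · rw [add_assoc]
      · generalize idx p = x, idx q = y
        clear ha hb
        revert x y α β; decide
    · change psign (idx p * (1 + α + β)) • cocycle m bar.twist (rootMat bar p q a) (rootMat bar q p b) =
        0 + dihedralClass bar.twist a b
      rw [cocycle_rootMat_far bar hpq ha hb, smul_smul, psign_sq, one_smul, zero_add]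
  rw [this]
  exact Prod.ext (add_zero _) (zero_add _)

theorem rootExt_lam (hm : 3 ≤ m) (p : Fin m ⊕ Fin m) (a b : R) :
    CartanSystem.lam 𝒜 (PeriplecticSystem.cartan 𝒜 (matExt m bar.twist) (rootExt bar)) hm p a b =
      (rootMat bar p p (entrySign 𝒜 p (superBracket 𝒜 a b)), dihedralClass bar.twist a b) := by
  have h := (third_far_left hm p p).symm
  simp only [CartanSystem.lam, LinearMap.sub_apply, LinearMap.compr₂_apply, LinearMap.flip_apply]
  rw [rootExt_cartan bar h, rootExt_cartan bar h, superFlip_one_right, mul_one,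
    dihedralClass_one_right, ← mul_sub_superFlip]
  refine Prod.ext ?_ (sub_zero _)
  simp only [map_sub, Prod.fst_sub]
  abel

/-- Averaging over `p` and `p.swap` turns the diagonal entry `[a, b]` into half of `[a, b] + σ [a,
b]`, so the matrix part vanishes on dihedral homology classes. -/
theorem rootExt_symLam (hm : 3 ≤ m) (p : Fin m ⊕ Fin m) (a b : R) :
    CartanSystem.symLam 𝒜 (PeriplecticSystem.cartan 𝒜 (matExt m bar.twist) (rootExt bar)) hm p
      a b = ((⅟2 : k) • rootMat bar p p (entrySign 𝒜 p
        (dihedralBracket bar.twist (dihedralClass bar.twist a b))), dihedralClass bar.twist a b) := by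
  simp only [CartanSystem.symLam, LinearMap.smul_apply, LinearMap.add_apply]
  rw [rootExt_lam, rootExt_lam, rootMat_swap_self, dihedralBracket_class]
  refine Prod.ext ?_ (CartanSystem.invOf_two_smul_add_self _)
  simp only [map_add, Prod.smul_fst, Prod.fst_add]
  rw [add_comm]

end ExtSystem

/-! ### The retraction onto a Lie superalgebra with a system of root elements -/

namespace PeriplecticSystem

section Retraction

variable {k R L L' : Type*} [CommRing k] [Ring R] [Algebra k R]
  {𝒜 : ZMod 2 → Submodule k R} [GradedAlgebra 𝒜] {m : ℕ}
  [AddCommGroup L] [Module k L] [AddCommGroup L'] [Module k L']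
  {bar : SuperInvolution 𝒜} {S : LieSuperalgebra k L} {S' : LieSuperalgebra k L'}
  {u : Fin m ⊕ Fin m → Fin m ⊕ Fin m → R →ₗ[k] L}
  {u' : Fin m ⊕ Fin m → Fin m ⊕ Fin m → R →ₗ[k] L'}

theorem map_cartan (φ : LieSuperHom S S') (hφ : ∀ p q a, Far p q → φ.toLinearMap (u p q a) =
    u' p q a) {p q : Fin m ⊕ Fin m} (hpq : Far p q) (a b : R) :
    φ.toLinearMap (cartan 𝒜 S u p q a b) = cartan 𝒜 S' u' p q a b := by
  simp only [cartan, LinearMap.smul_apply, LinearMap.compl₁₂_apply, LinearMap.comp_apply,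
    map_zsmul, φ.map_bracket]
  rw [hφ _ _ _ hpq, hφ _ _ _ hpq.symm]

theorem map_longRoot (φ : LieSuperHom S S') (hφ : ∀ p q a, Far p q → φ.toLinearMap (u p q a) =
    u' p q a) (hm : 3 ≤ m) (p : Fin m ⊕ Fin m) (a : R) :
    φ.toLinearMap (longRoot S u hm p a) = longRoot S' u' hm p a := by
  simp only [longRoot, LinearMap.comp_apply, LinearMap.flip_apply, φ.map_bracket]
  rw [hφ _ _ _ (third_far_left hm p p).symm, hφ _ _ _ (by simpa using third_far_left hm p p)]

theorem map_symLam [Invertible (2 : k)] (φ : LieSuperHom S S')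
    (hφ : ∀ p q a, Far p q → φ.toLinearMap (u p q a) =
    u' p q a) (hm : 3 ≤ m) (p : Fin m ⊕ Fin m) (a b : R) :
    φ.toLinearMap (CartanSystem.symLam 𝒜 (cartan 𝒜 S u) hm p a b) =
      CartanSystem.symLam 𝒜 (cartan 𝒜 S' u') hm p a b := by
  have h : ∀ p, Far p (third hm p p) := fun p => (third_far_left hm p p).symm
  simp only [CartanSystem.symLam, CartanSystem.lam, LinearMap.smul_apply, LinearMap.add_apply,
    LinearMap.sub_apply, LinearMap.compr₂_apply, LinearMap.flip_apply, map_smul, map_add, map_sub,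
    map_cartan φ hφ (h _)]

theorem bracket_eq_cartan (p q : Fin m ⊕ Fin m) (a b : R) : S.bracket (u p q a) (u q p b) =
    psign (idx p) • cartan 𝒜 S u p q (entrySign 𝒜 p a) (entrySign 𝒜 p b) := by
  have : S.bracket.compl₁₂ (u p q) (u q p) =
      psign (idx p) • (cartan 𝒜 S u p q).compl₁₂ (entrySign 𝒜 p) (entrySign 𝒜 p) := by
    refine linearMap_ext_homogeneous₂ 𝒜 fun α β a ha b hb => ?_
    simp only [LinearMap.smul_apply, LinearMap.compl₁₂_apply]
    rw [cartan_of_mem p q (entrySign_mem p ha) (entrySign_mem p hb), entrySign_of_mem p ha,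
      entrySign_of_mem p hb]
    simp only [map_zsmul, LinearMap.smul_apply, smul_smul]
    convert (one_smul ℤ _).symm using 2
    generalize idx p = x
    clear ha hb
    revert x α β; decide
  exact LinearMap.congr_fun₂ this a b

theorem fullSpan_induction (hm : 3 ≤ m) {N : Submodule k L}
    (short : ∀ p q a, Far p q → u p q a ∈ N) (long : ∀ p a, longRoot S u hm p a ∈ N)
    (cart : ∀ p q a b, Far p q → cartan 𝒜 S u p q a b ∈ N) : fullSpan S u hm ≤ N := by
  refine Submodule.span_le.2 ?_
  rintro _ ((⟨p, q, a, hpq, rfl⟩ | ⟨p, a, rfl⟩) | ⟨p, q, a, b, hpq, rfl⟩)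
  · exact short p q a hpq
  · exact long p a
  · rw [SetLike.mem_coe, bracket_eq_cartan (𝒜 := 𝒜)]
    exact zsmul_mem (cart _ _ _ _ hpq) _

variable [Invertible (2 : k)]

variable (bar S u) in
/-- The element of the Lie superalgebra that corresponds to the root matrix `u_{pq}(a)`. -/
def lift (hm : 3 ≤ m) (p₀ p q : Fin m ⊕ Fin m) : R →ₗ[k] L :=
  if p = q then CartanSystem.symDiff (cartan 𝒜 S u) bar.twist hm p₀ p ∘ₗ entrySign 𝒜 p
  else if q = p.swap then longRoot S u hm p else u p q

variable (hu : PeriplecticSystem bar S u)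

include hu

/-- A root matrix has entries at `(p, q)` and `(q*, p*)`; this compatibility makes both contribute
equally to `retraction`, whose factor `1/2` then gives the right value. -/
theorem lift_star (hm : 3 ≤ m) (p₀ p q : Fin m ⊕ Fin m) (a : R) :
    lift bar S u hm p₀ q.swap p.swap (tau bar p q a) = lift bar S u hm p₀ p q a := by
  by_cases h : p = q
  · subst h
    simp only [lift, if_true, LinearMap.comp_apply]
    rw [entrySign_swap_tau]
    simp only [CartanSystem.symDiff, LinearMap.smul_apply, LinearMap.add_apply,
      LinearMap.comp_apply, bar.twist.invol, Sum.swap_swap]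
    rw [add_comm]
  have h' : q.swap ≠ p.swap := fun e => h (Sum.swap_leftInverse.injective e).symm
  by_cases hs : q = p.swap
  · subst hs
    simp only [lift, Sum.swap_swap, if_neg h, if_true]
    exact hu.longRoot_tau hm p a
  · have hs' : p.swap ≠ q.swap.swap := fun e => hs (by rw [e, Sum.swap_swap])
    simp only [lift, if_neg h, if_neg h', if_neg hs, if_neg hs']
    refine (hu.star (fun e => ?_) a).symm
    rcases eq_or_eq_swap e with rfl | e
    · exact h rfl
    · exact hs (by rw [e, Sum.swap_swap])

/-- The retraction from the central extension. -/
def retraction (hm : 3 ≤ m) (p₀ : Fin m ⊕ Fin m) :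
    Mat m R × DihedralQuotient bar.twist →ₗ[k] L :=
  ((⅟2 : k) • ∑ p, ∑ q, lift bar S u hm p₀ p q ∘ₗ Matrix.entryLinearMap k R p q).coprod
    ((dihedralRel bar.twist).liftQ _ (hu.cartanSystem.dihedralRel_le_ker_symLam hm p₀))

theorem retraction_class (hm : 3 ≤ m) (p₀ : Fin m ⊕ Fin m) (a b : R) :
    hu.retraction hm p₀ (0, dihedralClass bar.twist a b) =
      CartanSystem.symLam 𝒜 (cartan 𝒜 S u) hm p₀ a b := by
  rw [retraction, LinearMap.coprod_apply, map_zero, zero_add]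
  rfl

theorem retraction_rootMat (hm : 3 ≤ m) (p₀ p q : Fin m ⊕ Fin m) (a : R) :
    hu.retraction hm p₀ (rootMat bar p q a, 0) = lift bar S u hm p₀ p q a := by
  have h : ∀ p q a, ∑ x, ∑ y, lift bar S u hm p₀ x y (Matrix.single p q a x y) =
      lift bar S u hm p₀ p q a := by
    intro p q a
    rw [Finset.sum_eq_single p, Finset.sum_eq_single q]
    · rw [Matrix.single_apply_same]
    · intro y _ hy
      rw [Matrix.single_apply_of_ne _ _ _ _ _ fun h => hy h.2.symm, map_zero]
    · simp
    · intro x _ hx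
      refine Finset.sum_eq_zero fun y _ => ?_
      rw [Matrix.single_apply_of_ne _ _ _ _ _ fun h => hx h.1.symm, map_zero]
    · simp
  rw [retraction, LinearMap.coprod_apply, map_zero, add_zero, rootMat_apply, map_add]
  simp only [LinearMap.smul_apply, LinearMap.sum_apply, LinearMap.comp_apply,
    Matrix.entryLinearMap_apply]
  rw [h, h, hu.lift_star, ← smul_add, CartanSystem.invOf_two_smul_add_self]

/-- It suffices to check the spanning elements. Root elements return by construction, and for
Cartan-type elements the claim is `eq_symLam_add`. In particular `φ` is injective on the span. -/
theorem retraction_comp (hm : 3 ≤ m) (p₀ : Fin m ⊕ Fin m)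
    (φ : LieSuperHom S (matExt m bar.twist))
    (hφ : ∀ p q a, Far p q → φ.toLinearMap (u p q a) = rootExt bar p q a) {x : L}
    (hx : x ∈ fullSpan S u hm) : hu.retraction hm p₀ (φ.toLinearMap x) = x := by
  have : fullSpan S u hm ≤
      LinearMap.eqLocus (hu.retraction hm p₀ ∘ₗ φ.toLinearMap) LinearMap.id := by
    refine fullSpan_induction (𝒜 := 𝒜) hm ?_ ?_ ?_
    · intro p q a hpq
      change hu.retraction hm p₀ (φ.toLinearMap (u p q a)) = u p q a
      rw [hφ p q a hpq, rootExt_apply, hu.retraction_rootMat, lift, if_neg hpq.ne,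
        if_neg hpq.symm.ne_swap]
    · intro p a
      change hu.retraction hm p₀ (φ.toLinearMap (longRoot S u hm p a)) = longRoot S u hm p a
      rw [map_longRoot φ hφ, rootExt_long, rootExt_apply, hu.retraction_rootMat, lift,
        if_neg (ne_swap_self p), if_pos rfl]
    · intro p q a b hpq
      change hu.retraction hm p₀ (φ.toLinearMap (cartan 𝒜 S u p q a b)) = cartan 𝒜 S u p q a b
      rw [map_cartan φ hφ hpq, rootExt_cartan bar hpq, ← zero_add (dihedralClass _ a b),
        ← add_zero (_ - _), ← Prod.mk_add_mk, map_add, hu.retraction_class,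
        ← sub_zero (0 : DihedralQuotient bar.twist), ← Prod.mk_sub_mk, map_sub,
        hu.retraction_rootMat, hu.retraction_rootMat, lift, lift, if_pos rfl, if_pos rfl,
        LinearMap.comp_apply, LinearMap.comp_apply, entrySign_entrySign, entrySign_entrySign,
        hu.cartanSystem.eq_symLam_add hm p₀ hpq a b]
      abel
  exact this hx

omit hu in
/-- On the image of the span of root and Cartan-type elements, the twisted trace is determined by
the central component. -/
theorem matTrace_eq (hm : 3 ≤ m) (φ : LieSuperHom S (matExt m bar.twist))
    (hφ : ∀ p q a, Far p q → φ.toLinearMap (u p q a) = rootExt bar p q a) {x : L}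
    (hx : x ∈ fullSpan S u hm) : matTrace 𝒜 (φ.toLinearMap x).1 =
      dihedralBracket bar.twist (φ.toLinearMap x).2 := by
  have : fullSpan S u hm ≤ LinearMap.eqLocus
      (matTrace 𝒜 ∘ₗ LinearMap.fst k _ _ ∘ₗ φ.toLinearMap)
      (dihedralBracket bar.twist ∘ₗ LinearMap.snd k _ _ ∘ₗ φ.toLinearMap) := by
    refine fullSpan_induction (𝒜 := 𝒜) hm ?_ ?_ ?_
    · intro p q a hpq
      change matTrace 𝒜 (φ.toLinearMap _).1 = dihedralBracket bar.twist (φ.toLinearMap _).2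
      rw [hφ p q a hpq, rootExt_apply, matTrace_rootMat_of_ne bar hpq.ne, map_zero]
    · intro p a
      change matTrace 𝒜 (φ.toLinearMap _).1 = dihedralBracket bar.twist (φ.toLinearMap _).2
      rw [map_longRoot φ hφ, rootExt_long, rootExt_apply,
        matTrace_rootMat_of_ne bar (ne_swap_self p), map_zero]
    · intro p q a b hpq
      change matTrace 𝒜 (φ.toLinearMap _).1 = dihedralBracket bar.twist (φ.toLinearMap _).2
      rw [map_cartan φ hφ hpq, rootExt_cartan bar hpq, map_sub, matTrace_rootMat_self,
        matTrace_rootMat_self, dihedralBracket_class, ← mul_sub_superFlip, map_sub]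
      abel
  exact this hx

/-- The central component identifies the kernel of the matrix component with the dihedral
homology. -/
theorem exists_kernel_equiv (hm : 3 ≤ m) (φ : LieSuperHom S (matExt m bar.twist))
    (hφ : ∀ p q a, Far p q → φ.toLinearMap (u p q a) = rootExt bar p q a)
    (htop : fullSpan S u hm = ⊤) :
    Nonempty (LinearMap.ker (LinearMap.fst k _ _ ∘ₗ φ.toLinearMap) ≃ₗ[k]
      dihedralHomology bar.twist) := by
  let p₀ : Fin m ⊕ Fin m := Sum.inl ⟨0, by omega⟩
  have hmem : ∀ x : L, x ∈ fullSpan S u hm := fun x => htop.ge (Submodule.mem_top)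
  let f : LinearMap.ker (LinearMap.fst k _ _ ∘ₗ φ.toLinearMap) →ₗ[k] dihedralHomology bar.twist :=
    LinearMap.codRestrict _ ((LinearMap.snd k _ _ ∘ₗ φ.toLinearMap) ∘ₗ Submodule.subtype _) (by
      rintro ⟨x, hx⟩
      have hx' : (φ.toLinearMap x).1 = 0 := hx
      rw [dihedralHomology_eq_ker, LinearMap.mem_ker]
      change dihedralBracket bar.twist (φ.toLinearMap x).2 = 0
      rw [← matTrace_eq hm φ hφ (hmem x), hx', map_zero])
  refine ⟨LinearEquiv.ofBijective f ⟨?_, ?_⟩⟩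
  · rw [← LinearMap.ker_eq_bot, LinearMap.ker_eq_bot']
    rintro ⟨x, hx⟩ h
    have h1 : (φ.toLinearMap x).1 = 0 := hx
    have h2 : (φ.toLinearMap x).2 = 0 := congrArg Subtype.val h
    have h3 : φ.toLinearMap x = 0 := Prod.ext h1 h2
    refine Subtype.ext ?_
    change x = 0
    rw [← hu.retraction_comp hm p₀ φ hφ (hmem x), h3, map_zero]
  · rintro ⟨q, hq⟩
    -- The preimage of `q` is the retraction of `(0, q)`: by `rootExt_symLam` its image has central
    -- component `q`, and a matrix component that vanishes as soon as `dihedralBracket` kills `q`.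
    have key : φ.toLinearMap ∘ₗ hu.retraction hm p₀ ∘ₗ LinearMap.inr k _ _ =
        ((⅟2 : k) • rootMat bar p₀ p₀ ∘ₗ entrySign 𝒜 p₀ ∘ₗ dihedralBracket bar.twist).prod
          LinearMap.id := by
      refine dihedralQuotient_ext _ fun a b => ?_
      change φ.toLinearMap (hu.retraction hm p₀ (0, dihedralClass bar.twist a b)) = _
      rw [hu.retraction_class, map_symLam φ hφ, rootExt_symLam]
      rfl
    have hk := LinearMap.congr_fun key q
    rw [dihedralHomology_eq_ker, LinearMap.mem_ker] at hq
    have h1 : (φ.toLinearMap (hu.retraction hm p₀ (0, q))).1 = 0 := by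
      refine (congrArg Prod.fst hk).trans ?_
      change (⅟2 : k) • rootMat bar p₀ p₀ (entrySign 𝒜 p₀ (dihedralBracket bar.twist q)) = 0
      rw [hq, map_zero, map_zero, smul_zero]
    exact ⟨⟨hu.retraction hm p₀ (0, q), h1⟩, Subtype.ext (congrArg Prod.snd hk)⟩

end Retraction

end PeriplecticSystem

/-! ### The system of root elements in the Steinberg Lie superalgebra -/

section Stp

/-- A linear map given on homogeneous components. -/
def ofHomogeneous {k R M : Type*} [CommRing k] [AddCommGroup R] [Module k R] [AddCommGroup M]
    [Module k M] {𝒜 : ZMod 2 → Submodule k R} [DirectSum.Decomposition 𝒜]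
    (G : ∀ α, 𝒜 α →ₗ[k] M) : R →ₗ[k] M :=
  DirectSum.toModule k (ZMod 2) M G ∘ₗ (DirectSum.decomposeLinearEquiv 𝒜).toLinearMap

theorem ofHomogeneous_coe {k R M : Type*} [CommRing k] [AddCommGroup R] [Module k R]
    [AddCommGroup M] [Module k M] {𝒜 : ZMod 2 → Submodule k R} [DirectSum.Decomposition 𝒜]
    (G : ∀ α, 𝒜 α →ₗ[k] M) {α : ZMod 2} (a : 𝒜 α) : ofHomogeneous G (a : R) = G α a := by
  change DirectSum.toModule k (ZMod 2) M G (DirectSum.decompose 𝒜 (a : R)) = _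
  rw [DirectSum.decompose_coe]
  exact DirectSum.toModule_lof (M := fun i => 𝒜 i) k α a

variable {k R : Type*} [CommRing k] [Ring R] [Algebra k R]
  {𝒜 : ZMod 2 → Submodule k R} [GradedAlgebra 𝒜] {m : ℕ} (bar : SuperInvolution 𝒜)

theorem tau_inl_inl (i j : Fin m) (a : R) :
    tau bar (Sum.inl i) (Sum.inl j) a = -bar.toFun a := by
  change -(1 : ℤ) • bar.toFun _ = _
  exact neg_one_zsmul _

theorem tau_inr_inr (i j : Fin m) (a : R) :
    tau bar (Sum.inr i) (Sum.inr j) a = -bar.toFun a := by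
  change -(1 : ℤ) • bar.toFun _ = _
  exact neg_one_zsmul _

theorem tau_inl_inr (i j : Fin m) (a : R) :
    tau bar (Sum.inl i) (Sum.inr j) a = rho 𝒜 (bar.toFun a) := by
  change -(-1 : ℤ) • bar.toFun _ = _
  rw [if_neg (show ¬(idx (Sum.inl i : Fin m ⊕ Fin m) = idx (Sum.inr j : Fin m ⊕ Fin m)) from
    (by decide : ¬((0 : ZMod 2) = 1))), neg_neg, one_smul, bar.map_rho]

theorem tau_inr_inl (i j : Fin m) (a : R) :
    tau bar (Sum.inr i) (Sum.inl j) a = -rho 𝒜 (bar.toFun a) := by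
  change -(1 : ℤ) • bar.toFun _ = _
  rw [if_neg (show ¬(idx (Sum.inr i : Fin m ⊕ Fin m) = idx (Sum.inl j : Fin m ⊕ Fin m)) from
    (by decide : ¬((1 : ZMod 2) = 0))), neg_one_zsmul, bar.map_rho]

theorem toStp_eq_zero {r : Free k (StpGen 𝒜 m)} (h : StpRel bar r) : toStp m bar r = 0 :=
  (Submodule.Quotient.mk_eq_zero _).2 (lieRel_subset (Or.inl (Or.inl h)))

theorem toStp_eq {r s : Free k (StpGen 𝒜 m)} (h : StpRel bar (r - s)) :
    toStp m bar r = toStp m bar s :=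
  sub_eq_zero.1 (toStp_eq_zero bar h)

/-- The elements `t_{ij}(a)` of the Steinberg Lie superalgebra, for all `a`. -/
def tStp (i j : Fin m) : R →ₗ[k] Stp m bar :=
  if h : i ≠ j then ofHomogeneous fun α =>
    { toFun := fun a : 𝒜 α => toStp m bar (tF h a)
      map_add' := fun a b => toStp_eq bar (StpRel.t_add h a b)
      map_smul' := fun c a => toStp_eq bar (StpRel.t_smul h c a) }
  else 0

/-- The elements `f_{ij}(a)` of the Steinberg Lie superalgebra, for all `a`. -/
def fStp (i j : Fin m) : R →ₗ[k] Stp m bar :=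
  if h : i ≠ j then ofHomogeneous fun α =>
    { toFun := fun a : 𝒜 α => toStp m bar (fF h a)
      map_add' := fun a b => toStp_eq bar (StpRel.f_add h a b)
      map_smul' := fun c a => toStp_eq bar (StpRel.f_smul h c a) }
  else 0

/-- The elements `g_{ij}(a)` of the Steinberg Lie superalgebra, for all `a`. -/
def gStp (i j : Fin m) : R →ₗ[k] Stp m bar :=
  if h : i ≠ j then ofHomogeneous fun α =>
    { toFun := fun a : 𝒜 α => toStp m bar (gF h a)
      map_add' := fun a b => toStp_eq bar (StpRel.g_add h a b)
      map_smul' := fun c a => toStp_eq bar (StpRel.g_smul h c a) }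
  else 0

theorem tStp_coe {i j : Fin m} (h : i ≠ j) {α : ZMod 2} (a : 𝒜 α) :
    tStp bar i j (a : R) = toStp m bar (tF h a) := by
  rw [tStp, dif_pos h]
  exact ofHomogeneous_coe _ a

theorem fStp_coe {i j : Fin m} (h : i ≠ j) {α : ZMod 2} (a : 𝒜 α) :
    fStp bar i j (a : R) = toStp m bar (fF h a) := by
  rw [fStp, dif_pos h]
  exact ofHomogeneous_coe _ a

theorem gStp_coe {i j : Fin m} (h : i ≠ j) {α : ZMod 2} (a : 𝒜 α) :
    gStp bar i j (a : R) = toStp m bar (gF h a) := by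
  rw [gStp, dif_pos h]
  exact ofHomogeneous_coe _ a

theorem fStp_star {i j : Fin m} (h : i ≠ j) (a : R) :
    fStp bar i j a = fStp bar j i (rho 𝒜 (bar.toFun a)) := by
  refine homogeneous_induction 𝒜 (P := fun a =>
    fStp bar i j a = fStp bar j i (rho 𝒜 (bar.toFun a))) (fun α a ha => ?_)
    (fun a b h h' => by simp only [map_add, h, h']) a
  lift a to 𝒜 α using ha
  -- Instantiated at the conjugate of `a`, so that the left coefficient becomes `a`.
  have := toStp_eq bar (StpRel.f_bar h (hbar bar a))
  rw [← fStp_coe, ← fStp_coe] at this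
  simpa [hbar, hrho, bar.invol] using this

theorem gStp_star {i j : Fin m} (h : i ≠ j) (a : R) :
    gStp bar i j a = -gStp bar j i (rho 𝒜 (bar.toFun a)) := by
  refine homogeneous_induction 𝒜 (P := fun a =>
    gStp bar i j a = -gStp bar j i (rho 𝒜 (bar.toFun a))) (fun α a ha => ?_)
    (fun a b h h' => by simp only [map_add, h, h', neg_add]) a
  lift a to 𝒜 α using ha
  have := StpRel.g_bar (m := m) (bar := bar) h (hbar bar a)
  rw [← sub_neg_eq_add] at this
  have := toStp_eq bar this
  change _ = -toStp m bar (gF h.symm _) at this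
  rw [← gStp_coe, ← gStp_coe] at this
  simpa [hbar, hrho, bar.invol] using this

/-- The root elements of the Steinberg Lie superalgebra. -/
def rootStp : Fin m ⊕ Fin m → Fin m ⊕ Fin m → R →ₗ[k] Stp m bar
  | Sum.inl i, Sum.inl j => tStp bar i j
  | Sum.inl i, Sum.inr j => fStp bar i j
  | Sum.inr i, Sum.inl j => gStp bar i j
  | Sum.inr i, Sum.inr j => -(tStp bar j i ∘ₗ bar.toFun)

theorem rootStp_star {p q : Fin m ⊕ Fin m} (h : Far p q) (a : R) :
    rootStp bar p q a = rootStp bar q.swap p.swap (tau bar p q a) := by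
  rcases p with i | i <;> rcases q with j | j
  · change tStp bar i j a = -tStp bar i j (bar.toFun (tau bar (Sum.inl i) (Sum.inl j) a))
    rw [tau_inl_inl, map_neg, bar.invol, map_neg, neg_neg]
  · change fStp bar i j a = fStp bar j i (tau bar (Sum.inl i) (Sum.inr j) a)
    replace h : i ≠ j := h
    rw [tau_inl_inr, fStp_star bar h]
  · change gStp bar i j a = gStp bar j i (tau bar (Sum.inr i) (Sum.inl j) a)
    replace h : i ≠ j := h
    rw [tau_inr_inl, gStp_star bar h, map_neg]
  · change -tStp bar j i (bar.toFun a) = tStp bar j i (tau bar (Sum.inr i) (Sum.inr j) a)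
    rw [tau_inr_inr, map_neg]

/-- Generators of the Steinberg Lie superalgebra are root elements. -/
theorem exists_rootStp_eq (x : StpGen 𝒜 m) : ∃ p q a, Far p q ∧
    toStp m bar (FreeNonUnitalNonAssocAlgebra.of k x) = rootStp bar p q a := by
  rcases x with ⟨i, j, h, α, a⟩ | ⟨i, j, h, α, a⟩ | ⟨i, j, h, α, a⟩
  · exact ⟨Sum.inl i, Sum.inl j, a, h, (tStp_coe bar h a).symm⟩
  · exact ⟨Sum.inl i, Sum.inr j, a, h, (fStp_coe bar h a).symm⟩
  · exact ⟨Sum.inr i, Sum.inl j, a, h, (gStp_coe bar h a).symm⟩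

/-! ### Relations between the root elements of the Steinberg Lie superalgebra -/

variable [Invertible (2 : k)]

theorem toStp_bracket (x y : Free k (StpGen 𝒜 m)) :
    (stpLie m bar).bracket (toStp m bar x) (toStp m bar y) = toStp m bar (x * y) := rfl

theorem rootStp_mem {p q : Fin m ⊕ Fin m} (h : Far p q) {α : ZMod 2} {a : R} (ha : a ∈ 𝒜 α) :
    rootStp bar p q a ∈ (stpLie m bar).grade (idx p + idx q + α) := by
  have hof : ∀ x : StpGen 𝒜 m, toStp m bar (FreeNonUnitalNonAssocAlgebra.of k x) ∈
      (stpLie m bar).grade x.parity := fun x => ⟨_, freeGrade_of x, rfl⟩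
  rcases p with i | i <;> rcases q with j | j
  · lift a to 𝒜 α using ha
    change tStp bar i j a ∈ _
    replace h : i ≠ j := h
    rw [tStp_coe bar h, show idx (Sum.inl i) + idx (Sum.inl j) + α = α by simp [idx]]
    exact hof (StpGen.t i j h α a)
  · lift a to 𝒜 α using ha
    change fStp bar i j a ∈ _
    replace h : i ≠ j := h
    rw [fStp_coe bar h, show idx (Sum.inl i) + idx (Sum.inr j) + α = α + 1 by
      simp [idx, add_comm]]
    exact hof (StpGen.f i j h α a)
  · lift a to 𝒜 α using ha
    change gStp bar i j a ∈ _
    replace h : i ≠ j := h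
    rw [gStp_coe bar h, show idx (Sum.inr i) + idx (Sum.inl j) + α = α + 1 by
      simp [idx, add_comm]]
    exact hof (StpGen.g i j h α a)
  · have ha := bar.map_mem ha
    change -tStp bar j i (bar.toFun a) ∈ _
    generalize bar.toFun a = b at *
    lift b to 𝒜 α using ha
    replace h : j ≠ i := Ne.symm h
    rw [tStp_coe bar h, show idx (Sum.inr i) + idx (Sum.inr j) + α = α by
      simp [idx, CharTwo.add_self_eq_zero]]
    exact neg_mem (hof (StpGen.t j i h α b))

theorem rootStp_bracket_ext {p q r s : Fin m ⊕ Fin m} {f : R →ₗ[k] R →ₗ[k] Stp m bar}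
    (h : ∀ α β, ∀ a ∈ 𝒜 α, ∀ b ∈ 𝒜 β, (stpLie m bar).bracket (rootStp bar p q a)
      (rootStp bar r s b) = f a b) (a b : R) :
    (stpLie m bar).bracket (rootStp bar p q a) (rootStp bar r s b) = f a b := by
  have : (stpLie m bar).bracket.compl₁₂ (rootStp bar p q) (rootStp bar r s) = f :=
    linearMap_ext_homogeneous₂ 𝒜 h
  exact LinearMap.congr_fun₂ this a b

/-- Reflection and skew-symmetry make the product rules for `p, q, r` and `r*, q*, p*` equivalent.
-/
theorem rootStp_mul_swap {p q r : Fin m ⊕ Fin m} (hpq : Far p q) (hqr : Far q r) (hpr : Far p r)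
    (h : ∀ a b, (stpLie m bar).bracket (rootStp bar r.swap q.swap a)
      (rootStp bar q.swap p.swap b) = rootStp bar r.swap p.swap (a * b)) (a b : R) :
    (stpLie m bar).bracket (rootStp bar p q a) (rootStp bar q r b) = rootStp bar p r (a * b) :=
  rootStp_bracket_ext bar (f := (LinearMap.mul k R).compr₂ (rootStp bar p r))
    (fun α β a ha b hb => by
      rw [(stpLie m bar).skew (rootStp_mem bar hpq ha) (rootStp_mem bar hqr hb),
        rootStp_star bar hpq, rootStp_star bar hqr, h, LinearMap.compr₂_apply,
        LinearMap.mul_apply', rootStp_star bar hpr, tau_mul bar p q r ha hb, map_zsmul,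
        neg_smul]) a b

theorem rootStp_mul {p q r : Fin m ⊕ Fin m} (hpq : Far p q) (hqr : Far q r) (hpr : Far p r)
    (a b : R) :
    (stpLie m bar).bracket (rootStp bar p q a) (rootStp bar q r b) = rootStp bar p r (a * b) := by
  have ttt : ∀ {i j l : Fin m}, i ≠ j → j ≠ l → i ≠ l → ∀ a b, (stpLie m bar).bracket
      (rootStp bar (Sum.inl i) (Sum.inl j) a) (rootStp bar (Sum.inl j) (Sum.inl l) b) =
      rootStp bar (Sum.inl i) (Sum.inl l) (a * b) := fun {i j l} h1 h2 h3 =>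
    rootStp_bracket_ext bar (f := (LinearMap.mul k R).compr₂ (tStp bar i l))
      fun α β a ha b hb => by
        lift a to 𝒜 α using ha
        lift b to 𝒜 β using hb
        change (stpLie m bar).bracket (tStp bar i j a) (tStp bar j l b) =
          tStp bar i l (hmul a b).1
        rw [tStp_coe bar h1, tStp_coe bar h2, tStp_coe bar h3, toStp_bracket]
        exact toStp_eq bar (StpRel.tt h1 h2 h3 a b)
  have tff : ∀ {i j l : Fin m}, i ≠ j → j ≠ l → i ≠ l → ∀ a b, (stpLie m bar).bracket
      (rootStp bar (Sum.inl i) (Sum.inl j) a) (rootStp bar (Sum.inl j) (Sum.inr l) b) =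
      rootStp bar (Sum.inl i) (Sum.inr l) (a * b) := fun {i j l} h1 h2 h3 =>
    rootStp_bracket_ext bar (f := (LinearMap.mul k R).compr₂ (fStp bar i l))
      fun α β a ha b hb => by
        lift a to 𝒜 α using ha
        lift b to 𝒜 β using hb
        change (stpLie m bar).bracket (tStp bar i j a) (fStp bar j l b) =
          fStp bar i l (hmul a b).1
        rw [tStp_coe bar h1, fStp_coe bar h2, fStp_coe bar h3, toStp_bracket]
        exact toStp_eq bar (StpRel.tf h1 h2 h3 a b)
  have gtg : ∀ {i j l : Fin m}, i ≠ j → j ≠ l → i ≠ l → ∀ a b, (stpLie m bar).bracket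
      (rootStp bar (Sum.inr i) (Sum.inl j) a) (rootStp bar (Sum.inl j) (Sum.inl l) b) =
      rootStp bar (Sum.inr i) (Sum.inl l) (a * b) := fun {i j l} h1 h2 h3 =>
    rootStp_bracket_ext bar (f := (LinearMap.mul k R).compr₂ (gStp bar i l))
      fun α β a ha b hb => by
        lift a to 𝒜 α using ha
        lift b to 𝒜 β using hb
        change (stpLie m bar).bracket (gStp bar i j a) (tStp bar j l b) =
          gStp bar i l (hmul a b).1
        rw [gStp_coe bar h1, tStp_coe bar h2, gStp_coe bar h3, toStp_bracket]
        exact toStp_eq bar (StpRel.gt h1 h2 h3 a b)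
  have fgt : ∀ {i j l : Fin m}, i ≠ j → j ≠ l → i ≠ l → ∀ a b, (stpLie m bar).bracket
      (rootStp bar (Sum.inl i) (Sum.inr j) a) (rootStp bar (Sum.inr j) (Sum.inl l) b) =
      rootStp bar (Sum.inl i) (Sum.inl l) (a * b) := fun {i j l} h1 h2 h3 =>
    rootStp_bracket_ext bar (f := (LinearMap.mul k R).compr₂ (tStp bar i l))
      fun α β a ha b hb => by
        lift a to 𝒜 α using ha
        lift b to 𝒜 β using hb
        change (stpLie m bar).bracket (fStp bar i j a) (gStp bar j l b) =
          tStp bar i l (hmul a b).1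
        rw [fStp_coe bar h1, gStp_coe bar h2, tStp_coe bar h3, toStp_bracket]
        exact toStp_eq bar (StpRel.fg h1 h2 h3 a b)
  -- Four of the eight sign patterns are defining relations; the other four are their mirror images.
  rcases p with i | i <;> rcases q with j | j <;> rcases r with l | l
  · exact ttt hpq hqr hpr a b
  · exact tff hpq hqr hpr a b
  · exact fgt hpq hqr hpr a b
  · exact rootStp_mul_swap bar hpq hqr hpr (tff hqr.symm hpq.symm hpr.symm) a b
  · exact gtg hpq hqr hpr a b
  · exact rootStp_mul_swap bar hpq hqr hpr (fgt hqr.symm hpq.symm hpr.symm) a b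
  · exact rootStp_mul_swap bar hpq hqr hpr (gtg hqr.symm hpq.symm hpr.symm) a b
  · exact rootStp_mul_swap bar hpq hqr hpr (ttt hqr.symm hpq.symm hpr.symm) a b

theorem rootStp_zero_comm {p q r s : Fin m ⊕ Fin m} (hpq : Far p q) (hrs : Far r s)
    (h : ∀ a b, (stpLie m bar).bracket (rootStp bar r s a) (rootStp bar p q b) = 0) (a b : R) :
    (stpLie m bar).bracket (rootStp bar p q a) (rootStp bar r s b) = 0 :=
  rootStp_bracket_ext bar (f := 0) (fun _ _ a ha b hb =>
    (stpLie m bar).bracket_eq_zero_comm (rootStp_mem bar hrs hb) (rootStp_mem bar hpq ha)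
      (h b a)) a b

/-- The vanishing relations between generators. -/
theorem rootStp_zero_aux {p q r s : Fin m ⊕ Fin m} (hpq : Far p q) (hrs : Far r s)
    (h1 : q ≠ r) (h2 : p ≠ s) (h3 : q ≠ s.swap) (h4 : p ≠ r.swap)
    (h5 : ¬(p.isRight = true ∧ q.isRight = true)) (h6 : ¬(r.isRight = true ∧ s.isRight = true))
    (a b : R) : (stpLie m bar).bracket (rootStp bar p q a) (rootStp bar r s b) = 0 := by
  have tf : ∀ {i j l n : Fin m}, i ≠ j → l ≠ n → j ≠ l → n ≠ j → ∀ a b, (stpLie m bar).bracket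
      (rootStp bar (Sum.inl i) (Sum.inl j) a) (rootStp bar (Sum.inl l) (Sum.inr n) b) = 0 :=
    fun {i j l n} e1 e2 e3 e4 => rootStp_bracket_ext bar (f := 0) fun α β a ha b hb => by
        lift a to 𝒜 α using ha
        lift b to 𝒜 β using hb
        change (stpLie m bar).bracket (tStp bar i j a) (fStp bar l n b) = 0
        rw [tStp_coe bar e1, fStp_coe bar e2, toStp_bracket]
        exact toStp_eq_zero bar (StpRel.tf_zero e1 e3 e2 e4 a b)
  have gt : ∀ {i j l n : Fin m}, i ≠ j → l ≠ n → l ≠ j → i ≠ l → ∀ a b, (stpLie m bar).bracket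
      (rootStp bar (Sum.inr i) (Sum.inl j) a) (rootStp bar (Sum.inl l) (Sum.inl n) b) = 0 :=
    fun {i j l n} e1 e2 e3 e4 => rootStp_bracket_ext bar (f := 0) fun α β a ha b hb => by
        lift a to 𝒜 α using ha
        lift b to 𝒜 β using hb
        change (stpLie m bar).bracket (gStp bar i j a) (tStp bar l n b) = 0
        rw [gStp_coe bar e1, tStp_coe bar e2, toStp_bracket]
        exact toStp_eq_zero bar (StpRel.gt_zero e1 e2 e3 e4 a b)
  have fg : ∀ {i j l n : Fin m}, i ≠ j → l ≠ n → i ≠ l → i ≠ n → j ≠ l → j ≠ n → ∀ a b,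
      (stpLie m bar).bracket (rootStp bar (Sum.inl i) (Sum.inr j) a)
        (rootStp bar (Sum.inr l) (Sum.inl n) b) = 0 :=
    fun {i j l n} e1 e2 e3 e4 e5 e6 => rootStp_bracket_ext bar (f := 0) fun α β a ha b hb => by
        lift a to 𝒜 α using ha
        lift b to 𝒜 β using hb
        change (stpLie m bar).bracket (fStp bar i j a) (gStp bar l n b) = 0
        rw [fStp_coe bar e1, gStp_coe bar e2, toStp_bracket]
        exact toStp_eq_zero bar (StpRel.fg_zero e1 e3 e4 e5 e6 e2 a b)
  rcases p with i | i <;> rcases q with j | j <;> rcases r with l | l <;> rcases s with n | n <;>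
    simp only [Sum.isRight_inl, Sum.isRight_inr, and_self, not_true, not_false_eq_true,
      Sum.swap_inl, Sum.swap_inr, ne_eq, Sum.inl.injEq, Sum.inr.injEq, reduceCtorEq] at h1 h2 h3 h4 h5 h6
  · refine rootStp_bracket_ext bar (f := 0) (fun α β a ha b hb => ?_) a b
    lift a to 𝒜 α using ha
    lift b to 𝒜 β using hb
    change (stpLie m bar).bracket (tStp bar i j a) (tStp bar l n b) = 0
    replace hpq : i ≠ j := hpq
    replace hrs : l ≠ n := hrs
    rw [tStp_coe bar hpq, tStp_coe bar hrs, toStp_bracket]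
    exact toStp_eq_zero bar (StpRel.tt_zero hpq h1 hrs (Ne.symm h2) a b)
  · exact tf hpq hrs h1 (Ne.symm h3) a b
  · exact rootStp_zero_comm bar hpq hrs (gt hrs hpq h2 (Ne.symm h4)) a b
  · exact rootStp_zero_comm bar hpq hrs (tf hrs hpq (Ne.symm h2) h3) a b
  · refine rootStp_bracket_ext bar (f := 0) (fun α β a ha b hb => ?_) a b
    lift a to 𝒜 α using ha
    lift b to 𝒜 β using hb
    change (stpLie m bar).bracket (fStp bar i j a) (fStp bar l n b) = 0
    replace hpq : i ≠ j := hpq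
    replace hrs : l ≠ n := hrs
    rw [fStp_coe bar hpq, fStp_coe bar hrs, toStp_bracket]
    exact toStp_eq_zero bar (StpRel.ff hpq hrs a b)
  · exact fg hpq hrs h4 h2 h1 h3 a b
  · exact gt hpq hrs (Ne.symm h1) h4 a b
  · exact rootStp_zero_comm bar hpq hrs
      (fg hrs hpq (Ne.symm h4) (Ne.symm h1) (Ne.symm h2) (Ne.symm h3)) a b
  · refine rootStp_bracket_ext bar (f := 0) (fun α β a ha b hb => ?_) a b
    lift a to 𝒜 α using ha
    lift b to 𝒜 β using hb
    change (stpLie m bar).bracket (gStp bar i j a) (gStp bar l n b) = 0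
    replace hpq : i ≠ j := hpq
    replace hrs : l ≠ n := hrs
    rw [gStp_coe bar hpq, gStp_coe bar hrs, toStp_bracket]
    exact toStp_eq_zero bar (StpRel.gg hpq hrs a b)

theorem rootStp_system : PeriplecticSystem bar (stpLie m bar) (rootStp bar) where
  mem h _ _ ha := rootStp_mem bar h ha
  star h a := rootStp_star bar h a
  mul h1 h2 h3 a b := rootStp_mul bar h1 h2 h3 a b
  zero {p q r s} hpq hrs h1 h2 h3 h4 a b := by
    have swap_eq : ∀ {x y : Fin m ⊕ Fin m}, x.swap = y → x = y.swap := by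
      rintro x _ rfl
      rw [Sum.swap_swap]
    have key : ∀ {p q : Fin m ⊕ Fin m}, p.isRight = true ∧ q.isRight = true →
        ¬(q.swap.isRight = true ∧ p.swap.isRight = true) := by
      rintro (i | i) (j | j) ⟨h, h'⟩ ⟨h'', -⟩ <;>
        revert h h' h'' <;> simp
    -- A root element with both indices in the second copy is the reflection of one with both in the
    -- first, which reduces everything to brackets between generators.
    by_cases h5 : p.isRight = true ∧ q.isRight = true
    · rw [rootStp_star bar hpq]
      have hpq' : Far q.swap p.swap := by simpa using hpq.symm
      by_cases h6 : r.isRight = true ∧ s.isRight = true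
      · rw [rootStp_star bar hrs]
        exact rootStp_zero_aux bar hpq' (by simpa using hrs.symm)
          (fun e => h2 (Sum.swap_leftInverse.injective e))
          (fun e => h1 (Sum.swap_leftInverse.injective e))
          (fun e => h4 (by rw [swap_eq e, Sum.swap_swap]))
          (fun e => h3 (by rw [swap_eq e, Sum.swap_swap])) (key h5) (key h6) _ _
      · exact rootStp_zero_aux bar hpq' hrs (fun e => h4 (swap_eq e)) (fun e => h3 (swap_eq e))
          (fun e => h2 (Sum.swap_leftInverse.injective e))
          (fun e => h1 (Sum.swap_leftInverse.injective e)) (key h5) h6 _ _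
    · by_cases h6 : r.isRight = true ∧ s.isRight = true
      · rw [rootStp_star bar hrs]
        exact rootStp_zero_aux bar hpq (by simpa using hrs.symm) h3 h4
          (fun e => h1 (by rw [e, Sum.swap_swap])) (fun e => h2 (by rw [e, Sum.swap_swap]))
          h5 (key h6) _ _
      · exact rootStp_zero_aux bar hpq hrs h1 h2 h3 h4 h5 h6 a b

/-- The span contains the generators and is stable under bracketing with them. -/
theorem rootStp_fullSpan (hm : 3 ≤ m) :
    PeriplecticSystem.fullSpan (stpLie m bar) (rootStp bar) hm = ⊤ := by
  refine presented_eq_top_of_ad (stpRels_homog m bar) (fun x => ?_) (fun x y hy => ?_)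
  · obtain ⟨p, q, a, h, e⟩ := exists_rootStp_eq bar x
    change toStp m bar _ ∈ _
    rw [e]
    exact PeriplecticSystem.short_mem_fullSpan hm h a
  · obtain ⟨p, q, a, h, e⟩ := exists_rootStp_eq bar x
    change (stpLie m bar).bracket (toStp m bar _) y ∈ _
    rw [e]
    exact (rootStp_system bar).bracket_mem_fullSpan hm h a hy

/-! ### The homomorphism to the central extension -/

/-- The images of the generators in the central extension. -/
def genExt : StpGen 𝒜 m → Mat m R × DihedralQuotient bar.twist
  | .t i j _ _ a => rootExt bar (Sum.inl i) (Sum.inl j) a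
  | .f i j _ _ a => rootExt bar (Sum.inl i) (Sum.inr j) a
  | .g i j _ _ a => rootExt bar (Sum.inr i) (Sum.inl j) a

theorem genExt_mem (x : StpGen 𝒜 m) :
    genExt bar x ∈ (matExt m bar.twist).grade x.parity := by
  have hs := rootExt_system (m := m) bar
  rcases x with ⟨i, j, h, α, a⟩ | ⟨i, j, h, α, a⟩ | ⟨i, j, h, α, a⟩
  · have := hs.mem (p := Sum.inl i) (q := Sum.inl j) h a.2
    rwa [show idx (Sum.inl i) + idx (Sum.inl j) + α = α by simp [idx]] at this
  · have := hs.mem (p := Sum.inl i) (q := Sum.inr j) h a.2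
    rwa [show idx (Sum.inl i) + idx (Sum.inr j) + α = α + 1 by simp [idx, add_comm]] at this
  · have := hs.mem (p := Sum.inr i) (q := Sum.inl j) h a.2
    rwa [show idx (Sum.inr i) + idx (Sum.inl j) + α = α + 1 by simp [idx, add_comm]] at this

/-- Each defining relation is linearity, or an instance of `star`, `mul` or `zero` in the central
extension. -/
theorem freeLift_genExt {r : Free k (StpGen 𝒜 m)} (h : StpRel bar r) :
    (matExt m bar.twist).freeLift (genExt bar) r = 0 := by
  have hs := rootExt_system (m := m) bar
  have ht : ∀ {i j : Fin m} (h : i ≠ j) {α} (a : 𝒜 α), (matExt m bar.twist).freeLift (genExt bar)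
      (tF h a) = rootExt bar (Sum.inl i) (Sum.inl j) a := fun h _ a =>
    (matExt m bar.twist).freeLift_of (genExt bar) (StpGen.t _ _ h _ a)
  have hf : ∀ {i j : Fin m} (h : i ≠ j) {α} (a : 𝒜 α), (matExt m bar.twist).freeLift (genExt bar)
      (fF h a) = rootExt bar (Sum.inl i) (Sum.inr j) a := fun h _ a =>
    (matExt m bar.twist).freeLift_of (genExt bar) (StpGen.f _ _ h _ a)
  have hg : ∀ {i j : Fin m} (h : i ≠ j) {α} (a : 𝒜 α), (matExt m bar.twist).freeLift (genExt bar)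
      (gF h a) = rootExt bar (Sum.inr i) (Sum.inl j) a := fun h _ a =>
    (matExt m bar.twist).freeLift_of (genExt bar) (StpGen.g _ _ h _ a)
  have hmul : ∀ {α β} (a : 𝒜 α) (b : 𝒜 β), ((hmul a b : 𝒜 (α + β)) : R) = a * b :=
    fun _ _ => rfl
  cases h with
  | t_add h a b => simp [ht]
  | t_smul h c a => simp [ht]
  | f_add h a b => simp [hf]
  | f_smul h c a => simp [hf]
  | g_add h a b => simp [hg]
  | g_smul h c a => simp [hg]
  | @f_bar i j h α a =>
    rw [map_sub, hf, hf, rootExt_apply, rootExt_apply, rootMat_star, tau_inl_inr]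
    simp [hbar, hrho, bar.invol]
  | @g_bar i j h α a =>
    rw [map_add, hg, hg, rootExt_apply, rootExt_apply, rootMat_star, tau_inr_inl]
    simp [hbar, hrho, bar.invol]
  | @tt i j l hij hjl hil α β a b =>
    rw [map_sub, LieSuperalgebra.freeLift_mul, ht, ht, ht, hmul]
    exact sub_eq_zero.2 (hs.mul (p := Sum.inl i) (q := Sum.inl j) (r := Sum.inl l) hij hjl hil _ _)
  | @tt_zero i j l n hij hjl hln hni α β a b =>
    rw [LieSuperalgebra.freeLift_mul, ht, ht]
    exact hs.zero (p := Sum.inl i) (q := Sum.inl j) (r := Sum.inl l) (s := Sum.inl n) hij hln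
      (by simpa using hjl) (by simpa using hni.symm) (by simp) (by simp) _ _
  | @tf i j l hij hjl hil α β a b =>
    rw [map_sub, LieSuperalgebra.freeLift_mul, ht, hf, hf, hmul]
    exact sub_eq_zero.2 (hs.mul (p := Sum.inl i) (q := Sum.inl j) (r := Sum.inr l) hij hjl hil _ _)
  | @tf_zero i j l n hij hjl hln hnj α β a b =>
    rw [LieSuperalgebra.freeLift_mul, ht, hf]
    exact hs.zero (p := Sum.inl i) (q := Sum.inl j) (r := Sum.inl l) (s := Sum.inr n) hij hln
      (by simpa using hjl) (by simp) (by simpa using hnj.symm) (by simp) _ _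
  | @gt i j l hij hjl hil α β a b =>
    rw [map_sub, LieSuperalgebra.freeLift_mul, hg, ht, hg, hmul]
    exact sub_eq_zero.2 (hs.mul (p := Sum.inr i) (q := Sum.inl j) (r := Sum.inl l) hij hjl hil _ _)
  | @gt_zero i j l n hij hln hlj hil α β a b =>
    rw [LieSuperalgebra.freeLift_mul, hg, ht]
    exact hs.zero (p := Sum.inr i) (q := Sum.inl j) (r := Sum.inl l) (s := Sum.inl n) hij hln
      (by simpa using hlj.symm) (by simp) (by simp) (by simpa using hil) _ _
  | @ff i j l n hij hln α β a b =>
    rw [LieSuperalgebra.freeLift_mul, hf, hf]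
    exact hs.zero (p := Sum.inl i) (q := Sum.inr j) (r := Sum.inl l) (s := Sum.inr n) hij hln
      (by simp) (by simp) (by simp) (by simp) _ _
  | @gg i j l n hij hln α β a b =>
    rw [LieSuperalgebra.freeLift_mul, hg, hg]
    exact hs.zero (p := Sum.inr i) (q := Sum.inl j) (r := Sum.inr l) (s := Sum.inl n) hij hln
      (by simp) (by simp) (by simp) (by simp) _ _
  | @fg i j l hij hjl hil α β a b =>
    rw [map_sub, LieSuperalgebra.freeLift_mul, hf, hg, ht, hmul]
    exact sub_eq_zero.2 (hs.mul (p := Sum.inl i) (q := Sum.inr j) (r := Sum.inl l) hij hjl hil _ _)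
  | @fg_zero i j l n hij hil hin hjl hjn hln α β a b =>
    rw [LieSuperalgebra.freeLift_mul, hf, hg]
    exact hs.zero (p := Sum.inl i) (q := Sum.inr j) (r := Sum.inr l) (s := Sum.inl n) hij hln
      (by simpa using hjl) (by simpa using hin) (by simpa using hjn) (by simpa using hil) _ _

variable (m) in
/-- The homomorphism from the Steinberg Lie superalgebra to the central extension. -/
def stpToExt : LieSuperHom (stpLie m bar) (matExt m bar.twist) :=
  presentedHom (stpRels_homog m bar) (matExt m bar.twist) (genExt bar) (genExt_mem bar)
    fun _ hr => freeLift_genExt bar hr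

theorem stpToExt_of (x : StpGen 𝒜 m) :
    (stpToExt m bar).toLinearMap (toStp m bar (FreeNonUnitalNonAssocAlgebra.of k x)) =
      genExt bar x :=
  (matExt m bar.twist).freeLift_of (genExt bar) x

theorem stpToExt_root (p q : Fin m ⊕ Fin m) (a : R) (h : Far p q) :
    (stpToExt m bar).toLinearMap (rootStp bar p q a) = rootExt bar p q a := by
  have : ((stpToExt m bar).toLinearMap ∘ₗ rootStp bar p q) = rootExt bar p q := by
    refine linearMap_ext_homogeneous 𝒜 fun α a ha => ?_
    change (stpToExt m bar).toLinearMap (rootStp bar p q a) = _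
    rcases p with i | i <;> rcases q with j | j
    · lift a to 𝒜 α using ha
      change (stpToExt m bar).toLinearMap (tStp bar i j a) = _
      replace h : i ≠ j := h
      rw [tStp_coe bar h]
      exact stpToExt_of bar (StpGen.t i j h α a)
    · lift a to 𝒜 α using ha
      change (stpToExt m bar).toLinearMap (fStp bar i j a) = _
      replace h : i ≠ j := h
      rw [fStp_coe bar h]
      exact stpToExt_of bar (StpGen.f i j h α a)
    · lift a to 𝒜 α using ha
      change (stpToExt m bar).toLinearMap (gStp bar i j a) = _
      replace h : i ≠ j := h
      rw [gStp_coe bar h]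
      exact stpToExt_of bar (StpGen.g i j h α a)
    · rw [rootStp_star bar h, rootExt_apply, rootMat_star]
      have ha' := tau_mem bar (Sum.inr i) (Sum.inr j) ha
      generalize tau bar (Sum.inr i) (Sum.inr j) a = b at *
      lift b to 𝒜 α using ha'
      change (stpToExt m bar).toLinearMap (tStp bar j i b) = _
      replace h : j ≠ i := Ne.symm h
      rw [tStp_coe bar h]
      exact stpToExt_of bar (StpGen.t j i h α b)
  exact LinearMap.congr_fun this a

end Stp

/-! ### Root matrices span the periplectic Lie superalgebra -/

section Span

variable {k R : Type*} [CommRing k] [Ring R] [Algebra k R]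
  {𝒜 : ZMod 2 → Submodule k R} [GradedAlgebra 𝒜] {m : ℕ} (bar : SuperInvolution 𝒜)

theorem prp_single (p q : Fin m ⊕ Fin m) (a : R) : (prp m bar).toFun (Matrix.single p q a) =
    -Matrix.single q.swap p.swap (tau bar p q a) := by
  refine homogeneous_induction 𝒜 (P := fun a => (prp m bar).toFun (Matrix.single p q a) =
    -Matrix.single q.swap p.swap (tau bar p q a)) (fun α a ha => ?_)
    (fun a b h h' => by rw [Matrix.single_add, map_add, map_add, Matrix.single_add, h, h',
      neg_add]) a
  change prpFun m bar _ = _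
  ext x y
  rw [prpFun_apply m bar (single_mem p q ha), Matrix.neg_apply]
  by_cases h : q.swap = x ∧ p.swap = y
  · obtain ⟨rfl, rfl⟩ := h
    rw [Sum.swap_swap, Sum.swap_swap, Matrix.single_apply_same, Matrix.single_apply_same,
      tau_of_mem bar p q ha, ← neg_smul]
    congr 1
    rw [idx_swap, idx_swap]
    generalize idx p = x, idx q = y
    clear ha
    revert x y α; decide
  · rw [Matrix.single_apply_of_ne _ _ _ _ _ h, Matrix.single_apply_of_ne _ _ _ _ _ (fun h' => h
      ⟨by rw [h'.2, Sum.swap_swap], by rw [h'.1, Sum.swap_swap]⟩), map_zero, smul_zero, neg_zero]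

theorem rootMat_mem_pTilde (p q : Fin m ⊕ Fin m) (a : R) :
    rootMat bar p q a ∈ (pTilde m bar).carrier := by
  change (prp m bar).toFun (rootMat bar p q a) = -rootMat bar p q a
  rw [rootMat_apply, map_add, prp_single, prp_single, tau_tau, Sum.swap_swap, Sum.swap_swap,
    neg_add, add_comm]

/-- The first units of the root matrices sum to `X`, the reflected ones to `-prp X = X`. -/
theorem sum_rootMat {X : Mat m R} (hX : X ∈ (pTilde m bar).carrier) :
    ∑ p, ∑ q, rootMat bar p q (X p q) = X + X := by
  have h1 : ∑ p, ∑ q, Matrix.single p q (X p q) = X := (Matrix.matrix_eq_sum_single X).symm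
  have h2 : ∑ p, ∑ q, Matrix.single q.swap p.swap (tau bar p q (X p q)) = X := by
    have h : (prp m bar).toFun X = -X := hX
    rw [← neg_inj, ← h]
    conv_rhs => rw [← h1]
    simp only [map_sum, prp_single, Finset.sum_neg_distrib]
  simp only [rootMat_apply, Finset.sum_add_distrib]
  rw [h1, h2]

/-! ### Generation of `𝔭ₘ` by off-diagonal root matrices -/

variable {N : Submodule k (Mat m R)}

/-- A diagonal root matrix acts on an off-diagonal one without changing its position, up to
reflection. -/
theorem bracket_rootMat_self_mem (hroot : ∀ p q a, p ≠ q → rootMat bar p q a ∈ N)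
    {p r s : Fin m ⊕ Fin m} (hrs : r ≠ s) {α β : ZMod 2} {a b : R} (ha : a ∈ 𝒜 α) (hb : b ∈ 𝒜 β) :
    superBracket (matGrade 𝒜 m) (rootMat bar p p a) (rootMat bar r s b) ∈ N := by
  rw [rootMat_bracket bar _ _ _ _ ha hb]
  have hrs' : s.swap ≠ r.swap := fun e => hrs (Sum.swap_leftInverse.injective e).symm
  refine sub_mem (add_mem ?_ ?_) (zsmul_mem (add_mem ?_ ?_) _)
  · split_ifs with h
    · exact hroot _ _ _ (h ▸ hrs)
    · exact zero_mem _
  · split_ifs with h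
    · exact hroot _ _ _ (h ▸ hrs')
    · exact zero_mem _
  · split_ifs with h
    · exact hroot _ _ _ (h ▸ hrs)
    · exact zero_mem _
  · split_ifs with h
    · exact hroot _ _ _ (h ▸ hrs')
    · exact zero_mem _

/-- Up to a diagonal root matrix at a far index `t`, which commutes with the one at `p`, the
diagonal matrix at `r` is `[u_{rt}(b), u_{tr}(1)]`. The Jacobi identity then reduces to brackets of
diagonal with off-diagonal matrices. -/
theorem bracket_rootMat_self_self_mem
    (hN : ∀ X ∈ N, ∀ Y ∈ N, superBracket (matGrade 𝒜 m) X Y ∈ N)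
    (hroot : ∀ p q a, p ≠ q → rootMat bar p q a ∈ N) (hm : 3 ≤ m)
    (p r : Fin m ⊕ Fin m) {α β : ZMod 2} {a b : R} (ha : a ∈ 𝒜 α) (hb : b ∈ 𝒜 β) :
    superBracket (matGrade 𝒜 m) (rootMat bar p p a) (rootMat bar r r b) ∈ N := by
  obtain ⟨t, htp, htr⟩ := exists_far hm p r
  have h1 : (1 : R) ∈ 𝒜 0 := SetLike.one_mem_graded 𝒜
  have e := rootMat_bracket bar r t t r hb h1
  rw [if_pos rfl, if_neg htr.ne_swap, if_pos rfl, if_neg htr.swap_ne, add_zero, add_zero, mul_one,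
    one_mul, eq_sub_iff_add_eq] at e
  have h0 : superBracket (matGrade 𝒜 m) (rootMat bar p p a) (rootMat bar t t b) = 0 := by
    rw [rootMat_bracket bar _ _ _ _ ha hb, if_neg htp.symm.ne, if_neg htp.symm.ne_swap,
      if_neg htp.ne, if_neg htp.swap_ne]
    simp
  rw [← e, add_zero, map_add, map_zsmul, h0, smul_zero, add_zero]
  have hj := (superLie (matGrade 𝒜 m)).jacobi (rootMat_mem bar p p ha) (rootMat_mem bar r t hb)
    (rootMat_mem bar t r h1)
  rw [show superBracket (matGrade 𝒜 m) (rootMat bar p p a)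
    (superBracket (matGrade 𝒜 m) (rootMat bar r t b) (rootMat bar t r 1)) = _ from hj]
  exact add_mem (hN _ (bracket_rootMat_self_mem bar hroot htr.symm.ne ha hb) _
    (hroot _ _ _ htr.ne)) (zsmul_mem (hN _ (hroot _ _ _ htr.symm.ne) _
      (bracket_rootMat_self_mem bar hroot htr.ne ha h1)) _)

/-- A Lie sub-superalgebra that contains the root matrices off the diagonal contains the brackets
of all root matrices. -/
theorem bracket_rootMat_mem
    (hN : ∀ X ∈ N, ∀ Y ∈ N, superBracket (matGrade 𝒜 m) X Y ∈ N)
    (hroot : ∀ p q a, p ≠ q → rootMat bar p q a ∈ N) (hm : 3 ≤ m)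
    (p q r s : Fin m ⊕ Fin m) (a b : R) :
    superBracket (matGrade 𝒜 m) (rootMat bar p q a) (rootMat bar r s b) ∈ N := by
  refine homogeneous_induction 𝒜 (P := fun a => superBracket (matGrade 𝒜 m) (rootMat bar p q a)
    (rootMat bar r s b) ∈ N) (fun α a ha => ?_) (fun a b h h' => by
      rw [map_add, map_add, LinearMap.add_apply]; exact add_mem h h') a
  refine homogeneous_induction 𝒜 (P := fun b => superBracket (matGrade 𝒜 m) (rootMat bar p q a)
    (rootMat bar r s b) ∈ N) (fun β b hb => ?_) (fun a b h h' => by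
      rw [map_add, map_add]; exact add_mem h h') b
  by_cases hpq : p = q
  · subst hpq
    by_cases hrs : r = s
    · subst hrs
      exact bracket_rootMat_self_self_mem bar hN hroot hm p r ha hb
    · exact bracket_rootMat_self_mem bar hroot hrs ha hb
  · by_cases hrs : r = s
    · subst hrs
      rw [show superBracket (matGrade 𝒜 m) (rootMat bar p q a) (rootMat bar r r b) = _ from
        (superLie (matGrade 𝒜 m)).skew (rootMat_mem bar p q ha) (rootMat_mem bar r r hb)]
      exact neg_mem (zsmul_mem (bracket_rootMat_self_mem bar hroot hpq hb ha) _)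
    · exact hN _ (hroot _ _ _ hpq) _ (hroot _ _ _ hrs)

theorem toMat_mem [Invertible (2 : k)]
    (hN : ∀ X ∈ N, ∀ Y ∈ N, superBracket (matGrade 𝒜 m) X Y ∈ N)
    (hroot : ∀ p q a, p ≠ q → rootMat bar p q a ∈ N) (hm : 3 ≤ m) (z : P m bar) :
    toMat m bar z ∈ N := by
  have hle : (derived (pTilde m bar).lie).carrier ≤ N.comap (pTilde m bar).carrier.subtype := by
    refine Submodule.span_le.2 ?_
    rintro _ ⟨⟨X, hX⟩, ⟨Y, hY⟩, rfl⟩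
    change superBracket (matGrade 𝒜 m) X Y ∈ N
    -- The diagonal root matrices in this sum need not lie in `N`, but all brackets of root matrices
    -- do.
    have half : ∀ Z ∈ (pTilde m bar).carrier,
        Z = (⅟2 : k) • ∑ p, ∑ q, rootMat bar p q (Z p q) := fun Z hZ => by
      rw [sum_rootMat bar hZ, ← two_smul k Z, smul_smul, invOf_mul_self, one_smul]
    rw [half X hX, half Y hY]
    simp only [map_smul, LinearMap.smul_apply, map_sum, LinearMap.sum_apply]
    exact N.smul_mem _ (sum_mem fun r _ => sum_mem fun s _ => N.smul_mem _ (sum_mem fun p _ =>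
      sum_mem fun q _ => bracket_rootMat_mem bar hN hroot hm p q r s _ _))
  exact hle z.2

theorem toMat_injective : Function.Injective (toMat m bar) := fun _ _ h =>
  Subtype.ext (Subtype.ext h)

theorem rootMat_inl_inl (i j : Fin m) (a : R) :
    rootMat bar (Sum.inl i) (Sum.inl j) a = tMat m bar i j a := by
  rw [rootMat_apply, tau_inl_inl, ← Matrix.single_neg, ← sub_eq_add_neg]
  rfl

theorem rootMat_inl_inr (i j : Fin m) (a : R) :
    rootMat bar (Sum.inl i) (Sum.inr j) a = fMat m bar i j a := by
  rw [rootMat_apply, tau_inl_inr]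
  rfl

theorem rootMat_inr_inl (i j : Fin m) (a : R) :
    rootMat bar (Sum.inr i) (Sum.inl j) a = gMat m bar i j a := by
  rw [rootMat_apply, tau_inr_inl, ← Matrix.single_neg, ← sub_eq_add_neg]
  rfl

end Span

/-! ### The canonical homomorphism -/

section Canonical

variable {k R : Type*} [CommRing k] [Invertible (2 : k)] [Ring R] [Algebra k R]
  {𝒜 : ZMod 2 → Submodule k R} [GradedAlgebra 𝒜] {m : ℕ} (bar : SuperInvolution 𝒜)

variable (m) in
/-- The matrix component of the homomorphism to the central extension. -/
def stpToMat : Stp m bar →ₗ[k] Mat m R := LinearMap.fst k _ _ ∘ₗ (stpToExt m bar).toLinearMap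

theorem stpToMat_bracket (x y : Stp m bar) : stpToMat m bar ((stpLie m bar).bracket x y) =
    superBracket (matGrade 𝒜 m) (stpToMat m bar x) (stpToMat m bar y) :=
  congrArg Prod.fst ((stpToExt m bar).map_bracket x y)

theorem stpToMat_root {p q : Fin m ⊕ Fin m} (h : Far p q) (a : R) :
    stpToMat m bar (rootStp bar p q a) = rootMat bar p q a :=
  congrArg Prod.fst (stpToExt_root bar p q a h)

theorem stpToMat_mem_pTilde (x : Stp m bar) : stpToMat m bar x ∈ (pTilde m bar).carrier := by
  have : (pTilde m bar).carrier.comap (stpToMat m bar) = ⊤ := by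
    refine presented_eq_top (stpRels_homog m bar) (fun x => ?_) (fun x y hx hy => ?_)
    · obtain ⟨p, q, a, h, e⟩ := exists_rootStp_eq bar x
      change stpToMat m bar (toStp m bar _) ∈ (pTilde m bar).carrier
      rw [e, stpToMat_root bar h]
      exact rootMat_mem_pTilde bar p q a
    · change stpToMat m bar ((stpLie m bar).bracket x y) ∈ (pTilde m bar).carrier
      rw [stpToMat_bracket]
      exact (pTilde m bar).bracket_mem hx hy
  exact this.ge (Submodule.mem_top (x := x))

variable (m) in
/-- The matrix component as a map to `𝔭̃ₘ`. -/
def stpToPTilde : Stp m bar →ₗ[k] (pTilde m bar).carrier :=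
  LinearMap.codRestrict _ (stpToMat m bar) (stpToMat_mem_pTilde bar)

theorem stpToPTilde_bracket (x y : Stp m bar) : stpToPTilde m bar ((stpLie m bar).bracket x y) =
    (pTilde m bar).lie.bracket (stpToPTilde m bar x) (stpToPTilde m bar y) :=
  Subtype.ext (stpToMat_bracket bar x y)

theorem stpToPTilde_mem_derived (hm : 3 ≤ m) (x : Stp m bar) :
    stpToPTilde m bar x ∈ (derived (pTilde m bar).lie).carrier := by
  have : (derived (pTilde m bar).lie).carrier.comap (stpToPTilde m bar) = ⊤ := by
    refine presented_eq_top (stpRels_homog m bar) (fun x => ?_) (fun x y hx hy => ?_)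
    · obtain ⟨p, q, a, h, e⟩ := exists_rootStp_eq bar x
      obtain ⟨r, hrp, hrq⟩ := exists_far hm p q
      change stpToPTilde m bar (toStp m bar _) ∈ (derived (pTilde m bar).lie).carrier
      -- Each generator is itself a bracket, `u_{pq}(a) = [u_{pr}(a), u_{rq}(1)]`.
      rw [e, ← mul_one a, ← rootStp_mul bar hrp.symm hrq h, stpToPTilde_bracket]
      exact Submodule.subset_span ⟨_, _, rfl⟩
    · change stpToPTilde m bar ((stpLie m bar).bracket x y) ∈ (derived (pTilde m bar).lie).carrier
      rw [stpToPTilde_bracket]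
      exact (derived (pTilde m bar).lie).bracket_mem hx hy
  exact this.ge (Submodule.mem_top (x := x))

/-- The canonical homomorphism `𝔰𝔱𝔭ₘ → 𝔭ₘ`. -/
def stpToP (hm : 3 ≤ m) : LieSuperHom (stpLie m bar) (pLie m bar) where
  toLinearMap := LinearMap.codRestrict _ (stpToPTilde m bar) (stpToPTilde_mem_derived bar hm)
  map_grade hx := ((stpToExt m bar).map_grade hx).1
  map_bracket x y := Subtype.ext (stpToPTilde_bracket bar x y)

theorem toMat_stpToP (hm : 3 ≤ m) (x : Stp m bar) :
    toMat m bar ((stpToP bar hm).toLinearMap x) = stpToMat m bar x := rfl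

theorem isCanonical_stpToP (hm : 3 ≤ m) : IsCanonical m bar (stpToP bar hm) := by
  intro i j h α a
  rw [toMat_stpToP, toMat_stpToP, toMat_stpToP, ← rootMat_inl_inl, ← rootMat_inl_inr,
    ← rootMat_inr_inl]
  exact ⟨congrArg Prod.fst (stpToExt_of bar (StpGen.t i j h α a)),
    congrArg Prod.fst (stpToExt_of bar (StpGen.f i j h α a)),
    congrArg Prod.fst (stpToExt_of bar (StpGen.g i j h α a))⟩

theorem IsCanonical.unique {φ ψ : LieSuperHom (stpLie m bar) (pLie m bar)}
    (hφ : IsCanonical m bar φ) (hψ : IsCanonical m bar ψ) : φ = ψ := by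
  refine presentedHom_ext (stpRels_homog m bar) fun x => toMat_injective bar ?_
  rcases x with ⟨i, j, h, α, a⟩ | ⟨i, j, h, α, a⟩ | ⟨i, j, h, α, a⟩
  · exact (hφ i j h α a).1.trans (hψ i j h α a).1.symm
  · exact (hφ i j h α a).2.1.trans (hψ i j h α a).2.1.symm
  · exact (hφ i j h α a).2.2.trans (hψ i j h α a).2.2.symm

theorem stpToP_surjective (hm : 3 ≤ m) : Function.Surjective (stpToP bar hm).toLinearMap := by
  intro z
  obtain ⟨x, hx⟩ : toMat m bar z ∈ LinearMap.range (stpToMat m bar) := by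
    refine toMat_mem bar ?_ (fun p q a hpq => ?_) hm z
    · rintro _ ⟨x, rfl⟩ _ ⟨y, rfl⟩
      exact ⟨_, stpToMat_bracket bar x y⟩
    · by_cases h : Far p q
      · exact ⟨_, stpToMat_root bar h a⟩
      · obtain rfl : q = p.swap := by
          rcases eq_or_eq_swap (not_not.1 h) with h | h
          · exact absurd h hpq
          · rw [h, Sum.swap_swap]
        -- The off-diagonal root matrices that are not images of short elements come from the long
        -- root elements.
        refine ⟨PeriplecticSystem.longRoot (stpLie m bar) (rootStp bar) hm p a, ?_⟩
        change ((stpToExt m bar).toLinearMap _).1 = _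
        rw [PeriplecticSystem.map_longRoot _ (stpToExt_root bar), rootExt_long]
        rfl
  exact ⟨x, toMat_injective bar hx⟩

/-- A bracket in the central extension depends only on matrix components, so `[x, y]` maps to zero
there; the retraction then gives `[x, y] = 0`. -/
theorem stpToP_central (hm : 3 ≤ m) {x : Stp m bar} (hx : (stpToP bar hm).toLinearMap x = 0)
    (y : Stp m bar) : (stpLie m bar).bracket x y = 0 := by
  have h1 : ((stpToExt m bar).toLinearMap x).1 = 0 := congrArg (toMat m bar) hx
  have h2 : (stpToExt m bar).toLinearMap ((stpLie m bar).bracket x y) = 0 := by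
    rw [(stpToExt m bar).map_bracket, matExt_bracket, h1, map_zero, map_zero]
    rfl
  rw [← (rootStp_system bar).retraction_comp hm (Sum.inl ⟨0, by omega⟩) (stpToExt m bar)
    (stpToExt_root bar) ((rootStp_fullSpan bar hm).ge
      (Submodule.mem_top (x := (stpLie m bar).bracket x y))), h2, map_zero]

theorem ker_stpToP (hm : 3 ≤ m) :
    LinearMap.ker (stpToP bar hm).toLinearMap = LinearMap.ker (stpToMat m bar) :=
  Submodule.ext fun _ => (toMat_injective bar).eq_iff.symm

end Canonical

end Periplectic

theorem mainTheorem4 {k R : Type*} [CommRing k] [Invertible (2 : k)] [Ring R] [Algebra k R]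
    (𝒜 : ZMod 2 → Submodule k R) [GradedAlgebra 𝒜] (bar : SuperInvolution 𝒜)
    (m : ℕ) (hm : 3 ≤ m) :
    (∃! ψ : LieSuperHom (stpLie m bar) (pLie m bar), IsCanonical m bar ψ) ∧
    ∀ ψ : LieSuperHom (stpLie m bar) (pLie m bar), IsCanonical m bar ψ →
      Function.Surjective ψ.toLinearMap ∧
      (∀ x, ψ.toLinearMap x = 0 → ∀ y, (stpLie m bar).bracket x y = 0) ∧
      Nonempty (LinearMap.ker ψ.toLinearMap ≃ₗ[k] dihedralHomology bar.twist) := by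
  refine ⟨⟨stpToP bar hm, isCanonical_stpToP bar hm,
    fun ψ hψ => IsCanonical.unique bar hψ (isCanonical_stpToP bar hm)⟩, fun ψ hψ => ?_⟩
  obtain rfl := IsCanonical.unique bar hψ (isCanonical_stpToP bar hm)
  obtain ⟨e⟩ := (rootStp_system bar).exists_kernel_equiv hm (stpToExt m bar) (stpToExt_root bar)
    (rootStp_fullSpan bar hm)
  exact ⟨stpToP_surjective bar hm, fun _ hx y => stpToP_central bar hm hx y,
    ⟨(LinearEquiv.ofEq _ _ (ker_stpToP bar hm)).trans e⟩⟩
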